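/- Let $k$ be an algebraically closed field of characteristic $p>0$. **Hilbert–Kunz multiplicity.** For a $k$-algebra $R$ and an ideal $I$, let $I^{[p^e]}$ be the ideal generated by all $f^{p^e}$, $f\in I$, and put $\mathrm{HKM}(I,R)=\lim_{e\to\infty}\dim_k(R/I^{[p^e]})/p^{e\dim R}$. **Han's function.** For non-zero homogeneous $F_1,F_2,F_3\in k[X,Y]$ of degrees $d_1,d_2,d_3$ put $\mathrm{sg}(F_1,F_2,F_3)=d_1+d_2+d_3-2m$, where $m$ is the smallest degree of a non-trivial homogeneous syzygy of $(F_1,F_2,F_3)$. There is exactly one continuous function $\delta:[0,\infty)^3\to\mathbb R$ with $\delta\left(\frac{n_1}{p^e},\frac{n_2}{p^e},\frac{n_3}{p^e}\right)=p^{-e}\,\mathrm{sg}(X^{n_1},Y^{n_2},(X+Y)^{n_3})$ for all $n_i,e\in\mathbb N=\{0,1,2,\dots\}$. **Trinomials.** Let $F=X^{a_1}Y^{a_2}Z^{a_3}+X^{b_1}Y^{b_2}Z^{b_3}+X^{c_1}Y^{c_2}Z^{c_3}\in k[X,Y,Z]$, with three distinct monomials, be irreducible, homogeneous of degree $d$ and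 regular, i.e. each of the points $(1:0:0)$, $(0:1:0)$, $(0:0:1)$ has multiplicity $<\frac d2$ on the projective curve $F=0$. Then, after a permutation of the variables and a permutation of the three monomials, $F$ is of * type I: $a_1,b_2,c_3>\frac d2$ and $a_3=b_1=c_2=0$, or * type II: $a_1=d$, $a_2=a_3=0$, $b_2,c_3>\frac d2$ and $c_1=0$. If $F$ is of type I or II, the determinant of the matrix with columns $(a_i),(b_i),(c_i)$ equals $d\lambda$ with a positive integer $\lambda$. For $t\in[0,\infty)^3$ put $$\begin{aligned}\alpha'(t)&=t_1d-t_1b_3-t_1c_2-t_2c_1-t_3b_1,\\ \beta'(t)&=t_2d-t_2c_1-t_3a_2-t_1c_2-t_2a_3,\\ \gamma'(t)&=t_3d-t_3a_2-t_1b_3-t_3b_1-t_2a_3,\end{aligned}$$ let $x_+=\max(x,0)$ and $x_-=\max(-x,0)$, and define $$(\alpha,\beta,\gamma)=\begin{cases}(\alpha'_++\gamma'_-,\ \beta'_++\alpha'_-,\ \gamma'_++\beta'_-)&\text{for type I},\\ (\alpha'_++\beta'_-+\gamma'_-,\ \beta'_+,\ \gamma'_++\alpha'_-)&\text{for type II}.\end{cases}$$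 Let $Q(t)=2t_1t_2+2t_1t_3+2t_2t_3-t_1^2-t_2^2-t_3^2$. **Theorem.** Let $F$ be a regular irreducible trinomial as above and $R=k[X,Y,Z]/(F)$. There is exactly one continuous function $\mu:[0,\infty)^3\to\mathbb R$ with $\mu(pt)=p^{\dim R}\mu(t)$ for all $t$ and $\mu(l)=\mathrm{HKM}((X^{l_1},Y^{l_2},Z^{l_3}),R)$ for all $l\in\mathbb N^3$ (in particular these limits exist). If $F$ is of type I or II, then for all $t\in[0,\infty)^3$ $$\mu(t)=\frac d4\,Q(t)+\frac{\lambda^2}{4d}\,\delta\left(\frac{\alpha(t)}{\lambda},\frac{\beta(t)}{\lambda},\frac{\gamma(t)}{\lambda}\right)^2.$$ In particular, $\mathrm{HKM}((X^{l_1},Y^{l_2},Z^{l_3}),R)$ is given by the right-hand side at $t=l$ for all $l\in\mathbb N^3$, and for every real $s\ge0$ $$\mu(s,s,s)=\frac{3d}4s^2+\frac{\lambda^2}{4d}\,\delta\left(\frac{(a_1+b_2-d)s}{\lambda},\frac{(a_1+c_3-d)s}{\lambda},\frac{(b_2+c_3-d)s}{\lambda}\right)^2.$$ -/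

import Mathlib

open Filter Topology
open scoped NNReal

noncomputable section

namespace HanMonsky

/-! ## Hilbert-Kunz multiplicities -/

section HilbertKunz

variable {R : Type*} [CommRing R]

/-- The ideal generated by the `q`-th powers of the elements of `I`; for `q = p ^ e` in
characteristic `p` this is the Frobenius power of `I`. -/
def frobeniusPower (I : Ideal R) (q : ℕ) : Ideal R :=
  Ideal.span ((fun f : R => f ^ q) '' (I : Set R))

/-- The Hilbert-Kunz function `q ↦ dim_k (R / I^[q])`. -/
def hkf (k : Type*) [Field k] [Algebra k R] (I : Ideal R) (q : ℕ) : ℕ :=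
  Module.finrank k (R ⧸ frobeniusPower I q)

/-- `m` is the Hilbert-Kunz multiplicity of `R` with respect to `I`: the limit of
`dim_k (R / I^[p ^ e]) / p ^ (e * dim R)` exists and equals `m`. -/
def HasHKM (k : Type*) [Field k] [Algebra k R] (p : ℕ) (I : Ideal R) (m : ℝ) : Prop :=
  ∃ n : ℕ, ringKrullDim R = n ∧
    Tendsto (fun e : ℕ => (hkf k I (p ^ e) : ℝ) / ((p : ℝ) ^ e) ^ n) atTop (𝓝 m)

/-- The ideal `(x_i ^ l_i : i)`. -/
def powerIdeal {ι : Type*} (x : ι → R) (l : ι → ℕ) : Ideal R :=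
  Ideal.span (Set.range fun i => x i ^ l i)

/-- `μ` is the continuous extension to `[0, ∞)^ι` of `l ↦ HKM((x_i ^ l_i : i), R)`, `l ∈ ℕ^ι`,
with `μ (p t) = p ^ (dim R) μ t`. -/
def IsHKMExtension (k : Type*) [Field k] [Algebra k R] (p : ℕ) {ι : Type*} (x : ι → R)
    (μ : (ι → ℝ≥0) → ℝ) : Prop :=
  Continuous μ ∧
  (∃ n : ℕ, ringKrullDim R = n ∧ ∀ t, μ (fun i => (p : ℝ≥0) * t i) = (p : ℝ) ^ n * μ t) ∧
  ∀ l : ι → ℕ, HasHKM k p (powerIdeal x l) (μ fun i => (l i : ℝ≥0))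

end HilbertKunz

/-! ## Syzygy gaps and Han's `δ` function -/

section Delta

variable (k : Type*) [Field k]

/-- The minimal degree of a non-trivial homogeneous syzygy `(A_0, A_1, A_2)` of three homogeneous
polynomials in `k[X, Y]`; the degree of the syzygy is the common degree of the `A_i F_i`. -/
def minSyzygyDegree (F : Fin 3 → MvPolynomial (Fin 2) k) : ℕ :=
  sInf {n : ℕ | ∃ A : Fin 3 → MvPolynomial (Fin 2) k,
    A ≠ 0 ∧ (∀ i, (A i * F i).IsHomogeneous n) ∧ ∑ i, A i * F i = 0}

/-- The syzygy gap of three non-zero homogeneous polynomials in `k[X, Y]`. -/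
def syzygyGap (F : Fin 3 → MvPolynomial (Fin 2) k) : ℤ :=
  ∑ i, ((F i).totalDegree : ℤ) - 2 * minSyzygyDegree k F

/-- The polynomials `X ^ n_0`, `Y ^ n_1`, `(X + Y) ^ n_2`. -/
def linePowers (n : Fin 3 → ℕ) : Fin 3 → MvPolynomial (Fin 2) k :=
  ![MvPolynomial.X 0 ^ n 0, MvPolynomial.X 1 ^ n 1,
    (MvPolynomial.X 0 + MvPolynomial.X 1) ^ n 2]

/-- `δ` is Han's function in characteristic `p`: the continuous function on `[0, ∞)^3` with
`δ (n / p ^ e) = sg (X ^ n_0, Y ^ n_1, (X + Y) ^ n_2) / p ^ e`. -/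
def IsHanDelta (p : ℕ) (δ : (Fin 3 → ℝ≥0) → ℝ) : Prop :=
  Continuous δ ∧
  ∀ (e : ℕ) (n : Fin 3 → ℕ),
    δ (fun i => (n i : ℝ≥0) / (p : ℝ≥0) ^ e) = (syzygyGap k (linePowers k n) : ℝ) / (p : ℝ) ^ e

end Delta

/-! ## Regular trinomials -/

section Trinomials

variable (k : Type*) [Field k]

/-- The trinomial `X^a_0 Y^a_1 Z^a_2 + X^b_0 Y^b_1 Z^b_2 + X^c_0 Y^c_1 Z^c_2`. -/
def trinomial (a b c : Fin 3 → ℕ) : MvPolynomial (Fin 3) k :=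
  ∏ i, MvPolynomial.X i ^ a i + ∏ i, MvPolynomial.X i ^ b i + ∏ i, MvPolynomial.X i ^ c i

variable {k}

/-- The multiplicity of the `i`-th coordinate point of the projective plane on the curve `F = 0`:
the order of vanishing at the origin of the dehomogenization of `F` at `X_i = 1`. -/
def multAtVertex (F : MvPolynomial (Fin 3) k) (i : Fin 3) : ℕ∞ :=
  ((MvPolynomial.aeval (fun j => if j = i then 1 else MvPolynomial.X j) F :
    MvPolynomial (Fin 3) k) : MvPowerSeries (Fin 3) k).order

/-- Regularity of a form `F` of degree `d`: each coordinate point has multiplicity `< d / 2`. -/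
def IsRegularForm (d : ℕ) (F : MvPolynomial (Fin 3) k) : Prop :=
  ∀ i, 2 * multAtVertex F i < (d : ℕ∞)

variable (k) in
/-- The coordinate ring `k[X, Y, Z] / (F)` of the trinomial. -/
abbrev TrinomialRing (a b c : Fin 3 → ℕ) : Type _ :=
  MvPolynomial (Fin 3) k ⧸ Ideal.span {trinomial k a b c}

variable (k) in
/-- The residue classes of `X`, `Y`, `Z`. -/
def coords (a b c : Fin 3 → ℕ) : Fin 3 → TrinomialRing k a b c :=
  fun i => Ideal.Quotient.mk _ (MvPolynomial.X i)

end Trinomials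

/-! ## The data built from the exponents -/

section Exponents

/-- First normal form of the exponents. -/
def IsTypeI (d : ℕ) (a b c : Fin 3 → ℕ) : Prop :=
  d < 2 * a 0 ∧ a 2 = 0 ∧ b 0 = 0 ∧ d < 2 * b 1 ∧ c 1 = 0 ∧ d < 2 * c 2

/-- Second normal form of the exponents. -/
def IsTypeII (d : ℕ) (a b c : Fin 3 → ℕ) : Prop :=
  a 0 = d ∧ a 1 = 0 ∧ a 2 = 0 ∧ d < 2 * b 1 ∧ c 0 = 0 ∧ d < 2 * c 2

/-- The determinant of the matrix with columns `a`, `b`, `c`. -/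
def expDet (a b c : Fin 3 → ℕ) : ℤ :=
  Matrix.det !![(a 0 : ℤ), (b 0 : ℤ), (c 0 : ℤ);
                (a 1 : ℤ), (b 1 : ℤ), (c 1 : ℤ);
                (a 2 : ℤ), (b 2 : ℤ), (c 2 : ℤ)]

/-- The positive integer `λ` with `det = d λ`. -/
def lam (d : ℕ) (a b c : Fin 3 → ℕ) : ℕ := (expDet a b c / (d : ℤ)).toNat

variable (d : ℕ) (a b c : Fin 3 → ℕ) (t : Fin 3 → ℝ≥0)

def alpha' : ℝ := t 0 * d - t 0 * b 2 - t 0 * c 1 - t 1 * c 0 - t 2 * b 0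

def beta' : ℝ := t 1 * d - t 1 * c 0 - t 2 * a 1 - t 0 * c 1 - t 1 * a 2

def gamma' : ℝ := t 2 * d - t 2 * a 1 - t 0 * b 2 - t 2 * b 0 - t 1 * a 2

/-- The triple `(α(t), β(t), γ(t))` for exponents of the first type. Here `Real.toNNReal x` is the
positive part of `x`, and `Real.toNNReal (-x)` its negative part. -/
def abgI : Fin 3 → ℝ≥0 :=
  ![(alpha' d b c t).toNNReal + (-gamma' d a b t).toNNReal,
    (beta' d a c t).toNNReal + (-alpha' d b c t).toNNReal,
    (gamma' d a b t).toNNReal + (-beta' d a c t).toNNReal]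

/-- The triple `(α(t), β(t), γ(t))` for exponents of the second type. -/
def abgII : Fin 3 → ℝ≥0 :=
  ![(alpha' d b c t).toNNReal + (-beta' d a c t).toNNReal + (-gamma' d a b t).toNNReal,
    (beta' d a c t).toNNReal,
    (gamma' d a b t).toNNReal + (-alpha' d b c t).toNNReal]

/-- The quadratic form `Q(r, s, t) = 2rs + 2rt + 2st - r² - s² - t²`. -/
def quadQ : ℝ :=
  2 * t 0 * t 1 + 2 * t 0 * t 2 + 2 * t 1 * t 2 - (t 0 : ℝ) ^ 2 - (t 1 : ℝ) ^ 2 - (t 2 : ℝ) ^ 2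

end Exponents

/-- `(d / 4) q + (l² / (4 d)) δ(u / l)²`. -/
def hkValue (δ : (Fin 3 → ℝ≥0) → ℝ) (d l : ℕ) (q : ℝ) (u : Fin 3 → ℝ≥0) : ℝ :=
  (d : ℝ) / 4 * q + (l : ℝ) ^ 2 / (4 * d) * δ (fun i => u i / (l : ℝ≥0)) ^ 2

end HanMonsky

end

/-! The curve is compared with a Fermat curve, and the Fermat curve with three binary forms. Write
`L` for `λ`. A monomial substitution `X r ↦ ∏ s, X s ^ O r s` carries `F` to a monomial times `X ^ L
+ Y ^ L + Z ^ L` (`isCover_typeI`, `isCover_typeII`). The rows of `O` span a lattice of index `d *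
L`. Multiplying by one monomial from each coset gives a map from `d * L` copies of `k[X, Y, Z]` to
the Fermat ring, and its kernel consists of the multiples of `F` in each copy (`ker_cover`): the
cosets separate the summands, and the Nullstellensatz treats each summand.

The Fermat ring is free of rank `L ^ 3` over `k[X, Y]`, the `L`-th powers of the variables acting as
`X`, `Y`, `-(X + Y)` (`toFree_eq_zero_iff`). So multiplication by `X r ^ (L * ν r)` becomes
multiplication by the product of linear forms with exponents `ν r * O r s`. In degrees up to `D`
source and target have the same leading dimension, so the image has codimension `O(D)`. Hence `d * L
* dim R / (X r ^ (L * ν r))` is `L ^ 3` times the colength of three binary forms of degrees `d * ν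
r`, up to an error linear in `ν` (`IsCover.exists_abs_finrank_sub_le`).

By Hilbert–Burch, the syzygies of three coprime binary forms of degrees `e r` are free on generators
of degrees `m`, `m'` with `m + m' = ∑ e r`. The gap is `|m - m'|` and the colength is `(m ^ 2 + m' ^
2 - ∑ e r ^ 2) / 2`; for `e r = d * ν r` this is `(d ^ 2 * Q(ν) + (m - m') ^ 2) / 4`. A factor
common to two of the forms shifts `m` and `m'` equally and can be dropped. What remains is either a
triple of powers of the three lines or a triple with a constant member, and its degrees are `α`,
`β`, `γ` (`hasReduction_typeI`, `hasReduction_typeII`).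

The gap is multiplied by `p` under Frobenius and is Lipschitz in the exponents, which yields `δ`
(`exists_isHanDelta`). Continuity of `δ` gives the limits, with `p ^ e * l` squeezed between
consecutive multiples of `L` (`hasHKM_of_isCover`). Uniqueness follows from the density of the
points with coordinates in `ℕ[1/p]`. For the classification, regularity gives each variable a
monomial in which it dominates, and irreducibility gives each variable a monomial in which it is
absent. -/

noncomputable section

namespace HanMonsky

/-! ## Restriction of polynomials to sets of exponents, degrees -/

section Filter

open MvPolynomial

variable {σ R : Type*} [CommRing R]

open Classical in
/-- The part of a polynomial supported on the exponents in `S`. -/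
def filt (S : Set (σ →₀ ℕ)) (f : MvPolynomial σ R) : MvPolynomial σ R :=
  ∑ e ∈ f.support with e ∈ S, monomial e (coeff e f)

open Classical in
theorem coeff_filt (S : Set (σ →₀ ℕ)) (f : MvPolynomial σ R) (e : σ →₀ ℕ) :
    coeff e (filt S f) = if e ∈ S then coeff e f else 0 := by
  simp only [filt, coeff_sum, coeff_monomial, Finset.sum_ite_eq', Finset.mem_filter, mem_support_iff]
  by_cases h : coeff e f = 0 <;> by_cases h' : e ∈ S <;> simp [h, h']

theorem filt_eq_self {S : Set (σ →₀ ℕ)} {f : MvPolynomial σ R}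
    (h : ∀ e, coeff e f ≠ 0 → e ∈ S) : filt S f = f := by
  classical
  ext e
  rw [coeff_filt]
  split_ifs with h'
  · rfl
  · by_contra h0
    exact h' (h e (Ne.symm h0))

theorem filt_eq_zero {S : Set (σ →₀ ℕ)} {f : MvPolynomial σ R}
    (h : ∀ e, coeff e f ≠ 0 → e ∉ S) : filt S f = 0 := by
  classical
  ext e
  rw [coeff_filt]
  split_ifs with h'
  · by_contra h0
    exact h e (by simpa using h0) h'
  · simp

theorem mem_of_coeff_filt_ne_zero {S : Set (σ →₀ ℕ)} {f : MvPolynomial σ R} {e : σ →₀ ℕ}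
    (h : coeff e (filt S f) ≠ 0) : e ∈ S := by
  classical
  rw [coeff_filt] at h
  by_contra h'
  simp [h'] at h

theorem filt_add (S : Set (σ →₀ ℕ)) (f g : MvPolynomial σ R) :
    filt S (f + g) = filt S f + filt S g := by
  classical
  ext e
  simp only [coeff_filt, coeff_add]
  split_ifs <;> simp

theorem filt_sum {ι : Type*} (s : Finset ι) (S : Set (σ →₀ ℕ)) (f : ι → MvPolynomial σ R) :
    filt S (∑ i ∈ s, f i) = ∑ i ∈ s, filt S (f i) := by
  classical
  ext e
  simp only [coeff_filt, coeff_sum]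
  split_ifs <;> simp

/-- One tool for three gradings: exact degree, bounded degree, and cosets of a lattice. It applies
whenever all monomials of `g` move exponents between `S'` and `S` in the same way, so that `g`
behaves like a homogeneous element. -/
theorem filt_mul {S S' : Set (σ →₀ ℕ)} {g : MvPolynomial σ R} (f : MvPolynomial σ R)
    (h : ∀ m, coeff m g ≠ 0 → ∀ e, m + e ∈ S ↔ e ∈ S') :
    filt S (g * f) = g * filt S' f := by
  classical
  ext n
  have h0 : ∀ (q : Prop) [Decidable q] (s : Finset ((σ →₀ ℕ) × (σ →₀ ℕ)))
      (u : (σ →₀ ℕ) × (σ →₀ ℕ) → R), (if q then ∑ x ∈ s, u x else 0) = ∑ x ∈ s, if q then u x else 0 := by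
    intro q _ s u
    split_ifs <;> simp
  rw [coeff_filt, coeff_mul, coeff_mul, h0]
  refine Finset.sum_congr rfl fun x hx => ?_
  rw [coeff_filt]
  by_cases hg : coeff x.1 g = 0
  · simp [hg]
  · have := h _ hg x.2
    rw [Finset.HasAntidiagonal.mem_antidiagonal.1 hx] at this
    simp [this]

/-- Every monomial of `f` has degree `m - e`. -/
def WDeg (f : MvPolynomial σ R) (e m : ℕ) : Prop := ∀ s, coeff s f ≠ 0 → s.degree + e = m

theorem isHomogeneous_iff_degree {f : MvPolynomial σ R} {n : ℕ} :
    f.IsHomogeneous n ↔ ∀ s, coeff s f ≠ 0 → s.degree = n := by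
  rw [← mem_homogeneousSubmodule, homogeneousSubmodule_eq_finsupp_supported,
    AddMonoidAlgebra.mem_supported]
  constructor
  · intro h s hs
    exact h (mem_support_iff.2 hs)
  · intro h s hs
    exact h s (mem_support_iff.1 hs)

theorem wdeg_zero_iff {f : MvPolynomial σ R} {n : ℕ} : WDeg f 0 n ↔ f.IsHomogeneous n := by
  simp [WDeg, isHomogeneous_iff_degree]

theorem wdeg_zero (e m : ℕ) : WDeg (0 : MvPolynomial σ R) e m := by simp [WDeg]

theorem WDeg.shift {f : MvPolynomial σ R} {e m : ℕ} (h : WDeg f e m) (a : ℕ) :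
    WDeg f (e + a) (m + a) := fun s hs => by rw [← h s hs, add_assoc]

theorem WDeg.unshift {f : MvPolynomial σ R} {e m a : ℕ} (h : WDeg f (e + a) (m + a)) :
    WDeg f e m := fun s hs => by have := h s hs; omega

theorem WDeg.add {f g : MvPolynomial σ R} {e m : ℕ} (hf : WDeg f e m) (hg : WDeg g e m) :
    WDeg (f + g) e m := fun s hs => by
  by_cases h : coeff s f = 0
  · exact hg s (by simpa [h] using hs)
  · exact hf s h

theorem WDeg.neg {f : MvPolynomial σ R} {e m : ℕ} (hf : WDeg f e m) : WDeg (-f) e m :=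
  fun s hs => hf s (by simpa using hs)

theorem WDeg.sub {f g : MvPolynomial σ R} {e m : ℕ} (hf : WDeg f e m) (hg : WDeg g e m) :
    WDeg (f - g) e m := by
  rw [sub_eq_add_neg]
  exact hf.add hg.neg

theorem WDeg.mul {f g : MvPolynomial σ R} {e m e' m' : ℕ} (hf : WDeg f e m) (hg : WDeg g e' m') :
    WDeg (f * g) (e + e') (m + m') := fun s hs => by
  classical
  rw [coeff_mul] at hs
  obtain ⟨x, hx, h⟩ := Finset.exists_ne_zero_of_sum_ne_zero hs
  have h1 := hf _ (left_ne_zero_of_mul h)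
  have h2 := hg _ (right_ne_zero_of_mul h)
  rw [← Finset.HasAntidiagonal.mem_antidiagonal.1 hx, map_add]
  omega

theorem WDeg.of_mul [IsDomain R] {f g : MvPolynomial σ R} {e m e' m' : ℕ} (hf : WDeg f e m)
    (hf0 : f ≠ 0) (hfg : WDeg (f * g) (e + e') (m + m')) : WDeg g e' m' := by
  have key : filt {s | s.degree + (e + e') = m + m'} (f * g)
      = f * filt {s | s.degree + e' = m'} g := by
    refine filt_mul g fun s hs t => ?_
    have := hf s hs
    simp only [Set.mem_ofPred_eq, map_add]
    omega
  have h1 := filt_eq_self (S := {s | s.degree + (e + e') = m + m'}) (f := f * g) hfg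
  rw [h1] at key
  have := mul_left_cancel₀ hf0 key
  intro s hs
  rw [this] at hs
  exact mem_of_coeff_filt_ne_zero hs

theorem WDeg.le {f : MvPolynomial σ R} {e m : ℕ} (h : WDeg f e m) (hf : f ≠ 0) : e ≤ m := by
  obtain ⟨s, hs⟩ := MvPolynomial.ne_zero_iff.1 hf
  have := h s hs
  omega

end Filter

/-! ## Linear forms -/

section Linear

open MvPolynomial

variable {k : Type*} [Field k]

/-- `ℓ` is a linear form with zero `pt`, and `y` is a linear form with value `1` at `pt`. -/
structure IsLinearForm (ℓ y : MvPolynomial (Fin 2) k) (pt : Fin 2 → k) : Prop where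
  hom : ℓ.IsHomogeneous 1
  hom' : y.IsHomogeneous 1
  ne_zero : ℓ ≠ 0
  eval_y : eval pt y = 1
  eval_zero : eval pt ℓ = 0
  dvd : ∀ i, ℓ ∣ X i - C (pt i) * y

theorem isLinearForm_X0 : IsLinearForm (X 0 : MvPolynomial (Fin 2) k) (X 1) ![0, 1] where
  hom := isHomogeneous_X _ _
  hom' := isHomogeneous_X _ _
  ne_zero := X_ne_zero _
  eval_y := by simp
  eval_zero := by simp
  dvd i := by fin_cases i <;> simp

theorem isLinearForm_X1 : IsLinearForm (X 1 : MvPolynomial (Fin 2) k) (X 0) ![1, 0] where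
  hom := isHomogeneous_X _ _
  hom' := isHomogeneous_X _ _
  ne_zero := X_ne_zero _
  eval_y := by simp
  eval_zero := by simp
  dvd i := by fin_cases i <;> simp

theorem isLinearForm_add : IsLinearForm (X 0 + X 1 : MvPolynomial (Fin 2) k) (X 0) ![1, -1] where
  hom := (isHomogeneous_X _ _).add (isHomogeneous_X _ _)
  hom' := isHomogeneous_X _ _
  ne_zero h := by
    have := congrArg (eval ![(1 : k), 0]) h
    simp at this
  eval_y := by simp
  eval_zero := by simp
  dvd i := by fin_cases i <;> simp [add_comm]

variable {ℓ y : MvPolynomial (Fin 2) k} {pt : Fin 2 → k}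

/-- Modulo `ℓ` each variable is `pt i` times `y`, so a form is congruent to its value at `pt` times
a power of `y`. -/
theorem IsLinearForm.dvd_of_eval_eq_zero (hl : IsLinearForm ℓ y pt) {f : MvPolynomial (Fin 2) k}
    {e m : ℕ} (hf : WDeg f e m) (h : eval pt f = 0) : ℓ ∣ f := by
  let φ := Ideal.Quotient.mk (Ideal.span {ℓ})
  have hX : ∀ i, φ (X i) = φ (C (pt i)) * φ y := fun i => by
    rw [← map_mul, Ideal.Quotient.eq, Ideal.mem_span_singleton]
    exact hl.dvd i
  have key : φ f = φ (C (eval pt f)) * φ y ^ (m - e) := by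
    conv_lhs => rw [f.as_sum]
    rw [eval_eq', map_sum, map_sum, map_sum, Finset.sum_mul]
    refine Finset.sum_congr rfl fun s hs => ?_
    have hd : m - e = s 0 + s 1 := by
      have := hf s (mem_support_iff.1 hs)
      simp only [Finsupp.degree_eq_sum, Fin.sum_univ_two] at this
      omega
    rw [monomial_eq, Finsupp.prod_fintype _ _ (by simp), hd]
    simp only [Fin.prod_univ_two, map_mul, map_pow, hX]
    ring
  rw [h, map_zero, map_zero, zero_mul, Ideal.Quotient.eq_zero_iff_mem,
    Ideal.mem_span_singleton] at key
  exact key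

theorem IsLinearForm.wdeg_of_mul (hl : IsLinearForm ℓ y pt) {f : MvPolynomial (Fin 2) k}
    {e m : ℕ} (hf : WDeg (ℓ * f) e m) : WDeg f (e + 1) m := by
  have := (wdeg_zero_iff.2 hl.hom).of_mul (e' := e + 1) (m' := m) (g := f) hl.ne_zero
    (by convert hf.shift 1 using 1 <;> omega)
  exact this

end Linear

/-! ## Bases of syzygy modules -/

section Pairs

open MvPolynomial

variable {k : Type*} [Field k]

/-- `A`, `A'` are homogeneous of degrees `m`, `m'` (as syzygies of `h`, where `h r` has degree
`e r`) and their cross product is `h`. -/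
structure IsSyzPair (h : Fin 3 → MvPolynomial (Fin 2) k) (e : Fin 3 → ℕ) (m m' : ℕ)
    (A A' : Fin 3 → MvPolynomial (Fin 2) k) : Prop where
  add_eq : m + m' = ∑ r, e r
  wdeg : ∀ r, WDeg (A r) (e r) m
  wdeg' : ∀ r, WDeg (A' r) (e r) m'
  cross : ∀ r, A (r + 1) * A' (r + 2) - A (r + 2) * A' (r + 1) = h r

/-- There is a pair as in `IsSyzPair` with degrees `m`, `m'`. -/
def HasSyzPair (h : Fin 3 → MvPolynomial (Fin 2) k) (e : Fin 3 → ℕ) (m m' : ℕ) : Prop :=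
  ∃ A A', IsSyzPair h e m m' A A'

variable {h : Fin 3 → MvPolynomial (Fin 2) k} {e : Fin 3 → ℕ} {m m' : ℕ}
  {A A' : Fin 3 → MvPolynomial (Fin 2) k}

theorem IsSyzPair.swap (H : IsSyzPair h e m m' A A') : IsSyzPair h e m' m A' (-A) where
  add_eq := by rw [add_comm, H.add_eq]
  wdeg := H.wdeg'
  wdeg' r := (H.wdeg r).neg
  cross r := by
    rw [← H.cross r]
    simp only [Pi.neg_apply]
    ring

theorem HasSyzPair.swap (H : HasSyzPair h e m m') : HasSyzPair h e m' m := by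
  obtain ⟨A, A', H⟩ := H
  exact ⟨_, _, H.swap⟩

theorem hasSyzPair_one : HasSyzPair (fun _ => (1 : MvPolynomial (Fin 2) k)) 0 0 0 := by
  refine ⟨![1, -1, 0], ![0, 1, -1], by simp, fun r => ?_, fun r => ?_, fun r => ?_⟩
  · rw [Pi.zero_apply, wdeg_zero_iff]
    fin_cases r
    · exact isHomogeneous_one _ _
    · exact (isHomogeneous_one _ _).neg
    · exact isHomogeneous_zero _ _ _
  · rw [Pi.zero_apply, wdeg_zero_iff]
    fin_cases r
    · exact isHomogeneous_zero _ _ _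
    · exact isHomogeneous_one _ _
    · exact (isHomogeneous_one _ _).neg
  · fin_cases r <;> simp

variable {ℓ y : MvPolynomial (Fin 2) k} {pt : Fin 2 → k}

/-- Since `ℓ` divides `A r`, it can be moved from that entry to the entries of `A'` other than `r`:
two of the minors are unchanged and the `r`-th gains the factor `ℓ`. -/
theorem IsSyzPair.mul_of_eval (H : IsSyzPair h e m m' A A') (hl : IsLinearForm ℓ y pt) (r : Fin 3)
    (h0 : eval pt (A r) = 0) :
    HasSyzPair (Function.update h r (ℓ * h r)) (Function.update e r (e r + 1)) m (m' + 1) := by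
  obtain ⟨c, hc⟩ := hl.dvd_of_eval_eq_zero (H.wdeg r) h0
  have hs := H.add_eq
  rw [Fin.sum_univ_three] at hs
  refine ⟨Function.update A r c, Function.update (fun i => ℓ * A' i) r (A' r), ?_, fun i => ?_,
    fun i => ?_, fun i => ?_⟩
  · rw [Fin.sum_univ_three]
    fin_cases r <;> simp <;> omega
  · by_cases hi : i = r
    · subst hi
      simp only [Function.update_self]
      exact hl.wdeg_of_mul (hc ▸ H.wdeg i)
    · simp only [Function.update_of_ne hi]
      exact H.wdeg i
  · by_cases hi : i = r
    · subst hi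
      simp only [Function.update_self]
      exact (H.wdeg' i).shift 1
    · simp only [Function.update_of_ne hi]
      convert (wdeg_zero_iff.2 hl.hom).mul (H.wdeg' i) using 1 <;> omega
  · have h1 := H.cross 0
    have h2 := H.cross 1
    have h3 := H.cross 2
    simp only [zero_add, show (1 : Fin 3) + 1 = 2 from rfl, show (1 : Fin 3) + 2 = 0 from rfl,
      show (2 : Fin 3) + 1 = 0 from rfl, show (2 : Fin 3) + 2 = 1 from rfl] at h1 h2 h3
    fin_cases r <;> fin_cases i <;> simp at hc ⊢ <;>
      simp only [hc] at h1 h2 h3 <;>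
      first
      | linear_combination ℓ * h1 | linear_combination ℓ * h2 | linear_combination ℓ * h3
      | linear_combination h1 | linear_combination h2 | linear_combination h3

theorem HasSyzPair.mul_linear (H : HasSyzPair h e m m') (hl : IsLinearForm ℓ y pt) (r : Fin 3) :
    HasSyzPair (Function.update h r (ℓ * h r)) (Function.update e r (e r + 1)) m (m' + 1) ∨
      HasSyzPair (Function.update h r (ℓ * h r)) (Function.update e r (e r + 1)) (m + 1) m' := by
  wlog hm : m ≤ m' generalizing m m'
  · exact (this H.swap (by omega)).symm.imp HasSyzPair.swap HasSyzPair.swap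
  obtain ⟨A, A', H⟩ := H
  by_cases h0 : eval pt (A r) = 0
  · exact Or.inl (H.mul_of_eval hl r h0)
  -- Adding a multiple of `A` to `A'` does not change the minors. This multiple, homogeneous because
  -- `m ≤ m'`, makes the `r`-th entry of the new `A'` vanish at `pt`.
  let c := eval pt (A' r) / eval pt (A r)
  have H' : IsSyzPair h e m m' A (fun i => A' i - C c * y ^ (m' - m) * A i) := by
    refine ⟨H.add_eq, H.wdeg, fun i => (H.wdeg' i).sub ?_, fun i => ?_⟩
    · have h1 : WDeg (C c * y ^ (m' - m)) 0 (m' - m) := by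
        rw [wdeg_zero_iff]
        simpa using (hl.hom'.pow (m' - m)).C_mul c
      convert h1.mul (H.wdeg i) using 1 <;> omega
    · rw [← H.cross i]
      ring
  refine Or.inr (H'.swap.mul_of_eval hl r ?_).swap
  simp [hl.eval_y, c, div_mul_cancel₀ _ h0]

/-- The three linear forms `X`, `Y`, `X + Y`. -/
def lin (k : Type*) [Field k] : Fin 3 → MvPolynomial (Fin 2) k := ![X 0, X 1, X 0 + X 1]

/-- Zeros of the three linear forms. -/
def linPt (k : Type*) [Field k] : Fin 3 → Fin 2 → k := ![![0, 1], ![1, 0], ![1, -1]]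

theorem exists_isLinearForm_lin (s : Fin 3) : ∃ y, IsLinearForm (lin k s) y (linPt k s) := by
  fin_cases s
  · exact ⟨_, isLinearForm_X0⟩
  · exact ⟨_, isLinearForm_X1⟩
  · exact ⟨_, isLinearForm_add⟩

/-- The monomials in `X`, `Y`, `X + Y` with the given exponents. -/
def linMon (k : Type*) [Field k] (η : Fin 3 → Fin 3 → ℕ) (r : Fin 3) : MvPolynomial (Fin 2) k :=
  ∏ s, lin k s ^ η r s

/-- Hilbert–Burch for products of linear forms: start from three constants and insert one linear
factor at a time. Coprimality plays no role until the pair is shown to generate all syzygies. -/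
theorem exists_hasSyzPair_linMon (η : Fin 3 → Fin 3 → ℕ) :
    ∃ m m', HasSyzPair (linMon k η) (fun r => ∑ s, η r s) m m' := by
  induction hN : ∑ r, ∑ s, η r s generalizing η with
  | zero =>
    have h0 : ∀ r s, η r s = 0 := by simpa using hN
    refine ⟨0, 0, ?_⟩
    convert hasSyzPair_one (k := k) using 1
    · funext r
      simp [linMon, h0]
    · funext r
      simp [h0]
  | succ N ih =>
    obtain ⟨r, s, hrs⟩ : ∃ r s, η r s ≠ 0 := by
      by_contra! h
      simp [h] at hN
    let η' := Function.update η r (Function.update (η r) s (η r s - 1))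
    have e1 : η = Function.update η' r (Function.update (η' r) s (η' r s + 1)) := by
      funext i
      by_cases hi : i = r
      · subst hi
        simp [η', Nat.sub_add_cancel (Nat.pos_of_ne_zero hrs)]
      · simp [η', hi]
    have e2 : ∀ v : Fin 3 → ℕ, ∑ j, Function.update v s (v s + 1) j = ∑ j, v j + 1 := by
      intro v
      rw [Finset.sum_update_of_mem (Finset.mem_univ s),
        ← Finset.add_sum_erase _ v (Finset.mem_univ s), ← Finset.sdiff_singleton_eq_erase]
      ring
    have e3 : (fun i => ∑ j, η i j)
        = Function.update (fun i => ∑ j, η' i j) r (∑ j, η' r j + 1) := by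
      funext i
      rw [e1]
      by_cases hi : i = r
      · subst hi
        simp only [Function.update_self]
        rw [e2]
      · simp [hi]
    have e4 : linMon k η = Function.update (linMon k η') r (lin k s * linMon k η' r) := by
      funext i
      rw [e1]
      by_cases hi : i = r
      · subst hi
        simp only [Function.update_self, linMon]
        rw [← Finset.mul_prod_erase _ _ (Finset.mem_univ s),
          ← Finset.mul_prod_erase Finset.univ (fun j => lin k j ^ η' i j) (Finset.mem_univ s)]
        rw [Function.update_self, pow_succ', mul_assoc]
        congr 2
        refine Finset.prod_congr rfl fun j hj => ?_
        rw [Function.update_of_ne (Finset.ne_of_mem_erase hj)]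
      · simp [hi, linMon]
    have hN' : ∑ r, ∑ s, η' r s = N := by
      have : ∑ i, ∑ j, η i j = ∑ i, ∑ j, η' i j + 1 := by
        have := congrArg (fun v : Fin 3 → ℕ => ∑ i, v i) e3
        rw [this, Finset.sum_update_of_mem (Finset.mem_univ r),
          ← Finset.add_sum_erase Finset.univ (fun i => ∑ j, η' i j) (Finset.mem_univ r),
          ← Finset.sdiff_singleton_eq_erase]
        ring
      omega
    obtain ⟨m, m', H⟩ := ih η' hN'
    obtain ⟨y, hl⟩ := exists_isLinearForm_lin (k := k) s
    rw [e3, e4]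
    rcases H.mul_linear hl r with H | H <;> exact ⟨_, _, H⟩

/-- Multiplying two of the three forms by a common factor. -/
theorem HasSyzPair.mul_off (H : HasSyzPair h e m m') {g : MvPolynomial (Fin 2) k} {n : ℕ}
    (hg : g.IsHomogeneous n) (r : Fin 3) :
    HasSyzPair (Function.update (fun i => g * h i) r (h r))
      (Function.update (fun i => e i + n) r (e r)) (m + n) (m' + n) := by
  obtain ⟨A, A', H⟩ := H
  have hs := H.add_eq
  rw [Fin.sum_univ_three] at hs
  -- Every minor except the `r`-th involves the entries at `r` exactly once per term, so scaling
  -- these entries scales precisely the two other forms.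
  refine ⟨Function.update A r (g * A r), Function.update A' r (g * A' r), ?_, fun i => ?_,
    fun i => ?_, fun i => ?_⟩
  · rw [Fin.sum_univ_three]
    fin_cases r <;> simp <;> omega
  · by_cases hi : i = r
    · subst hi
      simp only [Function.update_self]
      convert (wdeg_zero_iff.2 hg).mul (H.wdeg i) using 1 <;> omega
    · simp only [Function.update_of_ne hi]
      exact (H.wdeg i).shift n
  · by_cases hi : i = r
    · subst hi
      simp only [Function.update_self]
      convert (wdeg_zero_iff.2 hg).mul (H.wdeg' i) using 1 <;> omega
    · simp only [Function.update_of_ne hi]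
      exact (H.wdeg' i).shift n
  · have h1 := H.cross 0
    have h2 := H.cross 1
    have h3 := H.cross 2
    simp only [zero_add, show (1 : Fin 3) + 1 = 2 from rfl, show (1 : Fin 3) + 2 = 0 from rfl,
      show (2 : Fin 3) + 1 = 0 from rfl, show (2 : Fin 3) + 2 = 1 from rfl] at h1 h2 h3
    fin_cases r <;> fin_cases i <;> simp <;>
      first
      | linear_combination g * h1 | linear_combination g * h2 | linear_combination g * h3
      | linear_combination h1 | linear_combination h2 | linear_combination h3

/-- If one of the forms is constant, the degrees of the others give the basis. -/
theorem hasSyzPair_of_eq_one {h : Fin 3 → MvPolynomial (Fin 2) k} {e : Fin 3 → ℕ}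
    (hh : ∀ r, (h r).IsHomogeneous (e r)) (r : Fin 3) (h1 : h r = 1) (he : e r = 0) :
    HasSyzPair h e (e (r + 1)) (e (r + 2)) := by
  -- Each of the two other forms is a multiple of `h r = 1`; these are the syzygies expressing that.
  refine ⟨Function.update (Function.update 0 (r + 1) (-1)) r (h (r + 1)),
    Function.update (Function.update 0 (r + 2) (-1)) r (h (r + 2)), ?_, fun i => ?_, fun i => ?_,
    fun i => ?_⟩
  · rw [Fin.sum_univ_three]
    fin_cases r <;> simp at he ⊢ <;> omega
  · by_cases hi : i = r
    · subst hi
      rw [Function.update_self, he]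
      exact wdeg_zero_iff.2 (hh _)
    · rw [Function.update_of_ne hi]
      by_cases hi' : i = r + 1
      · subst hi'
        rw [Function.update_self]
        simpa using ((wdeg_zero_iff.2 (isHomogeneous_one (Fin 2) k)).neg).shift (e (r + 1))
      · rw [Function.update_of_ne hi']
        exact wdeg_zero _ _
  · by_cases hi : i = r
    · subst hi
      rw [Function.update_self, he]
      exact wdeg_zero_iff.2 (hh _)
    · rw [Function.update_of_ne hi]
      by_cases hi' : i = r + 2
      · subst hi'
        rw [Function.update_self]
        simpa using ((wdeg_zero_iff.2 (isHomogeneous_one (Fin 2) k)).neg).shift (e (r + 2))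
      · rw [Function.update_of_ne hi']
        exact wdeg_zero _ _
  · fin_cases r <;> fin_cases i <;> simp at h1 ⊢ <;> simp [h1]

end Pairs

/-! ## Dimensions of subspaces -/

section Dim

open Module

variable {k : Type*} [Field k] {M N : Type*} [AddCommGroup M] [Module k M] [AddCommGroup N]
  [Module k N]

theorem finrank_map_add_finrank_inf_ker (f : M →ₗ[k] N) (Y : Submodule k M)
    [FiniteDimensional k Y] :
    finrank k (Y.map f) + finrank k (Y ⊓ LinearMap.ker f : Submodule k M) = finrank k Y := by
  rw [← LinearMap.finrank_range_add_finrank_ker (f.domRestrict Y), LinearMap.range_domRestrict]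
  congr 1
  rw [LinearMap.ker_domRestrict]
  have h : Y ⊓ LinearMap.ker f = (Submodule.comap Y.subtype (LinearMap.ker f)).map Y.subtype := by
    rw [Submodule.map_comap_subtype]
  rw [h]
  exact (LinearEquiv.finrank_eq (Submodule.equivMapOfInjective _ Y.injective_subtype _)).symm

/-- The subspace of a power of `M` given by subspaces of the factors. -/
def piEquiv {ι : Type*} (p : ι → Submodule k M) :
    Submodule.pi Set.univ p ≃ₗ[k] ∀ i, p i where
  toFun x i := ⟨x.1 i, x.2 i trivial⟩
  invFun y := ⟨fun i => y i, fun i _ => (y i).2⟩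
  left_inv _ := rfl
  right_inv _ := rfl
  map_add' _ _ := rfl
  map_smul' _ _ := rfl

instance {ι : Type*} [Fintype ι] (p : ι → Submodule k M) [∀ i, FiniteDimensional k (p i)] :
    FiniteDimensional k (Submodule.pi Set.univ p) :=
  (piEquiv p).symm.finiteDimensional

theorem finrank_pi_univ {ι : Type*} [Fintype ι] (p : ι → Submodule k M)
    [∀ i, FiniteDimensional k (p i)] :
    finrank k (Submodule.pi Set.univ p) = ∑ i, finrank k (p i) := by
  rw [(piEquiv p).finrank_eq, finrank_pi_fintype]

theorem finrank_map_eq_of_ker_eq {N' : Type*} [AddCommGroup N'] [Module k N'] (f : M →ₗ[k] N)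
    (g : M →ₗ[k] N') (h : LinearMap.ker f = LinearMap.ker g) (Y : Submodule k M)
    [FiniteDimensional k Y] : finrank k (Y.map f) = finrank k (Y.map g) := by
  have h1 := finrank_map_add_finrank_inf_ker f Y
  have h2 := finrank_map_add_finrank_inf_ker g Y
  rw [h] at h1
  omega

theorem finrank_map_of_injective (f : M →ₗ[k] N) (h : Function.Injective f) (Y : Submodule k M) :
    finrank k (Y.map f) = finrank k Y :=
  (LinearEquiv.finrank_eq (Submodule.equivMapOfInjective f h Y)).symm

/-- The map `x ↦ ∑ r, g r (x r)`. -/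
def sumMap {ι : Type*} [Fintype ι] (g : ι → M →ₗ[k] N) : (ι → M) →ₗ[k] N :=
  ∑ r, (g r).comp (LinearMap.proj r)

theorem sumMap_apply {ι : Type*} [Fintype ι] (g : ι → M →ₗ[k] N) (x : ι → M) :
    sumMap g x = ∑ r, g r (x r) := by
  simp [sumMap]

theorem iSup_map_eq {ι : Type*} [Fintype ι] (g : ι → M →ₗ[k] N) (p : ι → Submodule k M) :
    ⨆ r, (p r).map (g r) = (Submodule.pi Set.univ p).map (sumMap g) := by
  classical
  apply le_antisymm
  · refine iSup_le fun r => ?_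
    rintro _ ⟨f, hf, rfl⟩
    refine ⟨Pi.single r f, fun i _ => ?_, ?_⟩
    · by_cases hi : i = r
      · subst hi
        simpa using hf
      · simp [hi]
    · rw [sumMap_apply, Finset.sum_eq_single r]
      · simp
      · intro i _ hi
        simp [hi]
      · simp
  · rintro _ ⟨S, hS, rfl⟩
    rw [sumMap_apply]
    exact Submodule.sum_mem _ fun r _ => Submodule.mem_iSup_of_mem r ⟨S r, hS r trivial, rfl⟩

/-- Rank–nullity for `X` and `W`: the kernel of `f` on `W` is no larger than the kernel on `X`, so
the image loses at most the codimension of `W` in `X`. -/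
theorem finrank_map_le_add {X W : Submodule k M} [FiniteDimensional k X] (h : W ≤ X)
    (f : M →ₗ[k] N) :
    finrank k (X.map f) + finrank k W ≤ finrank k (W.map f) + finrank k X := by
  have : FiniteDimensional k W := Submodule.finiteDimensional_of_le h
  have h1 := finrank_map_add_finrank_inf_ker f X
  have h2 := finrank_map_add_finrank_inf_ker f W
  have : FiniteDimensional k (X ⊓ LinearMap.ker f : Submodule k M) :=
    Submodule.finiteDimensional_of_le inf_le_left
  have h3 : finrank k (W ⊓ LinearMap.ker f : Submodule k M)
      ≤ finrank k (X ⊓ LinearMap.ker f : Submodule k M) :=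
    Submodule.finrank_mono (inf_le_inf_right _ h)
  omega

/-- Passing to subspaces in a sum of images changes the dimension at most by the sum of the
codimensions. -/
theorem finrank_iSup_map_le_add {ι : Type*} [Fintype ι] {X W : ι → Submodule k M}
    [∀ i, FiniteDimensional k (X i)] (h : ∀ i, W i ≤ X i) (g : ι → M →ₗ[k] N) :
    finrank k (⨆ r, (X r).map (g r) : Submodule k N) + ∑ i, finrank k (W i)
      ≤ finrank k (⨆ r, (W r).map (g r) : Submodule k N) + ∑ i, finrank k (X i) := by
  have : ∀ i, FiniteDimensional k (W i) := fun i => Submodule.finiteDimensional_of_le (h i)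
  rw [iSup_map_eq, iSup_map_eq, ← finrank_pi_univ, ← finrank_pi_univ]
  have hle : Submodule.pi Set.univ W ≤ Submodule.pi Set.univ X := fun x hx i hi => h i (hx i hi)
  exact finrank_map_le_add hle _

/-- Sums of images in a power of an algebra. -/
theorem iSup_map_compLeft {ι κ : Type*} [Fintype κ] (g : κ → M →ₗ[k] N)
    (p : κ → Submodule k M) :
    ⨆ r, (Submodule.pi Set.univ fun _ : ι => p r).map ((g r).compLeft ι)
      = Submodule.pi Set.univ fun _ : ι => ⨆ r, (p r).map (g r) := by
  apply le_antisymm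
  · refine iSup_le fun r => ?_
    rintro _ ⟨x, hx, rfl⟩ i _
    exact Submodule.mem_iSup_of_mem r ⟨x i, hx i trivial, rfl⟩
  · intro x hx
    rw [iSup_map_eq] at hx
    choose S hS hSx using fun i => hx i trivial
    have : x = ∑ r, (g r).compLeft ι fun i => S i r := by
      funext i
      rw [← hSx i, sumMap_apply, Finset.sum_apply]
      rfl
    rw [this]
    exact Submodule.sum_mem _ fun r _ => Submodule.mem_iSup_of_mem r
      ⟨fun i => S i r, fun i _ => hS i r trivial, rfl⟩

end Dim

/-! ## Polynomials of bounded degree -/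

section Bounded

open MvPolynomial Module

variable {σ : Type*} {k : Type*} [Field k]

/-- Every monomial of `f` has degree at most `N - e`. -/
def FDeg (f : MvPolynomial σ k) (e N : ℕ) : Prop := ∀ s, coeff s f ≠ 0 → s.degree + e ≤ N

theorem mem_restrictTotalDegree_iff {f : MvPolynomial σ k} {N : ℕ} :
    f ∈ restrictTotalDegree σ k N ↔ ∀ s, coeff s f ≠ 0 → s.degree ≤ N := by
  rw [mem_restrictTotalDegree, totalDegree, Finset.sup_le_iff]
  simp only [MvPolynomial.mem_support_iff]
  rfl

theorem fdeg_iff {f : MvPolynomial σ k} {e N : ℕ} (h : e ≤ N) :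
    FDeg f e N ↔ f ∈ restrictTotalDegree σ k (N - e) := by
  rw [mem_restrictTotalDegree_iff]
  refine forall₂_congr fun s _ => ?_
  omega

theorem WDeg.fdeg {f : MvPolynomial σ k} {e m : ℕ} (h : WDeg f e m) : FDeg f e m :=
  fun s hs => (h s hs).le

theorem FDeg.le {f : MvPolynomial σ k} {e m : ℕ} (h : FDeg f e m) (hf : f ≠ 0) : e ≤ m := by
  obtain ⟨s, hs⟩ := MvPolynomial.ne_zero_iff.1 hf
  have := h s hs
  omega

theorem FDeg.congr {f : MvPolynomial σ k} {e N e' N' : ℕ} (h : FDeg f e N)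
    (h' : e + N' = e' + N) : FDeg f e' N' := fun s hs => by
  have := h s hs
  omega

theorem FDeg.add {f g : MvPolynomial σ k} {e N : ℕ} (hf : FDeg f e N) (hg : FDeg g e N) :
    FDeg (f + g) e N := fun s hs => by
  by_cases h : coeff s f = 0
  · exact hg s (by simpa [h] using hs)
  · exact hf s h

theorem FDeg.neg {f : MvPolynomial σ k} {e N : ℕ} (hf : FDeg f e N) : FDeg (-f) e N :=
  fun s hs => hf s (by simpa using hs)

theorem FDeg.sub {f g : MvPolynomial σ k} {e N : ℕ} (hf : FDeg f e N) (hg : FDeg g e N) :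
    FDeg (f - g) e N := by
  rw [sub_eq_add_neg]
  exact hf.add hg.neg

theorem FDeg.mul {f g : MvPolynomial σ k} {e N e' N' : ℕ} (hf : FDeg f e N) (hg : FDeg g e' N') :
    FDeg (f * g) (e + e') (N + N') := fun s hs => by
  classical
  rw [coeff_mul] at hs
  obtain ⟨x, hx, h⟩ := Finset.exists_ne_zero_of_sum_ne_zero hs
  have h1 := hf _ (left_ne_zero_of_mul h)
  have h2 := hg _ (right_ne_zero_of_mul h)
  rw [← Finset.HasAntidiagonal.mem_antidiagonal.1 hx, map_add]
  omega

theorem FDeg.of_mul {f g : MvPolynomial σ k} {e m e' N : ℕ} (hf : WDeg f e m)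
    (hf0 : f ≠ 0) (hfg : FDeg (f * g) (e + e') (m + N)) : FDeg g e' N := by
  have key : filt {s | s.degree + (e + e') ≤ m + N} (f * g)
      = f * filt {s | s.degree + e' ≤ N} g := by
    refine filt_mul g fun s hs t => ?_
    have := hf s hs
    simp only [Set.mem_ofPred_eq, map_add]
    omega
  have h1 := filt_eq_self (S := {s | s.degree + (e + e') ≤ m + N}) (f := f * g) hfg
  rw [h1] at key
  have := mul_left_cancel₀ hf0 key
  intro s hs
  rw [this] at hs
  exact mem_of_coeff_filt_ne_zero hs

theorem setOf_degree_le_eq [Fintype σ] [DecidableEq σ] (N : ℕ) :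
    {n : σ →₀ ℕ | (n.sum fun _ e => e) ≤ N}
      = ((Finset.range (N + 1)).biUnion fun j => Finset.univ.finsuppAntidiag j :
        Finset (σ →₀ ℕ)) := by
  ext n
  simp only [Finset.coe_biUnion, Finset.coe_range, Set.mem_iUnion, Finset.mem_coe,
    Finset.mem_finsuppAntidiag, Set.mem_ofPred_eq, Set.mem_Iio]
  rw [Finsupp.sum_fintype _ _ (by simp)]
  constructor
  · exact fun h => ⟨_, Nat.lt_succ_of_le h, rfl, Finset.subset_univ _⟩
  · rintro ⟨j, hj, rfl, -⟩
    exact Nat.le_of_lt_succ hj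

instance [Finite σ] (N : ℕ) : FiniteDimensional k (restrictTotalDegree σ k N) := by
  classical
  have := Fintype.ofFinite σ
  have : Finite {n : σ →₀ ℕ | (n.sum fun _ e => e) ≤ N} := by
    rw [setOf_degree_le_eq]
    exact Finset.finite_toSet _
  exact Module.Finite.of_basis (basisRestrictSupport k _)

theorem finrank_restrictTotalDegree [Fintype σ] (N : ℕ) :
    finrank k (restrictTotalDegree σ k N)
      = ∑ j ∈ Finset.range (N + 1), (Fintype.card σ + j - 1).choose j := by
  classical
  rw [restrictTotalDegree, finrank_eq_nat_card_basis (basisRestrictSupport k _), setOf_degree_le_eq,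
    Nat.card_eq_fintype_card]
  simp only [Finset.coe_sort_coe, Fintype.card_coe]
  rw [Finset.card_biUnion]
  · refine Finset.sum_congr rfl fun j _ => ?_
    rw [Finset.card_finsuppAntidiag_nat_eq_choose, Finset.card_univ]
  · intro i _ j _ hij
    rw [Function.onFun, Finset.disjoint_left]
    intro n hi hj
    rw [Finset.mem_finsuppAntidiag] at hi hj
    exact hij (hi.1.symm.trans hj.1)

theorem finrank_restrictTotalDegree_two (N : ℕ) :
    (finrank k (restrictTotalDegree (Fin 2) k N) : ℝ) = (N + 1) * (N + 2) / 2 := by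
  rw [finrank_restrictTotalDegree, Fintype.card_fin]
  induction N with
  | zero => simp
  | succ N ih =>
    rw [Finset.sum_range_succ, Nat.cast_add, ih, show 2 + (N + 1) - 1 = (N + 1) + 1 by omega,
      Nat.choose_symm_add, Nat.choose_one_right]
    push_cast
    ring

theorem finrank_restrictTotalDegree_three (N : ℕ) :
    (finrank k (restrictTotalDegree (Fin 3) k N) : ℝ) = (N + 1) * (N + 2) * (N + 3) / 6 := by
  rw [finrank_restrictTotalDegree, Fintype.card_fin]
  induction N with
  | zero => norm_num
  | succ N ih =>
    rw [Finset.sum_range_succ, Nat.cast_add, ih, show 3 + (N + 1) - 1 = (N + 1) + 2 by omega,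
      Nat.choose_symm_add, Nat.cast_choose_two]
    push_cast
    ring

end Bounded

/-! ## The syzygy module -/

section Cramer

open MvPolynomial Module

/-- Parallelism shows that `h r` divides all `v r * h j`, hence `v r` times the gcd of the entries
of `h`, which is a unit. The factor is the quotient of `v r` by `h r`. -/
theorem exists_eq_mul_of_parallel {R : Type*} [CommRing R] [IsDomain R]
    [UniqueFactorizationMonoid R] {h v : Fin 3 → R} (hc : ∀ g, (∀ r, g ∣ h r) → IsUnit g)
    {r : Fin 3} (hr : h r ≠ 0) (hv : ∀ i j, v i * h j = v j * h i) :
    ∃ y, ∀ i, v i = y * h i := by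
  classical
  let _ : GCDMonoid R := UniqueFactorizationMonoid.toGCDMonoid R
  let g := gcd (h 0) (gcd (h 1) (h 2))
  have hg : IsUnit g := by
    refine hc g fun i => ?_
    fin_cases i
    · exact gcd_dvd_left _ _
    · exact (gcd_dvd_right _ _).trans (gcd_dvd_left _ _)
    · exact (gcd_dvd_right _ _).trans (gcd_dvd_right _ _)
  have h1 : ∀ j, h r ∣ v r * h j := fun j => ⟨v j, by rw [hv r j, mul_comm]⟩
  have h2 : h r ∣ v r * g :=
    (dvd_gcd (h1 0) ((dvd_gcd (h1 1) (h1 2)).trans (gcd_mul_left' _ _ _).dvd)).trans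
      (gcd_mul_left' _ _ _).dvd
  obtain ⟨y, hy⟩ := (hg.dvd_mul_right).1 h2
  refine ⟨y, fun i => mul_right_cancel₀ hr ?_⟩
  rw [hv i r, hy]
  ring

variable {k : Type*} [Field k] {h : Fin 3 → MvPolynomial (Fin 2) k} {e : Fin 3 → ℕ} {m m' : ℕ}
  {A A' : Fin 3 → MvPolynomial (Fin 2) k}

theorem IsSyzPair.cross0 (H : IsSyzPair h e m m' A A') : h 0 = A 1 * A' 2 - A 2 * A' 1 :=
  (H.cross 0).symm

theorem IsSyzPair.cross1 (H : IsSyzPair h e m m' A A') : h 1 = A 2 * A' 0 - A 0 * A' 2 :=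
  (H.cross 1).symm

theorem IsSyzPair.cross2 (H : IsSyzPair h e m m' A A') : h 2 = A 0 * A' 1 - A 1 * A' 0 :=
  (H.cross 2).symm

theorem IsSyzPair.wdeg_h (H : IsSyzPair h e m m' A A') (r : Fin 3) : WDeg (h r) 0 (e r) := by
  have hs := H.add_eq
  rw [Fin.sum_univ_three] at hs
  rw [← H.cross r]
  have h1 := (H.wdeg (r + 1)).mul (H.wdeg' (r + 2))
  have h2 := (H.wdeg (r + 2)).mul (H.wdeg' (r + 1))
  intro s hs'
  have := (h1.sub (by rwa [add_comm (e (r + 2))] at h2)) s hs'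
  fin_cases r <;> simp at this ⊢ <;> omega

theorem IsSyzPair.sum_eq_zero (H : IsSyzPair h e m m' A A') : ∑ r, A r * h r = 0 := by
  rw [Fin.sum_univ_three, H.cross0, H.cross1, H.cross2]
  ring

theorem IsSyzPair.sum_eq_zero' (H : IsSyzPair h e m m' A A') : ∑ r, A' r * h r = 0 := by
  rw [Fin.sum_univ_three, H.cross0, H.cross1, H.cross2]
  ring

/-- Both `A` and `S` are orthogonal to `h`, so their cross product is parallel to `h`. The degree
bound on `y` is read off at index `r` from `m + m' = ∑ e r`. -/
theorem IsSyzPair.exists_cross_eq (H : IsSyzPair h e m m' A A')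
    (hc : ∀ g, (∀ r, g ∣ h r) → IsUnit g) {r : Fin 3} (hr : h r ≠ 0)
    {S : Fin 3 → MvPolynomial (Fin 2) k} (hS : ∑ r, S r * h r = 0) {N : ℕ}
    (hN : ∀ r, FDeg (S r) (e r) N) :
    ∃ y, FDeg y m' N ∧ ∀ i, A (i + 1) * S (i + 2) - A (i + 2) * S (i + 1) = y * h i := by
  have hS' := hS
  rw [Fin.sum_univ_three, H.cross0, H.cross1, H.cross2] at hS
  obtain ⟨y, hy⟩ := exists_eq_mul_of_parallel
    (v := fun i => A (i + 1) * S (i + 2) - A (i + 2) * S (i + 1)) hc hr (fun i j => by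
      fin_cases i <;> fin_cases j <;> simp [H.cross0, H.cross1, H.cross2] <;>
      first
      | ring1
      | linear_combination A 0 * hS | linear_combination A 1 * hS | linear_combination A 2 * hS
      | linear_combination - A 0 * hS | linear_combination - A 1 * hS
      | linear_combination - A 2 * hS)
  refine ⟨y, ?_, hy⟩
  have hs := H.add_eq
  rw [Fin.sum_univ_three] at hs
  have h1 := (H.wdeg (r + 1)).fdeg.mul (hN (r + 2))
  have h2 := (H.wdeg (r + 2)).fdeg.mul (hN (r + 1))
  have h3 := h1.sub (by rwa [add_comm (e (r + 2))] at h2)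
  have hy' := hy r
  rw [hy', mul_comm] at h3
  refine FDeg.of_mul (H.wdeg_h r) hr ?_
  refine h3.congr ?_
  fin_cases r <;> simp <;> omega

/-- Cramer's rule: the cross products of `S` with `A` and `A'`, divided by `h`, are the
coefficients. Thus the pair generates all syzygies, with control of degrees. -/
theorem IsSyzPair.exists_eq_add (H : IsSyzPair h e m m' A A')
    (hc : ∀ g, (∀ r, g ∣ h r) → IsUnit g) {r : Fin 3} (hr : h r ≠ 0)
    {S : Fin 3 → MvPolynomial (Fin 2) k} (hS : ∑ r, S r * h r = 0) {N : ℕ}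
    (hN : ∀ r, FDeg (S r) (e r) N) :
    ∃ x y, FDeg x m N ∧ FDeg y m' N ∧ ∀ i, S i = x * A i + y * A' i := by
  obtain ⟨y, hy, hy'⟩ := H.exists_cross_eq hc hr hS hN
  obtain ⟨x, hx, hx'⟩ := H.swap.exists_cross_eq hc hr hS hN
  rw [Fin.sum_univ_three, H.cross0, H.cross1, H.cross2] at hS
  -- `A × S` yields `y`, while `A' × S` yields the negative of the other coefficient because `A' × A
  -- = -h`.
  refine ⟨-x, y, hx.neg, hy, fun i => mul_left_cancel₀ hr ?_⟩
  have e1 := hy' r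
  have e2 := hx' r
  have e3 : h r * S i = -(x * h r) * A i + y * h r * A' i := by
    rw [← e1, ← e2]
    fin_cases r <;> fin_cases i <;> simp [H.cross0, H.cross1, H.cross2] <;>
      first
      | ring1
      | linear_combination hS
  rw [e3]
  ring

theorem IsSyzPair.ne_zero (H : IsSyzPair h e m m' A A') {r : Fin 3} (hr : h r ≠ 0) : A ≠ 0 := by
  rintro rfl
  apply hr
  rw [← H.cross r]
  simp

/-- A non-zero combination `x A + y A'` of degree `n` has `x ≠ 0` or `y ≠ 0`, which forces `m ≤ n`
or `m' ≤ n`. -/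
theorem IsSyzPair.minSyzygyDegree_eq (H : IsSyzPair h e m m' A A')
    (hc : ∀ g, (∀ r, g ∣ h r) → IsUnit g) (h0 : ∀ r, h r ≠ 0) :
    minSyzygyDegree k h = min m m' := by
  have key : ∀ {m m' A A'}, IsSyzPair h e m m' A A' → m ∈ {n : ℕ | ∃ A : Fin 3 →
      MvPolynomial (Fin 2) k, A ≠ 0 ∧ (∀ i, (A i * h i).IsHomogeneous n) ∧
      ∑ i, A i * h i = 0} := by
    intro m m' A A' H
    refine ⟨A, H.ne_zero (h0 0), fun i => ?_, H.sum_eq_zero⟩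
    rw [← wdeg_zero_iff]
    intro s hs
    have := ((H.wdeg i).mul (H.wdeg_h i)) s hs
    omega
  apply le_antisymm
  · rcases le_total m m' with hm | hm
    · rw [min_eq_left hm]
      exact Nat.sInf_le (key H)
    · rw [min_eq_right hm]
      exact Nat.sInf_le (key H.swap)
  · refine le_csInf ⟨m, key H⟩ ?_
    rintro n ⟨S, hS0, hS, hS'⟩
    have hN : ∀ r, FDeg (S r) (e r) n := fun r => by
      have h1 := wdeg_zero_iff.2 (hS r)
      rw [mul_comm] at h1
      refine ((H.wdeg_h r).of_mul (h0 r) (e' := e r) (m' := n) ?_).fdeg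
      convert h1.shift (e r) using 1
      ring
    obtain ⟨x, y, hx, hy, hxy⟩ := H.exists_eq_add hc (h0 0) hS' hN
    by_cases hx0 : x = 0
    · by_cases hy0 : y = 0
      · refine absurd ?_ hS0
        funext i
        simp [hxy i, hx0, hy0]
      · exact (min_le_right _ _).trans (hy.le hy0)
    · exact (min_le_left _ _).trans (hx.le hx0)

theorem HasSyzPair.syzygyGap_eq (H : HasSyzPair h e m m')
    (hc : ∀ g, (∀ r, g ∣ h r) → IsUnit g) (h0 : ∀ r, h r ≠ 0) :
    syzygyGap k h = |(m : ℤ) - m'| := by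
  obtain ⟨A, A', H⟩ := H
  have hd : ∀ r, (h r).totalDegree = e r := fun r =>
    (wdeg_zero_iff.1 (H.wdeg_h r)).totalDegree (h0 r)
  have hs := congrArg (Nat.cast : ℕ → ℤ) H.add_eq
  push_cast at hs
  rw [syzygyGap, H.minSyzygyDegree_eq hc h0]
  simp only [hd]
  rw [← hs]
  rcases le_total m m' with hm | hm
  · rw [min_eq_left hm, abs_of_nonpos (by simpa using hm)]
    ring
  · rw [min_eq_right hm, abs_of_nonneg (by simpa using hm)]
    ring

/-- The elements of degree at most `N` of the ideal generated by the `h r`. -/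
def idealLE (h : Fin 3 → MvPolynomial (Fin 2) k) (e : Fin 3 → ℕ) (N : ℕ) :
    Submodule k (MvPolynomial (Fin 2) k) :=
  ⨆ r, (restrictTotalDegree (Fin 2) k (N - e r)).map (LinearMap.mulLeft k (h r))

/-- The map `S ↦ ∑ S r * h r`. -/
def combine {ι A : Type*} [Fintype ι] [CommRing A] [Algebra k A] (h : ι → A) :
    (ι → A) →ₗ[k] A :=
  sumMap fun r => LinearMap.mulLeft k (h r)

theorem combine_apply {ι A : Type*} [Fintype ι] [CommRing A] [Algebra k A] (h S : ι → A) :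
    combine (k := k) h S = ∑ r, S r * h r := by
  simp [combine, sumMap_apply, mul_comm]

theorem iSup_map_mulLeft {ι A : Type*} [Fintype ι] [CommRing A] [Algebra k A] (h : ι → A)
    (p : ι → Submodule k A) :
    ⨆ r, (p r).map (LinearMap.mulLeft k (h r))
      = (Submodule.pi Set.univ p).map (combine h) :=
  iSup_map_eq _ p

/-- Dimension count in the resolution with generators of degrees `e r` and relations of degrees `m`,
`m'`, cut off at degree `N`. The bound on `N` keeps all the natural-number subtractions honest. -/
theorem IsSyzPair.finrank_idealLE (H : IsSyzPair h e m m' A A')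
    (hc : ∀ g, (∀ r, g ∣ h r) → IsUnit g) (h0 : ∀ r, h r ≠ 0) {N : ℕ} (hN : ∑ r, e r ≤ N) :
    (finrank k (restrictTotalDegree (Fin 2) k N) : ℝ) - finrank k (idealLE h e N)
      = ((m : ℝ) ^ 2 + (m' : ℝ) ^ 2 - ∑ r, (e r : ℝ) ^ 2) / 2 := by
  have hs := H.add_eq
  have her : ∀ r, e r ≤ N := fun r =>
    (Finset.single_le_sum (f := e) (fun _ _ => Nat.zero_le _) (Finset.mem_univ r)).trans hN
  let Y := Submodule.pi Set.univ fun r => restrictTotalDegree (Fin 2) k (N - e r)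
  let mm : Fin 2 → ℕ := ![m, m']
  let Z := Submodule.pi Set.univ fun i => restrictTotalDegree (Fin 2) k (N - mm i)
  let Γ : (Fin 2 → MvPolynomial (Fin 2) k) →ₗ[k] (Fin 3 → MvPolynomial (Fin 2) k) :=
    LinearMap.pi fun r => combine ![A r, A' r]
  have hΓ : ∀ x r, Γ x r = x 0 * A r + x 1 * A' r := fun x r => by
    simp [Γ, combine_apply]
  have hΓi : Function.Injective Γ := by
    rw [← LinearMap.ker_eq_bot, LinearMap.ker_eq_bot']
    intro x hx
    have hx' : ∀ r, x 0 * A r + x 1 * A' r = 0 := fun r => by rw [← hΓ, hx]; rfl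
    funext i
    refine mul_right_cancel₀ (h0 0) ?_
    rw [H.cross0]
    fin_cases i
    · simp only [Fin.zero_eta, Pi.zero_apply, zero_mul]
      linear_combination A' 2 * hx' 1 - A' 1 * hx' 2
    · simp only [Fin.mk_one, Pi.zero_apply, zero_mul]
      linear_combination A 1 * hx' 2 - A 2 * hx' 1
  have hker : Y ⊓ LinearMap.ker (combine h) = Z.map Γ := by
    ext S
    constructor
    · rintro ⟨hS, hS'⟩
      rw [SetLike.mem_coe, LinearMap.mem_ker, combine_apply] at hS'
      obtain ⟨x, y, hx, hy, hxy⟩ := H.exists_eq_add hc (h0 0) hS' (N := N) fun r =>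
        (fdeg_iff (her r)).2 (hS r trivial)
      refine ⟨![x, y], fun i _ => ?_, ?_⟩
      · fin_cases i
        · exact (fdeg_iff (show m ≤ N by omega)).1 hx
        · exact (fdeg_iff (show m' ≤ N by omega)).1 hy
      · funext r
        rw [hΓ, hxy r]
        simp
    · rintro ⟨x, hx, rfl⟩
      have hx0 : FDeg (x 0) m N := (fdeg_iff (by omega)).2 (hx 0 trivial)
      have hx1 : FDeg (x 1) m' N := (fdeg_iff (by omega)).2 (hx 1 trivial)
      constructor
      · intro r _
        refine (fdeg_iff (her r)).1 ?_
        rw [hΓ]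
        exact ((hx0.mul (H.wdeg r).fdeg).congr (by ring)).add
          ((hx1.mul (H.wdeg' r).fdeg).congr (by ring))
      · rw [SetLike.mem_coe, LinearMap.mem_ker, combine_apply]
        simp only [hΓ]
        have h1 := H.sum_eq_zero
        have h2 := H.sum_eq_zero'
        rw [Fin.sum_univ_three] at h1 h2 ⊢
        linear_combination x 0 * h1 + x 1 * h2
  have hd := finrank_map_add_finrank_inf_ker (combine h) Y
  rw [hker, finrank_map_of_injective Γ hΓi, finrank_pi_univ, finrank_pi_univ,
    ← iSup_map_mulLeft, Fin.sum_univ_three, Fin.sum_univ_two] at hd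
  have hd' := congrArg (Nat.cast : ℕ → ℝ) hd
  push_cast at hd'
  rw [finrank_restrictTotalDegree_two, finrank_restrictTotalDegree_two,
    finrank_restrictTotalDegree_two, finrank_restrictTotalDegree_two,
    finrank_restrictTotalDegree_two, Nat.cast_sub (her 0), Nat.cast_sub (her 1),
    Nat.cast_sub (her 2), Nat.cast_sub (show mm 0 ≤ N by simp [mm]; omega),
    Nat.cast_sub (show mm 1 ≤ N by simp [mm]; omega)] at hd'
  simp only [mm, Matrix.cons_val_zero, Matrix.cons_val_one] at hd'
  have hs' := congrArg (Nat.cast : ℕ → ℝ) hs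
  push_cast at hs'
  rw [Fin.sum_univ_three] at hs'
  rw [finrank_restrictTotalDegree_two, Fin.sum_univ_three, idealLE]
  -- Up to a constant, a summand of shift `x` has dimension `(N + 3/2 - x) ^ 2 / 2`; the terms
  -- linear in `N + 3/2` cancel by `m + m' = ∑ e r`.
  linear_combination -hd' - (N + 3 / 2) * hs'

end Cramer

/-! ## Syzygy gaps of powers of linear forms -/

section Gap

open MvPolynomial

variable {k : Type*} [Field k]

theorem lin_ne_zero (s : Fin 3) : lin k s ≠ 0 := by
  obtain ⟨y, hl⟩ := exists_isLinearForm_lin (k := k) s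
  exact hl.ne_zero

theorem lin_isHomogeneous (s : Fin 3) : (lin k s).IsHomogeneous 1 := by
  obtain ⟨y, hl⟩ := exists_isLinearForm_lin (k := k) s
  exact hl.hom

theorem eval_linPt_lin_self (s : Fin 3) : eval (linPt k s) (lin k s) = 0 := by
  obtain ⟨y, hl⟩ := exists_isLinearForm_lin (k := k) s
  exact hl.eval_zero

theorem eval_linPt_lin_ne_zero {s t : Fin 3} (h : t ≠ s) : eval (linPt k s) (lin k t) ≠ 0 := by
  fin_cases s <;> fin_cases t <;> simp [linPt, lin] at h ⊢

theorem linMon_ne_zero (η : Fin 3 → Fin 3 → ℕ) (r : Fin 3) : linMon k η r ≠ 0 :=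
  Finset.prod_ne_zero_iff.2 fun s _ => pow_ne_zero _ (lin_ne_zero s)

theorem linMon_isHomogeneous (η : Fin 3 → Fin 3 → ℕ) (r : Fin 3) :
    (linMon k η r).IsHomogeneous (∑ s, η r s) := by
  refine IsHomogeneous.prod _ _ _ fun s _ => ?_
  simpa using (lin_isHomogeneous (k := k) s).pow (η r s)

/-- An irreducible common factor divides some `lin k s`, hence is proportional to it and vanishes at
`linPt k s`; but a product not containing `lin k s` does not vanish there. -/
theorem linMon_coprime {η : Fin 3 → Fin 3 → ℕ} (hη : ∀ s, ∃ r, η r s = 0)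
    (g : MvPolynomial (Fin 2) k) (hg : ∀ r, g ∣ linMon k η r) : IsUnit g := by
  by_contra hu
  have hg0 : g ≠ 0 := fun h => linMon_ne_zero η 0 (zero_dvd_iff.1 (h ▸ hg 0))
  obtain ⟨π, hπ, hπg⟩ := WfDvdMonoid.exists_irreducible_factor hu hg0
  obtain ⟨s, -, hs⟩ := (hπ.prime.dvd_finsetProd_iff _).1 (hπg.trans (hg 0))
  obtain ⟨c, hc⟩ := hπ.prime.dvd_of_dvd_pow hs
  have hc0 : c ≠ 0 := fun h => lin_ne_zero s (by rw [hc, h, mul_zero])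
  have hd := totalDegree_mul_of_isDomain hπ.ne_zero hc0
  rw [← hc, (lin_isHomogeneous s).totalDegree (lin_ne_zero s)] at hd
  have h1 : π.totalDegree ≠ 0 := fun h => by
    have h2 := totalDegree_eq_zero_iff_eq_C.1 h
    apply hπ.not_isUnit
    rw [h2]
    refine (IsUnit.mk0 _ fun h3 => hπ.ne_zero ?_).map C
    rw [h2, h3, C_0]
  have h2 := totalDegree_eq_zero_iff_eq_C.1 (show c.totalDegree = 0 by omega)
  have h3 : eval (linPt k s) π = 0 := by
    have := congrArg (eval (linPt k s)) hc
    rw [eval_linPt_lin_self, map_mul, h2, eval_C] at this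
    refine (mul_eq_zero.1 this.symm).resolve_right fun h4 => hc0 ?_
    rw [h2, h4, C_0]
  obtain ⟨r, hr⟩ := hη s
  obtain ⟨b, hb⟩ := hπg.trans (hg r)
  have h4 := congrArg (eval (linPt k s)) hb
  rw [map_mul, h3, zero_mul, linMon, map_prod, Finset.prod_eq_zero_iff] at h4
  obtain ⟨t, -, ht⟩ := h4
  by_cases hts : t = s
  · subst hts
    simp [hr] at ht
  · rw [map_pow] at ht
    exact pow_ne_zero _ (eval_linPt_lin_ne_zero hts) ht

theorem HasSyzPair.syzygyGap_linMon {η : Fin 3 → Fin 3 → ℕ} {m m' : ℕ}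
    (hη : ∀ s, ∃ r, η r s = 0) (H : HasSyzPair (linMon k η) (fun r => ∑ s, η r s) m m') :
    syzygyGap k (linMon k η) = |(m : ℤ) - m'| :=
  H.syzygyGap_eq (linMon_coprime hη) (linMon_ne_zero η)

/-- Exponents of a triple of powers of the linear forms. -/
def diagExp (n : Fin 3 → ℕ) (r s : Fin 3) : ℕ := if r = s then n r else 0

theorem linMon_diagExp (n : Fin 3 → ℕ) : linMon k (diagExp n) = linePowers k n := by
  funext r
  rw [linMon, Finset.prod_eq_single r]
  · fin_cases r <;> simp [lin, linePowers, diagExp]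
  · intro s _ hs
    simp [diagExp, hs.symm]
  · simp

theorem sum_diagExp (n : Fin 3 → ℕ) : (fun r => ∑ s, diagExp n r s) = n := by
  funext r
  simp [diagExp]

theorem linePowers_apply (n : Fin 3 → ℕ) (r : Fin 3) : linePowers k n r = lin k r ^ n r := by
  fin_cases r <;> simp [lin, linePowers]

theorem diagExp_zero (n : Fin 3 → ℕ) (s : Fin 3) : ∃ r, diagExp n r s = 0 :=
  ⟨s + 1, by fin_cases s <;> simp [diagExp]⟩

theorem exists_hasSyzPair_linePowers (n : Fin 3 → ℕ) :
    ∃ m m', HasSyzPair (linePowers k n) n m m' := by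
  have := exists_hasSyzPair_linMon (k := k) (diagExp n)
  rwa [linMon_diagExp, sum_diagExp] at this

theorem HasSyzPair.syzygyGap_linePowers {n : Fin 3 → ℕ} {m m' : ℕ}
    (H : HasSyzPair (linePowers k n) n m m') :
    syzygyGap k (linePowers k n) = |(m : ℤ) - m'| := by
  have h := linMon_diagExp (k := k) n
  rw [← h]
  refine HasSyzPair.syzygyGap_linMon (diagExp_zero n) ?_
  rwa [h, sum_diagExp]

theorem WDeg.pow {f : MvPolynomial (Fin 2) k} {e m : ℕ} (h : WDeg f e m) (n : ℕ) :
    WDeg (f ^ n) (n * e) (n * m) := by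
  induction n with
  | zero =>
    simp only [pow_zero, zero_mul, wdeg_zero_iff]
    exact isHomogeneous_one _ _
  | succ n ih =>
    rw [pow_succ]
    convert ih.mul h using 1 <;> ring

/-- The `p`-th power map is a ring homomorphism, so it carries minors to minors. -/
theorem HasSyzPair.frobenius (p : ℕ) [Fact p.Prime] [CharP k p]
    {h : Fin 3 → MvPolynomial (Fin 2) k} {e : Fin 3 → ℕ} {m m' : ℕ} (H : HasSyzPair h e m m') :
    HasSyzPair (fun r => h r ^ p) (fun r => p * e r) (p * m) (p * m') := by
  obtain ⟨A, A', H⟩ := H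
  refine ⟨fun r => A r ^ p, fun r => A' r ^ p, ?_, fun r => (H.wdeg r).pow p,
    fun r => (H.wdeg' r).pow p, fun r => ?_⟩
  · rw [← mul_add, H.add_eq, Finset.mul_sum]
  · rw [← H.cross r, sub_pow_char, mul_pow, mul_pow]

theorem syzygyGap_linePowers_mul (p : ℕ) [Fact p.Prime] [CharP k p] (n : Fin 3 → ℕ) :
    syzygyGap k (linePowers k fun i => p * n i) = p * syzygyGap k (linePowers k n) := by
  obtain ⟨m, m', H⟩ := exists_hasSyzPair_linePowers (k := k) n
  have H' := H.frobenius p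
  have h : (fun r => linePowers k n r ^ p) = linePowers k fun i => p * n i := by
    funext r
    rw [linePowers_apply, linePowers_apply, ← pow_mul, mul_comm]
  rw [h] at H'
  rw [H.syzygyGap_linePowers, H'.syzygyGap_linePowers]
  push_cast
  rw [← mul_sub, abs_mul, Nat.abs_cast]

/-- One more linear factor raises exactly one of `m`, `m'` by one. -/
theorem abs_syzygyGap_update_sub_le (n : Fin 3 → ℕ) (r : Fin 3) :
    |syzygyGap k (linePowers k (Function.update n r (n r + 1))) - syzygyGap k (linePowers k n)|
      ≤ 1 := by
  obtain ⟨m, m', H⟩ := exists_hasSyzPair_linePowers (k := k) n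
  obtain ⟨y, hl⟩ := exists_isLinearForm_lin (k := k) r
  have h : Function.update (linePowers k n) r (lin k r * linePowers k n r)
      = linePowers k (Function.update n r (n r + 1)) := by
    funext i
    by_cases hi : i = r
    · subst hi
      rw [Function.update_self, linePowers_apply, linePowers_apply, Function.update_self, pow_succ']
    · rw [Function.update_of_ne hi, linePowers_apply, linePowers_apply, Function.update_of_ne hi]
  have H' := H.mul_linear hl r
  rw [h] at H'
  rw [H.syzygyGap_linePowers]
  rcases H' with H' | H' <;> rw [H'.syzygyGap_linePowers] <;> push_cast <;>
    rcases abs_cases ((m : ℤ) - m') with h1 | h1 <;> simp only [abs_le] <;>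
    first
    | (rcases abs_cases ((m : ℤ) - (m' + 1)) with h2 | h2 <;> constructor <;> omega)
    | (rcases abs_cases ((m : ℤ) + 1 - m') with h2 | h2 <;> constructor <;> omega)

theorem abs_syzygyGap_sub_le_of_le {n n' : Fin 3 → ℕ} (h : n ≤ n') :
    |syzygyGap k (linePowers k n') - syzygyGap k (linePowers k n)| ≤ ∑ i, ((n' i : ℤ) - n i) := by
  induction hN : ∑ i, (n' i - n i) generalizing n' with
  | zero =>
    have : n' = n := by
      funext i
      have h1 : n' i - n i = 0 := (Finset.sum_eq_zero_iff.1 hN) i (Finset.mem_univ _)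
      have h2 : n i ≤ n' i := h i
      omega
    simp [this]
  | succ N ih =>
    obtain ⟨r, hr⟩ : ∃ r, n' r - n r ≠ 0 := by
      by_contra! h
      simp [h] at hN
    let n₁ := Function.update n' r (n' r - 1)
    have e1 : n' = Function.update n₁ r (n₁ r + 1) := by
      simp only [n₁, Function.update_self, Function.update_idem]
      rw [Nat.sub_add_cancel (by omega), Function.update_eq_self]
    have h1 : n ≤ n₁ := by
      intro i
      by_cases hi : i = r
      · subst hi
        simp only [n₁, Function.update_self]
        omega
      · simp only [n₁, Function.update_of_ne hi]
        exact h i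
    have hsum : ∑ i, n' i = ∑ i, n₁ i + 1 := by
      rw [e1, Finset.sum_update_of_mem (Finset.mem_univ r),
        ← Finset.add_sum_erase Finset.univ n₁ (Finset.mem_univ r),
        ← Finset.sdiff_singleton_eq_erase]
      ring
    have hN' : ∑ i, (n₁ i - n i) = N := by
      rw [Finset.sum_tsub_distrib _ fun i _ => h i] at hN
      rw [Finset.sum_tsub_distrib _ fun i _ => h1 i]
      omega
    have h2 := ih h1 hN'
    have h3 := abs_syzygyGap_update_sub_le (k := k) n₁ r
    rw [← e1] at h3
    have h4 := congrArg (Nat.cast : ℕ → ℤ) hsum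
    push_cast at h4
    rw [Finset.sum_sub_distrib] at h2 ⊢
    rw [h4]
    have := abs_sub_le (syzygyGap k (linePowers k n')) (syzygyGap k (linePowers k n₁))
      (syzygyGap k (linePowers k n))
    linarith

theorem abs_syzygyGap_sub_le (n n' : Fin 3 → ℕ) :
    |syzygyGap k (linePowers k n') - syzygyGap k (linePowers k n)| ≤ ∑ i, |(n' i : ℤ) - n i| := by
  have h1 := abs_syzygyGap_sub_le_of_le (k := k) (le_sup_left : n ≤ n ⊔ n')
  have h2 := abs_syzygyGap_sub_le_of_le (k := k) (le_sup_right : n' ≤ n ⊔ n')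
  have h3 : ∑ i, |(n' i : ℤ) - n i| = ∑ i, (((n ⊔ n') i : ℤ) - n i)
      + ∑ i, (((n ⊔ n') i : ℤ) - n' i) := by
    rw [← Finset.sum_add_distrib]
    refine Finset.sum_congr rfl fun i _ => ?_
    rw [Pi.sup_apply]
    push_cast
    rcases le_total (n i : ℤ) (n' i) with h | h
    · rw [max_eq_right h, abs_of_nonneg (by linarith)]
      ring
    · rw [max_eq_left h, abs_of_nonpos (by linarith)]
      ring
  rw [h3]
  have := abs_sub_le (syzygyGap k (linePowers k n')) (syzygyGap k (linePowers k (n ⊔ n')))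
    (syzygyGap k (linePowers k n))
  rw [abs_sub_comm] at h2
  linarith

theorem WDeg.aeval {f : MvPolynomial (Fin 2) k} {e m : ℕ} (h : WDeg f e m)
    {g : Fin 2 → MvPolynomial (Fin 2) k} (hg : ∀ i, (g i).IsHomogeneous 1) :
    WDeg (aeval g f) e m := by
  by_cases hf : f = 0
  · rw [hf, map_zero]
    exact wdeg_zero _ _
  · have he := h.le hf
    obtain ⟨n, rfl⟩ := Nat.exists_eq_add_of_le' he
    have h1 : WDeg f 0 n := (show WDeg f (0 + e) (n + e) by simpa using h).unshift
    have h2 := (wdeg_zero_iff.1 h1).aeval (n := 1) g hg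
    rw [one_mul, ← wdeg_zero_iff] at h2
    simpa using h2.shift e

/-- The substitution `X ↦ X + Y`, `Y ↦ -Y` exchanges `X` and `X + Y` and preserves `Y` up to sign.
This symmetry reconciles the two orders in which the arguments of `δ` are listed for equal
exponents. -/
theorem syzygyGap_linePowers_swap (n : Fin 3 → ℕ) :
    syzygyGap k (linePowers k ![n 2, n 1, n 0]) = syzygyGap k (linePowers k n) := by
  obtain ⟨m, m', H⟩ := exists_hasSyzPair_linePowers (k := k) n
  rw [H.syzygyGap_linePowers]
  obtain ⟨A, A', H⟩ := H
  let g : Fin 2 → MvPolynomial (Fin 2) k := ![X 0 + X 1, -X 1]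
  have hg : ∀ i, (g i).IsHomogeneous 1 := fun i => by
    fin_cases i
    · exact (isHomogeneous_X _ _).add (isHomogeneous_X _ _)
    · exact (isHomogeneous_X _ _).neg
  let ψ := aeval (R := k) g
  -- The sign coming from `(-Y) ^ n 1`. It is its own inverse, so suitable entries can be multiplied
  -- by it to remove it from the minors.
  let ε : MvPolynomial (Fin 2) k := C ((-1) ^ n 1)
  have hε : ε * ε = 1 := by
    simp only [ε, ← C_mul, ← mul_pow]
    simp
  have hεh : ∀ {f : MvPolynomial (Fin 2) k} {e m : ℕ}, WDeg f e m → WDeg (ε * f) e m := by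
    intro f e m hf
    have := (wdeg_zero_iff.2 (isHomogeneous_C (Fin 2) ((-1 : k) ^ n 1))).mul hf
    rwa [zero_add, zero_add] at this
  have h0 := congrArg ψ H.cross0
  have h1 := congrArg ψ H.cross1
  have h2 := congrArg ψ H.cross2
  have hψ0 : ψ (linePowers k n 0) = (X 0 + X 1) ^ n 0 := by simp [linePowers, ψ, g]
  have hψ1 : ψ (linePowers k n 1) = ε * X 1 ^ n 1 := by
    rw [linePowers_apply]
    simp only [ψ, g, ε, lin, map_pow, Matrix.cons_val_one, Matrix.cons_val_zero, aeval_X, map_neg,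
      map_one]
    rw [neg_pow]
  have hψ2 : ψ (linePowers k n 2) = X 0 ^ n 2 := by simp [linePowers, ψ, g]
  rw [hψ0] at h0
  rw [hψ1] at h1
  rw [hψ2] at h2
  simp only [map_sub, map_mul] at h0 h1 h2
  refine HasSyzPair.syzygyGap_linePowers ⟨![ψ (A 2), ε * ψ (A 1), ψ (A 0)],
    ![-(ε * ψ (A' 2)), -ψ (A' 1), -(ε * ψ (A' 0))], ?_, fun r => ?_, fun r => ?_, fun r => ?_⟩
  · rw [H.add_eq]
    simp [Fin.sum_univ_three]
    ring
  · fin_cases r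
    · exact (H.wdeg 2).aeval hg
    · exact hεh ((H.wdeg 1).aeval hg)
    · exact (H.wdeg 0).aeval hg
  · fin_cases r
    · exact (hεh ((H.wdeg' 2).aeval hg)).neg
    · exact ((H.wdeg' 1).aeval hg).neg
    · exact (hεh ((H.wdeg' 0).aeval hg)).neg
  · fin_cases r
    · simp [linePowers]
      linear_combination -(ψ (A 1) * ψ (A' 0)) * hε - h2
    · simp [linePowers]
      linear_combination X 1 ^ n 1 * hε - ε * h1
    · simp [linePowers]
      linear_combination ψ (A 1) * ψ (A' 2) * hε - h0

end Gap

/-! ## Han's function -/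

section Han

/-- The points with coordinates in `ℕ[1/p]`. -/
def padicPoints (p : ℕ) : Set (Fin 3 → ℝ≥0) :=
  Set.range fun x : ℕ × (Fin 3 → ℕ) => fun i => (x.2 i : ℝ≥0) / (p : ℝ≥0) ^ x.1

theorem tendsto_floor_div {p : ℕ} (hp : 1 < p) (t : ℝ≥0) :
    Tendsto (fun e : ℕ => ((⌊(t : ℝ) * (p : ℝ) ^ e⌋₊ : ℕ) : ℝ≥0) / (p : ℝ≥0) ^ e) atTop (𝓝 t) := by
  rw [← NNReal.tendsto_coe]
  push_cast
  exact (tendsto_nat_floor_mul_div_atTop t.coe_nonneg).comp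
    (tendsto_pow_atTop_atTop_of_one_lt (by exact_mod_cast hp))

theorem dense_padicPoints {p : ℕ} (hp : 1 < p) : Dense (padicPoints p) := by
  intro t
  refine mem_closure_of_tendsto (b := (atTop : Filter ℕ)) (f := fun e : ℕ => fun i =>
    ((⌊(t i : ℝ) * (p : ℝ) ^ e⌋₊ : ℕ) : ℝ≥0) / (p : ℝ≥0) ^ e) ?_
    (Eventually.of_forall fun e => ⟨(e, fun i => ⌊(t i : ℝ) * (p : ℝ) ^ e⌋₊), rfl⟩)
  rw [tendsto_pi_nhds]
  exact fun i => tendsto_floor_div hp (t i)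

variable {k : Type*} [Field k] {p : ℕ} [Fact p.Prime]

theorem IsHanDelta.eq {δ δ' : (Fin 3 → ℝ≥0) → ℝ} (h : IsHanDelta k p δ)
    (h' : IsHanDelta k p δ') : δ = δ' := by
  refine h.1.ext_on (dense_padicPoints (Fact.out : p.Prime).one_lt) h'.1 ?_
  rintro _ ⟨⟨e, n⟩, rfl⟩
  simp only [h.2, h'.2]

theorem IsHanDelta.swap {δ : (Fin 3 → ℝ≥0) → ℝ} (h : IsHanDelta k p δ) (t : Fin 3 → ℝ≥0) :
    δ ![t 2, t 1, t 0] = δ t := by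
  have h1 : IsHanDelta k p fun t => δ ![t 2, t 1, t 0] := by
    refine ⟨h.1.comp ?_, fun e n => ?_⟩
    · refine continuous_pi fun i => ?_
      fin_cases i <;> simp <;> fun_prop
    · rw [← syzygyGap_linePowers_swap n, ← h.2 e ![n 2, n 1, n 0]]
      refine congrArg δ (funext fun i => ?_)
      fin_cases i <;> rfl
  exact congrFun (h1.eq h) t

variable [CharP k p]

theorem IsHanDelta.map_mul {δ : (Fin 3 → ℝ≥0) → ℝ} (h : IsHanDelta k p δ) (t : Fin 3 → ℝ≥0) :
    δ (fun i => (p : ℝ≥0) * t i) = p * δ t := by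
  have hp := (Fact.out : p.Prime)
  have h1 : Continuous fun t : Fin 3 → ℝ≥0 => δ fun i => (p : ℝ≥0) * t i :=
    h.1.comp (by fun_prop)
  have h2 : Continuous fun t : Fin 3 → ℝ≥0 => (p : ℝ) * δ t := continuous_const.mul h.1
  refine congrFun (h1.ext_on (dense_padicPoints hp.one_lt) h2 ?_) t
  rintro _ ⟨⟨e, n⟩, rfl⟩
  have e1 : (fun i => (p : ℝ≥0) * ((n i : ℝ≥0) / (p : ℝ≥0) ^ e))
      = fun i => ((p * n i : ℕ) : ℝ≥0) / (p : ℝ≥0) ^ e := by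
    funext i
    push_cast
    rw [mul_div_assoc]
  have e3 := h.2 e n
  have e4 := h.2 e fun i => p * n i
  simp only
  rw [e1, e4, e3, syzygyGap_linePowers_mul]
  push_cast
  ring

theorem syzygyGap_linePowers_pow_mul (j : ℕ) (n : Fin 3 → ℕ) :
    syzygyGap k (linePowers k fun i => p ^ j * n i) = p ^ j * syzygyGap k (linePowers k n) := by
  induction j with
  | zero => simp
  | succ j ih =>
    have := syzygyGap_linePowers_mul (k := k) p fun i => p ^ j * n i
    simp only [← mul_assoc, ← pow_succ'] at this
    rw [this, ih, pow_succ']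
    ring

/-- Frobenius brings both points to the common denominator `p ^ (e + e')`, where the integral
Lipschitz estimate applies. The factor 3 bounds a sum over three coordinates by the sup metric. -/
theorem abs_gap_div_sub_le (e e' : ℕ) (n n' : Fin 3 → ℕ) :
    |(syzygyGap k (linePowers k n) : ℝ) / (p : ℝ) ^ e
        - (syzygyGap k (linePowers k n') : ℝ) / (p : ℝ) ^ e'|
      ≤ 3 * dist (fun i => (n i : ℝ≥0) / (p : ℝ≥0) ^ e) fun i => (n' i : ℝ≥0) / (p : ℝ≥0) ^ e' := by
  have hp0 : (0 : ℝ) < p := by exact_mod_cast (Fact.out : p.Prime).pos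
  have h1 := abs_syzygyGap_sub_le (k := k) (fun i => p ^ e * n' i) fun i => p ^ e' * n i
  rw [syzygyGap_linePowers_pow_mul, syzygyGap_linePowers_pow_mul] at h1
  have h2 : |(p : ℝ) ^ e' * (syzygyGap k (linePowers k n) : ℝ)
      - (p : ℝ) ^ e * (syzygyGap k (linePowers k n') : ℝ)|
      ≤ ∑ i, |(p : ℝ) ^ e' * (n i : ℝ) - (p : ℝ) ^ e * (n' i : ℝ)| := by exact_mod_cast h1
  have h3 : ∀ x y : ℝ, |(p : ℝ) ^ e' * x - (p : ℝ) ^ e * y|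
      = (p : ℝ) ^ (e + e') * |x / (p : ℝ) ^ e - y / (p : ℝ) ^ e'| := fun x y => by
    rw [← abs_of_pos (pow_pos hp0 (e + e')), ← abs_mul, pow_add]
    congr 1
    field_simp
  simp only [h3] at h2
  rw [← Finset.mul_sum] at h2
  refine (le_of_mul_le_mul_left h2 (pow_pos hp0 _)).trans ?_
  have h4 : ∀ i : Fin 3, |(n i : ℝ) / (p : ℝ) ^ e - (n' i : ℝ) / (p : ℝ) ^ e'|
      ≤ dist (fun i => (n i : ℝ≥0) / (p : ℝ≥0) ^ e) fun i => (n' i : ℝ≥0) / (p : ℝ≥0) ^ e' := by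
    intro i
    refine le_trans (le_of_eq ?_) (dist_le_pi_dist _ _ i)
    rw [NNReal.dist_eq]
    push_cast
    rfl
  refine (Finset.sum_le_sum fun i _ => h4 i).trans ?_
  simp

/-- The Lipschitz estimate is used twice: at distance zero it shows that the value does not depend
on how a point is written as `n / p ^ e`, and it lets the function extend to all of `[0, ∞)^3`. -/
theorem exists_isHanDelta (k : Type*) [Field k] (p : ℕ) [Fact p.Prime] [CharP k p] :
    ∃ δ : (Fin 3 → ℝ≥0) → ℝ, IsHanDelta k p δ := by
  classical
  let val : ℕ × (Fin 3 → ℕ) → ℝ := fun x => (syzygyGap k (linePowers k x.2) : ℝ) / (p : ℝ) ^ x.1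
  let pt : ℕ × (Fin 3 → ℕ) → Fin 3 → ℝ≥0 := fun x i => (x.2 i : ℝ≥0) / (p : ℝ≥0) ^ x.1
  let f : (Fin 3 → ℝ≥0) → ℝ := fun t => if h : ∃ x, pt x = t then val h.choose else 0
  have hle : ∀ x y, |val x - val y| ≤ 3 * dist (pt x) (pt y) := fun x y =>
    abs_gap_div_sub_le x.1 y.1 x.2 y.2
  have hf : ∀ x, f (pt x) = val x := by
    intro x
    have h : ∃ y, pt y = pt x := ⟨x, rfl⟩
    have h1 := hle h.choose x
    rw [h.choose_spec, dist_self, mul_zero] at h1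
    have h2 := abs_nonpos_iff.1 h1
    simp only [f, dif_pos h]
    linarith
  have hL : LipschitzOnWith 3 f (Set.range pt) := by
    refine LipschitzOnWith.of_dist_le_mul ?_
    rintro _ ⟨x, rfl⟩ _ ⟨y, rfl⟩
    rw [hf, hf, Real.dist_eq]
    exact hle x y
  obtain ⟨g, hg, hfg⟩ := hL.extend_real
  refine ⟨g, hg.continuous, fun e n => ?_⟩
  have := hfg ⟨(e, n), rfl⟩
  rw [hf] at this
  exact this.symm

end Han

/-! ## The Fermat curve as a module over the polynomials in two variables -/

section Fermat

open MvPolynomial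

variable (k : Type*) [Field k] (L : ℕ)

/-- The linear forms `X`, `Y`, `-(X + Y)` with sum zero. -/
def lin0 : Fin 3 → MvPolynomial (Fin 2) k := ![X 0, X 1, -(X 0 + X 1)]

theorem sum_lin0 : ∑ s, lin0 k s = 0 := by
  simp [lin0, Fin.sum_univ_three]

/-- The polynomial `X ^ L + Y ^ L + Z ^ L`. -/
def fermat : MvPolynomial (Fin 3) k := ∑ s, X s ^ L

variable [NeZero L]

/-- The remainders of the exponents modulo `L`. -/
def resid (e : Fin 3 →₀ ℕ) (s : Fin 3) : Fin L := Fin.ofNat L (e s)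

/-- The monomial in the three linear forms given by the exponents divided by `L`. -/
def quotMon (e : Fin 3 →₀ ℕ) : MvPolynomial (Fin 2) k := ∏ s, lin0 k s ^ (e s / L)

/-- The linear map onto the free module with basis indexed by `Fin 3 → Fin L`, sending `X ^ L`,
`Y ^ L`, `Z ^ L` to the three linear forms. -/
def toFree : MvPolynomial (Fin 3) k →ₗ[k] ((Fin 3 → Fin L) → MvPolynomial (Fin 2) k) :=
  (basisMonomials (Fin 3) k).constr k fun e => Pi.single (resid L e) (quotMon k L e)

variable {k L}

theorem toFree_monomial (e : Fin 3 →₀ ℕ) (a : k) :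
    toFree k L (monomial e a) = a • Pi.single (resid L e) (quotMon k L e) := by
  have h : (monomial e a : MvPolynomial (Fin 3) k) = a • basisMonomials (Fin 3) k e := by
    rw [coe_basisMonomials, smul_monomial, smul_eq_mul, mul_one]
  rw [h, map_smul, toFree, Module.Basis.constr_basis]

/-- Adding `L • η` to an exponent keeps the remainders modulo `L` and adds `η` to the quotients, so
`toFree` is linear over `L`-th powers of monomials. -/
theorem toFree_mul (η : Fin 3 →₀ ℕ) (G : MvPolynomial (Fin 3) k) :
    toFree k L (monomial (L • η) 1 * G) = (∏ s, lin0 k s ^ η s) • toFree k L G := by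
  induction G using MvPolynomial.induction_on' with
  | monomial e a =>
    have h1 : resid L (L • η + e) = resid L e := by
      funext s
      simp [resid, Fin.ofNat]
    have h2 : quotMon k L (L • η + e) = (∏ s, lin0 k s ^ η s) * quotMon k L e := by
      rw [quotMon, quotMon, ← Finset.prod_mul_distrib]
      refine Finset.prod_congr rfl fun s _ => ?_
      rw [← pow_add]
      congr 1
      simp [Nat.mul_add_div (Nat.pos_of_neZero L)]
    rw [monomial_mul, one_mul, toFree_monomial, toFree_monomial, h1, h2, smul_comm]
    congr 1
    rw [← smul_eq_mul, Pi.single_smul]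
  | add f g hf hg => rw [mul_add, map_add, map_add, hf, hg, smul_add]

theorem toFree_fermat_mul (G : MvPolynomial (Fin 3) k) : toFree k L (fermat k L * G) = 0 := by
  have h : ∀ s, toFree k L (X s ^ L * G) = lin0 k s • toFree k L G := by
    intro s
    have := toFree_mul (L := L) (Finsupp.single s 1) G
    rw [Finsupp.smul_single, smul_eq_mul, mul_one, ← X_pow_eq_monomial] at this
    rw [this]
    congr 1
    rw [Finset.prod_eq_single s]
    · simp
    · intro t _ ht
      simp [ht.symm]
    · simp
  rw [fermat, Finset.sum_mul, map_sum]
  simp only [h]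
  rw [← Finset.sum_smul, sum_lin0, zero_smul]

/-- A section of `toFree`. -/
def ofFree (b : (Fin 3 → Fin L) → MvPolynomial (Fin 2) k) : MvPolynomial (Fin 3) k :=
  ∑ ε, (∏ s, X s ^ (ε s : ℕ)) * aeval ![X 0 ^ L, X 1 ^ L] (b ε)

/-- Each exponent is split into a remainder and a multiple of `L`; the round trip only replaces `Z ^
L` by `-(X ^ L + Y ^ L)`, which agrees with it modulo the Fermat polynomial. Hence anything killed
by `toFree` is a multiple of that polynomial. -/
theorem fermat_dvd_sub (G : MvPolynomial (Fin 3) k) :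
    fermat k L ∣ G - ofFree (toFree k L G) := by
  induction G using MvPolynomial.induction_on' with
  | monomial e a =>
    have h1 : ofFree (toFree k L (monomial e a)) = C a * ((∏ s, X s ^ (e s % L)) *
        (X 0 ^ (L * (e 0 / L)) * X 1 ^ (L * (e 1 / L)) * (-(X 0 ^ L + X 1 ^ L)) ^ (e 2 / L))) := by
      rw [toFree_monomial, ofFree, Finset.sum_eq_single (resid L e)]
      · rw [Pi.smul_apply, Pi.single_eq_same, map_smul, smul_eq_C_mul, quotMon,
          Fin.prod_univ_three (f := fun s => lin0 k s ^ (e s / L))]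
        simp [lin0, resid, Fin.ofNat, ← pow_mul]
        ring
      · intro ε _ hε
        rw [Pi.smul_apply, Pi.single_eq_of_ne hε, smul_zero, map_zero, mul_zero]
      · simp
    have h2 : (monomial e a : MvPolynomial (Fin 3) k) = C a * ((∏ s, X s ^ (e s % L)) *
        (X 0 ^ (L * (e 0 / L)) * X 1 ^ (L * (e 1 / L)) * (X 2 ^ L) ^ (e 2 / L))) := by
      rw [monomial_eq, Finsupp.prod_fintype _ _ (by simp)]
      congr 1
      simp only [Fin.prod_univ_three, ← pow_mul]
      conv_lhs => rw [← Nat.mod_add_div (e 0) L, ← Nat.mod_add_div (e 1) L,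
        ← Nat.mod_add_div (e 2) L]
      simp only [pow_add]
      ring
    rw [h1, h2, ← mul_sub, ← mul_sub, ← mul_sub]
    refine Dvd.dvd.mul_left (Dvd.dvd.mul_left (Dvd.dvd.mul_left ?_ _) _) _
    refine dvd_trans (dvd_of_eq ?_) (sub_dvd_pow_sub_pow _ _ _)
    rw [fermat, Fin.sum_univ_three]
    ring
  | add f g hf hg =>
    have h : ofFree (toFree k L (f + g)) = ofFree (toFree k L f) + ofFree (toFree k L g) := by
      rw [map_add, ofFree, ofFree, ofFree, ← Finset.sum_add_distrib]
      refine Finset.sum_congr rfl fun ε _ => ?_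
      rw [Pi.add_apply, map_add, mul_add]
    rw [h, add_sub_add_comm]
    exact dvd_add hf hg

theorem toFree_eq_zero_iff (G : MvPolynomial (Fin 3) k) :
    toFree k L G = 0 ↔ fermat k L ∣ G := by
  constructor
  · intro h
    have := fermat_dvd_sub (L := L) G
    rw [h] at this
    simpa [ofFree] using this
  · rintro ⟨H, rfl⟩
    exact toFree_fermat_mul H

end Fermat

/-! ## Monomial maps -/

section MonomialMap

open MvPolynomial

variable {k : Type*} [Field k]

/-- Take `det`-th roots of the coordinates and monomials in them with exponents from the adjugate,
since `O` times its adjugate is `det`. Only the existence of roots is used, so `p` may divide `det`.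
-/
theorem exists_torus_point [IsAlgClosed k] (O : Matrix (Fin 3) (Fin 3) ℕ)
    (hO : 0 < (O.map (Nat.cast : ℕ → ℤ)).det) (x : Fin 3 → k) (hx : ∀ r, x r ≠ 0) :
    ∃ u : Fin 3 → k, (∀ s, u s ≠ 0) ∧ ∀ r, ∏ s, u s ^ O r s = x r := by
  set M := O.map (Nat.cast : ℕ → ℤ)
  have hN : 0 < M.det.toNat := by omega
  choose y hy using fun r => IsAlgClosed.exists_pow_nat_eq (x r) hN
  have hy0 : ∀ r, y r ≠ 0 := fun r h => hx r (by rw [← hy r, h, zero_pow hN.ne'])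
  refine ⟨fun s => ∏ r, y r ^ M.adjugate s r, fun s => Finset.prod_ne_zero_iff.2 fun r _ =>
    zpow_ne_zero _ (hy0 r), fun r => ?_⟩
  have h1 : ∀ r', ∏ s, y r' ^ (M.adjugate s r' * (O r s : ℤ)) = y r' ^ ((M * M.adjugate) r r') := by
    intro r'
    rw [Matrix.mul_apply]
    simp only [Fin.prod_univ_three, Fin.sum_univ_three, zpow_add₀ (hy0 r')]
    simp only [M, Matrix.map_apply, mul_comm]
  calc ∏ s, (∏ r', y r' ^ M.adjugate s r') ^ O r s
      = ∏ s, ∏ r', y r' ^ (M.adjugate s r' * (O r s : ℤ)) := by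
        refine Finset.prod_congr rfl fun s _ => ?_
        rw [← Finset.prod_pow]
        refine Finset.prod_congr rfl fun r' _ => ?_
        rw [zpow_mul, zpow_natCast]
    _ = ∏ r', y r' ^ ((M * M.adjugate) r r') := by
        rw [Finset.prod_comm]
        exact Finset.prod_congr rfl fun r' _ => h1 r'
    _ = x r := by
        rw [Matrix.mul_adjugate, Finset.prod_eq_single r]
        · rw [Matrix.smul_apply, Matrix.one_apply_eq, smul_eq_mul, mul_one, ← hy r, ← zpow_natCast,
            Int.toNat_of_nonneg hO.le]
        · intro r' _ hr'
          rw [Matrix.smul_apply, Matrix.one_apply_ne hr'.symm, smul_zero, zpow_zero]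
        · simp

/-- A vector of natural numbers as an exponent. -/
def expo (v : Fin 3 → ℕ) : Fin 3 →₀ ℕ := Finsupp.equivFunOnFinite.symm v

@[simp]
theorem expo_apply (v : Fin 3 → ℕ) (i : Fin 3) : expo v i = v i := rfl

theorem monomial_expo (v : Fin 3 → ℕ) :
    (monomial (expo v) 1 : MvPolynomial (Fin 3) k) = ∏ i, X i ^ v i := by
  rw [monomial_eq, Finsupp.prod_fintype _ _ (by simp)]
  simp

variable (k) in
/-- The map of polynomial rings sending `X r` to the monomial with exponents `O r`. -/
def monMap (O : Matrix (Fin 3) (Fin 3) ℕ) : MvPolynomial (Fin 3) k →ₐ[k] MvPolynomial (Fin 3) k :=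
  aeval fun r => ∏ s, X s ^ O r s

/-- The action of `O` on exponents. -/
def expMap (O : Matrix (Fin 3) (Fin 3) ℕ) (e : Fin 3 →₀ ℕ) : Fin 3 →₀ ℕ :=
  expo fun s => ∑ r, e r * O r s

theorem monMap_monomial (O : Matrix (Fin 3) (Fin 3) ℕ) (e : Fin 3 →₀ ℕ) (a : k) :
    monMap k O (monomial e a) = monomial (expMap O e) a := by
  have h : (monomial (expMap O e) a : MvPolynomial (Fin 3) k) = C a * monomial (expMap O e) 1 := by
    rw [C_mul_monomial, mul_one]
  rw [h, expMap, monomial_expo, monMap, aeval_monomial, Finsupp.prod_fintype _ _ (by simp)]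
  have h1 : ∏ r, (∏ s, (X s : MvPolynomial (Fin 3) k) ^ O r s) ^ e r
      = ∏ s, X s ^ ∑ r, e r * O r s := by
    simp only [← Finset.prod_pow, ← pow_mul, mul_comm (e _)]
    rw [Finset.prod_comm]
    exact Finset.prod_congr rfl fun s _ => Finset.prod_pow_eq_pow_sum _ _ _
  rw [h1, algebraMap_eq]

/-- A point of `F = 0` with non-zero coordinates lifts to a torus point of the Fermat curve, where
the divisibility makes `G` vanish. The Nullstellensatz then gives `F ∣ G`, as `F` is prime. -/
theorem dvd_of_fermat_dvd [IsAlgClosed k] {L : ℕ} {O : Matrix (Fin 3) (Fin 3) ℕ}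
    (hO : 0 < (O.map (Nat.cast : ℕ → ℤ)).det) {F : MvPolynomial (Fin 3) k} (hF : Irreducible F)
    (hFX : ∀ r, ¬ F ∣ X r) {κ : Fin 3 → ℕ}
    (hκ : monMap k O F = (∏ s, X s ^ κ s) * fermat k L) (v : Fin 3 → ℕ)
    {G : MvPolynomial (Fin 3) k} (hG : fermat k L ∣ (∏ s, X s ^ v s) * monMap k O G) : F ∣ G := by
  -- The factor `∏ r, X r` disposes of the points with a zero coordinate, which need not lift.
  have key : (∏ r, X r) * G ∈ vanishingIdeal k (zeroLocus k (Ideal.span {F})) := by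
    rw [mem_vanishingIdeal_iff]
    intro x hx
    have hFx : aeval x F = 0 := hx F (Ideal.mem_span_singleton_self F)
    rw [map_mul, map_prod]
    by_cases hx0 : ∀ r, x r ≠ 0
    · obtain ⟨u, hu, hux⟩ := exists_torus_point O hO x hx0
      have hmon : ∀ H : MvPolynomial (Fin 3) k, aeval u (monMap k O H) = aeval x H := by
        intro H
        rw [monMap, ← AlgHom.comp_apply, comp_aeval]
        congr 2
        funext r
        simp [hux]
      have hpr : ∀ v : Fin 3 → ℕ, aeval u (∏ s, (X s : MvPolynomial (Fin 3) k) ^ v s) ≠ 0 := by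
        intro v
        simp only [map_prod, map_pow, aeval_X]
        exact Finset.prod_ne_zero_iff.2 fun s _ => pow_ne_zero _ (hu s)
      have h1 := congrArg (aeval u) hκ
      rw [hmon, hFx, map_mul] at h1
      have h2 := (mul_eq_zero.1 h1.symm).resolve_left (hpr κ)
      obtain ⟨H, hH⟩ := hG
      have h3 := congrArg (aeval u) hH
      rw [map_mul, map_mul, h2, zero_mul, hmon] at h3
      rw [(mul_eq_zero.1 h3).resolve_left (hpr v), mul_zero]
    · push Not at hx0
      obtain ⟨r, hr⟩ := hx0
      rw [Finset.prod_eq_zero (Finset.mem_univ r) (by simpa using hr), zero_mul]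
  have hp : (Ideal.span {F}).IsPrime := (Ideal.span_singleton_prime hF.ne_zero).2 hF.prime
  rw [vanishingIdeal_zeroLocus_eq_radical, hp.radical, Ideal.mem_span_singleton] at key
  refine (hF.prime.dvd_or_dvd key).resolve_left fun h => ?_
  obtain ⟨r, -, hr⟩ := (hF.prime.dvd_finsetProd_iff _).1 h
  exact hFX r hr

end MonomialMap

/-! ## Cosets of exponents -/

section Cosets

open MvPolynomial

variable (O : Matrix (Fin 3) (Fin 3) ℕ)

/-- The lattice spanned by the rows of `O`. -/
def rowLattice : Submodule ℤ (Fin 3 → ℤ) :=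
  LinearMap.range (Matrix.vecMulLinear (O.map (Nat.cast : ℕ → ℤ)))

/-- The class of an exponent modulo the row lattice. -/
def cls (e : Fin 3 →₀ ℕ) : (Fin 3 → ℤ) ⧸ rowLattice O := Submodule.Quotient.mk fun s => (e s : ℤ)

variable {O}

theorem cls_add (e f : Fin 3 →₀ ℕ) : cls O (e + f) = cls O e + cls O f := by
  rw [cls, cls, cls, ← Submodule.Quotient.mk_add]
  congr 1

theorem cls_expMap (e : Fin 3 →₀ ℕ) : cls O (expMap O e) = 0 := by
  rw [cls, Submodule.Quotient.mk_eq_zero]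
  refine ⟨fun r => (e r : ℤ), ?_⟩
  funext s
  simp [Matrix.vecMul, dotProduct, expMap]

theorem card_quotient_rowLattice (hO : (O.map (Nat.cast : ℕ → ℤ)).det ≠ 0) :
    Nat.card ((Fin 3 → ℤ) ⧸ rowLattice O) = (O.map (Nat.cast : ℕ → ℤ)).det.natAbs := by
  set M := O.map (Nat.cast : ℕ → ℤ)
  have hinj : Function.Injective (Matrix.vecMulLinear M) := by
    rw [injective_iff_map_eq_zero]
    exact fun x hx => Matrix.eq_zero_of_vecMul_eq_zero hO hx
  rw [← Submodule.natAbs_det_equiv (rowLattice O) (LinearEquiv.ofInjective _ hinj)]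
  rw [← Matrix.det_transpose M, ← LinearMap.det_toLin']
  refine congrArg (fun f : (Fin 3 → ℤ) →ₗ[ℤ] (Fin 3 → ℤ) => (LinearMap.det f).natAbs) ?_
  refine LinearMap.ext fun x => ?_
  rw [Matrix.toLin'_apply, Matrix.mulVec_transpose]
  rfl

/-- The lattice contains `det` times every integral vector, so the non-negative vector `det ^ 2 *
|z|` may be added to make a representative non-negative. -/
theorem exists_cls_eq (hO : (O.map (Nat.cast : ℕ → ℤ)).det ≠ 0)
    (q : (Fin 3 → ℤ) ⧸ rowLattice O) : ∃ v : Fin 3 → ℕ, cls O (expo v) = q := by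
  obtain ⟨z, rfl⟩ := Submodule.Quotient.mk_surjective _ q
  set M := O.map (Nat.cast : ℕ → ℤ) with hM
  let w : Fin 3 → ℤ := fun s => M.det * (M.det * |z s|)
  have hw : w ∈ rowLattice O := by
    refine ⟨Matrix.vecMul (fun s => M.det * |z s|) M.adjugate, ?_⟩
    rw [Matrix.vecMulLinear_apply, ← hM, Matrix.vecMul_vecMul, Matrix.adjugate_mul,
      Matrix.vecMul_smul, Matrix.vecMul_one]
    rfl
  have hnn : ∀ s, 0 ≤ z s + w s := fun s => by
    have h1 : 1 ≤ M.det * M.det := by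
      have := mul_self_pos.2 hO
      omega
    have h2 := neg_abs_le (z s)
    have h3 := abs_nonneg (z s)
    simp only [w]
    nlinarith
  refine ⟨fun s => (z s + w s).toNat, ?_⟩
  rw [cls, Submodule.Quotient.eq]
  convert hw using 1
  funext s
  simp [max_eq_left (hnn s)]

variable {k : Type*} [Field k]

theorem cls_of_coeff_monMap {G : MvPolynomial (Fin 3) k} {s : Fin 3 →₀ ℕ}
    (h : coeff s (monMap k O G) ≠ 0) : cls O s = 0 := by
  classical
  induction G using MvPolynomial.induction_on' with
  | monomial e a =>
    rw [monMap_monomial, coeff_monomial] at h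
    split_ifs at h with h1
    · rw [← h1, cls_expMap]
    · exact absurd rfl h
  | add f g hf hg =>
    rw [map_add, coeff_add] at h
    by_cases h1 : coeff s (monMap k O f) = 0
    · exact hg (by simpa [h1] using h)
    · exact hf h1

theorem coeff_fermat_ne_zero {L : ℕ} {m : Fin 3 →₀ ℕ} (h : coeff m (fermat k L) ≠ 0) :
    ∃ s, m = Finsupp.single s L := by
  classical
  rw [fermat, coeff_sum] at h
  obtain ⟨s, -, hs⟩ := Finset.exists_ne_zero_of_sum_ne_zero h
  refine ⟨s, ?_⟩
  rw [coeff_X_pow] at hs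
  by_contra h'
  rw [if_neg (Ne.symm h')] at hs
  exact hs rfl

/-- A sum of monomial maps with factors from different cosets is divisible by the Fermat polynomial
only if each summand is. -/
theorem fermat_dvd_of_dvd_sum {L : ℕ}
    (hL : ∀ s t, cls O (Finsupp.single s L) = cls O (Finsupp.single t L)) {ι : Type*} [Fintype ι]
    {v : ι → Fin 3 → ℕ} (hv : Function.Injective fun i => cls O (expo (v i)))
    {G : ι → MvPolynomial (Fin 3) k}
    (h : fermat k L ∣ ∑ i, (∏ s, X s ^ v i s) * monMap k O (G i)) (i : ι) :
    fermat k L ∣ (∏ s, X s ^ v i s) * monMap k O (G i) := by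
  classical
  obtain ⟨H, hH⟩ := h
  -- Restriction to the class of summand `i` kills the other summands. The monomials of the Fermat
  -- polynomial lie in one class, so the product with `H` restricts to the Fermat polynomial times a
  -- part of `H`.
  let S : Set (Fin 3 →₀ ℕ) := {e | cls O e = cls O (expo (v i))}
  have h1 := congrArg (filt S) hH
  rw [filt_sum, Finset.sum_eq_single i] at h1
  · rw [filt_eq_self, filt_mul (S' := {e | cls O (Finsupp.single 0 L) + cls O e
      = cls O (expo (v i))})] at h1
    · exact ⟨_, h1⟩
    · intro m hm e
      obtain ⟨s, rfl⟩ := coeff_fermat_ne_zero hm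
      change cls O _ = _ ↔ cls O _ + cls O _ = _
      rw [cls_add, hL s 0]
    · intro e he
      rw [← monomial_expo, coeff_monomial_mul'] at he
      split_ifs at he with h2
      · change cls O e = _
        rw [one_mul] at he
        have h3 := cls_of_coeff_monMap he
        rw [← add_tsub_cancel_of_le h2, cls_add, h3, add_zero]
      · exact absurd rfl he
  · intro j _ hj
    refine filt_eq_zero fun e he he' => hj (hv ?_)
    change cls O e = _ at he'
    rw [← monomial_expo, coeff_monomial_mul'] at he
    split_ifs at he with h2
    · rw [one_mul] at he
      have h3 := cls_of_coeff_monMap he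
      show cls O (expo (v j)) = cls O (expo (v i))
      rw [← he', ← add_tsub_cancel_of_le h2, cls_add, h3, add_zero]
    · exact absurd rfl he
  · simp

end Cosets

/-! ## Dimensions of graded quotients of a plane curve -/

section Curve

open MvPolynomial Module

variable {k : Type*} [Field k]

/-- The reduction modulo `F` as a linear map. -/
def modF (F : MvPolynomial (Fin 3) k) :
    MvPolynomial (Fin 3) k →ₗ[k] MvPolynomial (Fin 3) k ⧸ Ideal.span {F} :=
  (Ideal.Quotient.mkₐ k (Ideal.span {F})).toLinearMap

theorem modF_apply (F G : MvPolynomial (Fin 3) k) :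
    modF F G = Ideal.Quotient.mk (Ideal.span {F}) G := rfl

theorem modF_eq_zero_iff {F G : MvPolynomial (Fin 3) k} : modF F G = 0 ↔ F ∣ G := by
  rw [modF_apply, Ideal.Quotient.eq_zero_iff_mem, Ideal.mem_span_singleton]

/-- The classes of the variables modulo `F`. -/
def varF (F : MvPolynomial (Fin 3) k) (r : Fin 3) : MvPolynomial (Fin 3) k ⧸ Ideal.span {F} :=
  Ideal.Quotient.mk _ (X r)

/-- The part of degree at most `D` of the ideal `(X r ^ n r : r)`. -/
def powersLE (k : Type*) [Field k] (n : Fin 3 → ℕ) (D : ℕ) :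
    Submodule k (MvPolynomial (Fin 3) k) :=
  ⨆ r, (restrictTotalDegree (Fin 3) k (D - n r)).map (LinearMap.mulLeft k (X r ^ n r))

theorem coeff_mul_X_pow_degree {f : MvPolynomial (Fin 3) k} {r : Fin 3} {n : ℕ} {m : Fin 3 →₀ ℕ}
    (h : coeff m (X r ^ n * f) ≠ 0) : ∃ m', coeff m' f ≠ 0 ∧ m.degree = n + m'.degree := by
  classical
  rw [X_pow_eq_monomial, coeff_monomial_mul'] at h
  split_ifs at h with h1
  · rw [one_mul] at h
    refine ⟨_, h, ?_⟩
    conv_lhs => rw [← add_tsub_cancel_of_le h1]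
    rw [map_add, Finsupp.degree_single]
  · exact absurd rfl h

theorem filt_degree_mul {g : MvPolynomial (Fin 3) k} {n D : ℕ} (hg : g.IsHomogeneous n)
    (hn : n ≤ D) (f : MvPolynomial (Fin 3) k) :
    filt {s | s.degree ≤ D} (g * f) = g * filt {s | s.degree ≤ D - n} f :=
  filt_mul f fun m hm e => by
    have := isHomogeneous_iff_degree.1 hg m hm
    simp only [Set.mem_ofPred_eq, map_add]
    omega

theorem filt_degree_mem (f : MvPolynomial (Fin 3) k) (D : ℕ) :
    filt {s | s.degree ≤ D} f ∈ restrictTotalDegree (Fin 3) k D :=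
  mem_restrictTotalDegree_iff.2 fun _ hs => mem_of_coeff_filt_ne_zero hs

/-- As `F` is homogeneous, truncating a multiple of `F` by degree leaves a multiple of `F`. -/
theorem modF_filt_eq {F : MvPolynomial (Fin 3) k} {d : ℕ} (hF : F.IsHomogeneous d)
    {G H : MvPolynomial (Fin 3) k} (h : modF F G = modF F H) (D : ℕ) :
    modF F (filt {s | s.degree ≤ D} G) = modF F (filt {s | s.degree ≤ D} H) := by
  rw [← sub_eq_zero, ← map_sub, modF_eq_zero_iff] at h
  obtain ⟨A, hA⟩ := h
  have h1 : G = H + F * A := by rw [← hA]; ring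
  rw [h1, filt_add, map_add]
  have h2 : filt {s | s.degree ≤ D} (F * A) = F * filt {s | d + s.degree ≤ D} A := by
    refine filt_mul A fun m hm e => ?_
    simp only [Set.mem_ofPred_eq, map_add, isHomogeneous_iff_degree.1 hF m hm]
  rw [h2, (modF_eq_zero_iff (F := F)).2 (Dvd.intro _ rfl), add_zero]

/-- By pigeonhole, a monomial of degree larger than `∑ r, n r` is divisible by some `X r ^ n r`, so
it dies in the quotient. -/
theorem map_map_modF_eq_top (F : MvPolynomial (Fin 3) k) {n : Fin 3 → ℕ} {D : ℕ}
    (hD : ∑ r, n r ≤ D) :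
    ((restrictTotalDegree (Fin 3) k D).map (modF F)).map
      (Ideal.Quotient.mkₐ k (powerIdeal (varF F) n)).toLinearMap = ⊤ := by
  set q := (Ideal.Quotient.mkₐ k (powerIdeal (varF F) n)).toLinearMap
  have hq : ∀ y, q y = 0 ↔ y ∈ powerIdeal (varF F) n := fun y => Ideal.Quotient.eq_zero_iff_mem
  have hmon : ∀ e : Fin 3 →₀ ℕ, D < e.degree → ∀ a : k, q (modF F (monomial e a)) = 0 := by
    intro e he a
    obtain ⟨r, hr⟩ : ∃ r, n r ≤ e r := by
      by_contra! h
      rw [Finsupp.degree_eq_sum] at he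
      have := Finset.sum_le_sum fun r (_ : r ∈ Finset.univ) => (h r).le
      omega
    have h1 : (monomial e a : MvPolynomial (Fin 3) k)
        = monomial (e - Finsupp.single r (n r)) a * X r ^ n r := by
      rw [X_pow_eq_monomial, monomial_mul, mul_one, tsub_add_cancel_of_le]
      exact Finsupp.single_le_iff.2 hr
    rw [hq, modF_apply, h1, map_mul, map_pow]
    exact Ideal.mul_mem_left _ _ (Ideal.subset_span ⟨r, rfl⟩)
  rw [eq_top_iff]
  rintro y -
  obtain ⟨z, rfl⟩ := Ideal.Quotient.mk_surjective y
  obtain ⟨G, rfl⟩ := Ideal.Quotient.mk_surjective z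
  change q (modF F G) ∈ _
  induction G using MvPolynomial.induction_on' with
  | monomial e a =>
    by_cases he : e.degree ≤ D
    · refine ⟨_, ⟨monomial e a, ?_, rfl⟩, rfl⟩
      refine mem_restrictTotalDegree_iff.2 fun s hs => ?_
      classical
      rw [coeff_monomial] at hs
      split_ifs at hs with h
      · rwa [← h]
      · exact absurd rfl hs
    · rw [hmon e (not_le.1 he)]
      exact zero_mem _
  | add f g hf hg =>
    rw [map_add, map_add]
    exact add_mem hf hg

theorem finiteDimensional_quotient {F : MvPolynomial (Fin 3) k} (n : Fin 3 → ℕ) :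
    FiniteDimensional k ((MvPolynomial (Fin 3) k ⧸ Ideal.span {F}) ⧸ powerIdeal (varF F) n) := by
  have h : FiniteDimensional k (⊤ : Submodule k
      ((MvPolynomial (Fin 3) k ⧸ Ideal.span {F}) ⧸ powerIdeal (varF F) n)) := by
    rw [← map_map_modF_eq_top F le_rfl]
    infer_instance
  exact Module.finite_def.2 (Module.Finite.iff_fg.1 h)

/-- The quotient is already spanned in degrees at most `D`. A relation witnessing membership in the
ideal can be truncated at `D`, which identifies the kernel with the image of `powersLE`. -/
theorem finrank_quotient_add {F : MvPolynomial (Fin 3) k} {d : ℕ} (hF : F.IsHomogeneous d)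
    (n : Fin 3 → ℕ) {D : ℕ} (hD : ∑ r, n r ≤ D) :
    finrank k ((MvPolynomial (Fin 3) k ⧸ Ideal.span {F}) ⧸ powerIdeal (varF F) n)
        + finrank k ((powersLE k n D).map (modF F))
      = finrank k ((restrictTotalDegree (Fin 3) k D).map (modF F)) := by
  have hn : ∀ r, n r ≤ D := fun r =>
    (Finset.single_le_sum (f := n) (fun _ _ => Nat.zero_le _) (Finset.mem_univ r)).trans hD
  let q := (Ideal.Quotient.mkₐ k (powerIdeal (varF F) n)).toLinearMap
  have hq : ∀ y, q y = 0 ↔ y ∈ powerIdeal (varF F) n := fun y => Ideal.Quotient.eq_zero_iff_mem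
  have htop : ((restrictTotalDegree (Fin 3) k D).map (modF F)).map q = ⊤ :=
    map_map_modF_eq_top F hD
  have hker : (restrictTotalDegree (Fin 3) k D).map (modF F) ⊓ LinearMap.ker q
      = (powersLE k n D).map (modF F) := by
    apply le_antisymm
    · rintro _ ⟨⟨G, hG, rfl⟩, hy⟩
      obtain ⟨b, hb⟩ := Ideal.mem_span_range_iff_exists_fun.1 ((hq _).1 hy)
      choose B hB using fun r => Ideal.Quotient.mk_surjective (b r)
      have h1 : modF F G = modF F (∑ r, X r ^ n r * B r) := by
        rw [← hb, map_sum]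
        refine Finset.sum_congr rfl fun r _ => ?_
        rw [modF_apply, map_mul, map_pow, hB, mul_comm]
        rfl
      have h2 := modF_filt_eq hF h1 D
      rw [filt_eq_self (S := {s | s.degree ≤ D}) (mem_restrictTotalDegree_iff.1 hG), filt_sum] at h2
      rw [h2]
      refine ⟨_, ?_, rfl⟩
      refine Submodule.sum_mem _ fun r _ => Submodule.mem_iSup_of_mem r ?_
      rw [filt_degree_mul (isHomogeneous_X_pow r (n r)) (hn r)]
      exact ⟨_, filt_degree_mem _ _, rfl⟩
    · refine le_inf (Submodule.map_mono ?_) ?_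
      · refine iSup_le fun r => ?_
        rintro _ ⟨f, hf, rfl⟩
        refine mem_restrictTotalDegree_iff.2 fun s hs => ?_
        obtain ⟨m, hm, h⟩ := coeff_mul_X_pow_degree hs
        have := mem_restrictTotalDegree_iff.1 hf m hm
        have := hn r
        omega
      · rw [powersLE, Submodule.map_iSup]
        refine iSup_le fun r => ?_
        rintro _ ⟨_, ⟨f, hf, rfl⟩, rfl⟩
        rw [LinearMap.mem_ker, hq, LinearMap.mulLeft_apply, modF_apply, map_mul, map_pow]
        exact Ideal.mul_mem_right _ _ (Ideal.subset_span ⟨r, rfl⟩)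
  have h := finrank_map_add_finrank_inf_ker q ((restrictTotalDegree (Fin 3) k D).map (modF F))
  rwa [htop, hker, finrank_top] at h

/-- Multiples of `F` of degree at most `D` come from cofactors of degree at most `D - d`. Only the
leading term `d * D ^ 2 / 2` matters later; the crude linear correction makes the bound trivial for
`D < d`. -/
theorem le_finrank_map_modF {F : MvPolynomial (Fin 3) k} {d : ℕ} (hF : F.IsHomogeneous d)
    (hF0 : F ≠ 0) (D : ℕ) :
    (d : ℝ) * D ^ 2 / 2 - (d : ℝ) ^ 2 * D
      ≤ finrank k ((restrictTotalDegree (Fin 3) k D).map (modF F)) := by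
  by_cases hd : d ≤ D
  · have h1 := finrank_map_add_finrank_inf_ker (modF F) (restrictTotalDegree (Fin 3) k D)
    have h2 : restrictTotalDegree (Fin 3) k D ⊓ LinearMap.ker (modF F)
        ≤ (restrictTotalDegree (Fin 3) k (D - d)).map (LinearMap.mulLeft k F) := by
      rintro G ⟨hG, hG'⟩
      obtain ⟨A, rfl⟩ := modF_eq_zero_iff.1 hG'
      refine ⟨A, (fdeg_iff hd).1 (FDeg.of_mul (wdeg_zero_iff.2 hF) hF0 (e' := d) ?_), rfl⟩
      intro s hs
      have := mem_restrictTotalDegree_iff.1 hG s hs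
      omega
    have h3 := (Submodule.finrank_mono h2).trans (Submodule.finrank_map_le _ _)
    have h4 := finrank_restrictTotalDegree_three (k := k) D
    have h5 := finrank_restrictTotalDegree_three (k := k) (D - d)
    have h6 : (finrank k (restrictTotalDegree (Fin 3) k D) : ℝ)
        ≤ finrank k ((restrictTotalDegree (Fin 3) k D).map (modF F))
          + finrank k (restrictTotalDegree (Fin 3) k (D - d)) := by
      exact_mod_cast (by omega)
    rw [h4, h5, Nat.cast_sub hd] at h6
    have h7 : (d : ℝ) ≤ D := by exact_mod_cast hd
    have h8 : (0 : ℝ) ≤ d := by positivity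
    nlinarith [mul_nonneg h8 (sub_nonneg.2 h7), pow_nonneg h8 3, mul_nonneg h8 (mul_nonneg h8 (h8.trans h7))]
  · have h7 : (D : ℝ) ≤ d := by exact_mod_cast (not_le.1 hd).le
    have h8 : (0 : ℝ) ≤ D := by positivity
    have h9 : (0 : ℝ) ≤ finrank k ((restrictTotalDegree (Fin 3) k D).map (modF F)) := by positivity
    have h10 : (0 : ℝ) ≤ d := by positivity
    nlinarith [mul_nonneg (mul_nonneg h10 h8) (sub_nonneg.2 h7), mul_nonneg (mul_nonneg h10 h8) h10]

end Curve

/-! ## Comparison of a curve with the Fermat curve -/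

section Cover

open MvPolynomial Module

/-- The monomial map given by `O` sends `F` to a monomial multiple of the Fermat polynomial of
degree `L`. -/
structure IsCover {k : Type*} [Field k] (F : MvPolynomial (Fin 3) k) (d L : ℕ)
    (O : Matrix (Fin 3) (Fin 3) ℕ) (κ : Fin 3 → ℕ) : Prop where
  irr : Irreducible F
  hom : F.IsHomogeneous d
  not_dvd : ∀ r, ¬ F ∣ X r
  d_pos : 0 < d
  L_pos : 0 < L
  map_eq : monMap k O F = (∏ s, X s ^ κ s) * fermat k L
  -- In order: degrees are multiplied by `d`; the row lattice has index `d * L`; the Fermat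
  -- polynomial is homogeneous for the grading by cosets; no linear form divides all three products
  -- of linear forms.
  row_sum : ∀ r, ∑ s, O r s = d
  det_eq : (O.map (Nat.cast : ℕ → ℤ)).det = d * L
  cls_eq : ∀ s t, cls O (Finsupp.single s L) = cls O (Finsupp.single t L)
  col_zero : ∀ s, ∃ r, O r s = 0

variable {k : Type*} [Field k] {F : MvPolynomial (Fin 3) k} {d L : ℕ}
  {O : Matrix (Fin 3) (Fin 3) ℕ} {κ : Fin 3 → ℕ} {ι : Type*} [Fintype ι] {v : ι → Fin 3 → ℕ}

theorem monomial_smul_expo (ν : ℕ) (w : Fin 3 → ℕ) :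
    (monomial (L • expo fun s => ν * w s) 1 : MvPolynomial (Fin 3) k)
      = (∏ s, X s ^ w s) ^ (L * ν) := by
  have h : (L • expo fun s => ν * w s) = (L * ν) • expo w := by
    ext s
    simp [mul_assoc]
  rw [← monomial_expo, monomial_pow, one_pow, h]

section

variable [NeZero L]

variable (k L O v) in
/-- The comparison map. -/
def cover : (ι → MvPolynomial (Fin 3) k) →ₗ[k] ((Fin 3 → Fin L) → MvPolynomial (Fin 2) k) :=
  sumMap fun c => (toFree k L).comp
    ((LinearMap.mulLeft k (∏ s, X s ^ v c s)).comp (monMap k O).toLinearMap)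

theorem cover_apply (G : ι → MvPolynomial (Fin 3) k) :
    cover k L O v G = toFree k L (∑ c, (∏ s, X s ^ v c s) * monMap k O (G c)) := by
  rw [cover, sumMap_apply, map_sum]
  rfl

/-- The coset grading reduces divisibility of the sum to that of each summand, and the torus
argument reduces each summand to divisibility by `F`. -/
theorem ker_cover [IsAlgClosed k] (H : IsCover F d L O κ)
    (hv : Function.Injective fun c => cls O (expo (v c))) :
    LinearMap.ker (cover k L O v) = LinearMap.ker ((modF F).compLeft ι) := by
  have hdet : 0 < (O.map (Nat.cast : ℕ → ℤ)).det := by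
    rw [H.det_eq]
    exact mul_pos (by exact_mod_cast H.d_pos) (by exact_mod_cast H.L_pos)
  ext G
  rw [LinearMap.mem_ker, LinearMap.mem_ker, cover_apply, toFree_eq_zero_iff]
  constructor
  · intro h
    funext c
    exact modF_eq_zero_iff.2 (dvd_of_fermat_dvd hdet H.irr H.not_dvd H.map_eq (v c)
      (fermat_dvd_of_dvd_sum H.cls_eq hv h c))
  · intro h
    refine Finset.dvd_sum fun c _ => ?_
    have h1 : F ∣ G c := modF_eq_zero_iff.1 (congrFun h c)
    refine dvd_mul_of_dvd_right (dvd_trans ?_ (_root_.map_dvd (monMap k O) h1)) _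
    rw [H.map_eq]
    exact Dvd.intro_left _ rfl

/-- The dimension of an image depends only on the kernel, so the comparison map may be replaced by
copies of the reduction modulo `F`. -/
theorem finrank_map_cover [IsAlgClosed k] (H : IsCover F d L O κ)
    (hv : Function.Injective fun c => cls O (expo (v c)))
    (Y : Submodule k (MvPolynomial (Fin 3) k)) [FiniteDimensional k Y] :
    finrank k ((Submodule.pi Set.univ fun _ : ι => Y).map (cover k L O v))
      = Fintype.card ι * finrank k (Y.map (modF F)) := by
  rw [finrank_map_eq_of_ker_eq _ _ (ker_cover H hv)]
  have h := iSup_map_compLeft (ι := ι) (fun _ : Unit => modF F) fun _ => Y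
  rw [iSup_unique, iSup_unique] at h
  rw [h, finrank_pi_univ, Finset.sum_const, Finset.card_univ, smul_eq_mul]

/-- Here powers of the variables of the curve turn into products of linear forms in two variables.
-/
theorem cover_mul (r : Fin 3) (ν : ℕ) (G : ι → MvPolynomial (Fin 3) k) :
    cover k L O v (fun c => X r ^ (L * ν) * G c)
      = (∏ s, lin0 k s ^ (ν * O r s)) • cover k L O v G := by
  rw [cover_apply, cover_apply]
  have := toFree_mul (L := L) (k := k) (expo fun s => ν * O r s)
    (∑ c, (∏ s, X s ^ v c s) * monMap k O (G c))
  simp only [expo_apply] at this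
  rw [← this, monomial_smul_expo, Finset.mul_sum]
  congr 1
  refine Finset.sum_congr rfl fun c _ => ?_
  rw [map_mul, map_pow, show monMap k O (X r) = ∏ s, X s ^ O r s by simp [monMap]]
  ring

theorem toFree_mem {G : MvPolynomial (Fin 3) k} {M : ℕ}
    (hG : ∀ e, coeff e G ≠ 0 → e.degree ≤ M) :
    toFree k L G ∈ Submodule.pi Set.univ fun _ : Fin 3 → Fin L =>
      restrictTotalDegree (Fin 2) k (M / L) := by
  rw [G.as_sum, map_sum]
  refine Submodule.sum_mem _ fun e he => ?_
  have h1 := hG e (mem_support_iff.1 he)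
  rw [toFree_monomial]
  refine Submodule.smul_mem _ _ fun ε _ => ?_
  by_cases hε : resid L e = ε
  · subst hε
    rw [Pi.single_eq_same]
    have h2 : (quotMon k L e).IsHomogeneous (∑ s, e s / L) := by
      refine IsHomogeneous.prod _ _ _ fun s _ => ?_
      have h3 : (lin0 k s).IsHomogeneous 1 := by
        fin_cases s
        · exact isHomogeneous_X _ _
        · exact isHomogeneous_X _ _
        · exact ((isHomogeneous_X _ _).add (isHomogeneous_X _ _)).neg
      simpa using h3.pow (e s / L)
    refine mem_restrictTotalDegree_iff.2 fun s hs => ?_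
    rw [isHomogeneous_iff_degree.1 h2 s hs]
    rw [Finsupp.degree_eq_sum] at h1
    refine (Nat.le_div_iff_mul_le (Nat.pos_of_neZero L)).2 (le_trans ?_ h1)
    rw [Finset.sum_mul]
    exact Finset.sum_le_sum fun s _ => Nat.div_mul_le_self _ _
  · rw [Pi.single_eq_of_ne (Ne.symm hε)]
    exact zero_mem _

/-- The monomial map multiplies degrees by `d`, the coset monomials add at most `K`, and `toFree`
divides by `L`. -/
theorem map_cover_le (hrow : ∀ r, ∑ s, O r s = d) {K : ℕ} (hK : ∀ c, ∑ s, v c s ≤ K) (D : ℕ) :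
    (Submodule.pi Set.univ fun _ : ι => restrictTotalDegree (Fin 3) k D).map (cover k L O v)
      ≤ Submodule.pi Set.univ fun _ : Fin 3 → Fin L =>
        restrictTotalDegree (Fin 2) k ((d * D + K) / L) := by
  classical
  rintro _ ⟨G, hG, rfl⟩
  rw [cover_apply, map_sum]
  refine Submodule.sum_mem _ fun c _ => toFree_mem fun e he => ?_
  rw [← monomial_expo, coeff_monomial_mul'] at he
  split_ifs at he with h1
  · rw [one_mul] at he
    obtain ⟨f, hf, hfe⟩ : ∃ f, coeff f (G c) ≠ 0 ∧ expMap O f = e - expo (v c) := by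
      by_contra! h
      rw [(G c).as_sum, map_sum, coeff_sum] at he
      obtain ⟨f, hf, h2⟩ := Finset.exists_ne_zero_of_sum_ne_zero he
      rw [monMap_monomial, coeff_monomial] at h2
      split_ifs at h2 with h3
      · exact h f (mem_support_iff.1 hf) h3
      · exact h2 rfl
    have h4 := mem_restrictTotalDegree_iff.1 (hG c trivial) f hf
    have h5 : e = expo (v c) + expMap O f := by rw [hfe, add_tsub_cancel_of_le h1]
    have h6 : (expMap O f).degree = d * f.degree := by
      rw [Finsupp.degree_eq_sum, Finsupp.degree_eq_sum, Finset.mul_sum]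
      simp only [expMap, expo_apply]
      rw [Finset.sum_comm]
      refine Finset.sum_congr rfl fun r _ => ?_
      rw [← Finset.mul_sum, hrow, mul_comm]
    have h7 : (expo (v c)).degree = ∑ s, v c s := by
      rw [Finsupp.degree_eq_sum]
      rfl
    rw [h5, map_add, h6, h7]
    have := hK c
    have := Nat.mul_le_mul_left d h4
    omega
  · exact absurd rfl he

theorem idealLE_lin0 (ν : Fin 3 → ℕ) (e : Fin 3 → ℕ) (N : ℕ) :
    idealLE (fun r => ∏ s, lin0 k s ^ (ν r * O r s)) e N
      = idealLE (linMon k fun r s => ν r * O r s) e N := by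
  have h : ∀ r, ∏ s, lin0 k s ^ (ν r * O r s) = linMon k (fun r s => ν r * O r s) r
      ∨ ∏ s, lin0 k s ^ (ν r * O r s) = - linMon k (fun r s => ν r * O r s) r := by
    intro r
    have h1 : (∏ s, lin0 k s ^ (ν r * O r s))
        = (-1) ^ (ν r * O r 2) * linMon k (fun r s => ν r * O r s) r := by
      simp only [linMon, Fin.prod_univ_three, lin0, lin, Matrix.cons_val]
      rw [neg_pow]
      ring
    rw [h1]
    rcases neg_one_pow_eq_or (MvPolynomial (Fin 2) k) (ν r * O r 2) with h2 | h2 <;> simp [h2]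
  rw [idealLE, idealLE]
  refine iSup_congr fun r => ?_
  rcases h r with h | h
  · rw [h]
  · rw [h, show LinearMap.mulLeft k (-linMon k (fun r s => ν r * O r s) r)
      = - LinearMap.mulLeft k (linMon k (fun r s => ν r * O r s) r) by ext; simp, Submodule.map_neg]

theorem map_powersLE_cover (ν : Fin 3 → ℕ) (D : ℕ) :
    (Submodule.pi Set.univ fun _ : ι => powersLE k (fun r => L * ν r) D).map (cover k L O v)
      = ⨆ r, ((Submodule.pi Set.univ fun _ : ι => restrictTotalDegree (Fin 3) k
          (D - L * ν r)).map (cover k L O v)).map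
          ((LinearMap.mulLeft k (∏ s, lin0 k s ^ (ν r * O r s))).compLeft (Fin 3 → Fin L)) := by
  unfold powersLE
  rw [← iSup_map_compLeft, Submodule.map_iSup]
  refine iSup_congr fun r => ?_
  rw [← Submodule.map_comp, ← Submodule.map_comp]
  congr 1
  refine LinearMap.ext fun G => ?_
  exact cover_mul r (ν r) G

/-- Dimension comparison with explicit constants. -/
theorem abs_finrank_sub_le [IsAlgClosed k] (H : IsCover F d L O κ)
    (hv : Function.Injective fun c => cls O (expo (v c))) (hcard : Fintype.card ι = d * L)
    {K : ℕ} (hK : ∀ c, ∑ s, v c s ≤ K) {ν : Fin 3 → ℕ} {m m' : ℕ}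
    (hm : HasSyzPair (linMon k fun r s => ν r * O r s) (fun r => d * ν r) m m') {D : ℕ}
    (hD : L * ∑ r, ν r ≤ D) {C : ℝ}
    (hC : C = L * (d * (K + 2 * L) + (K + 2 * L) ^ 2 + d ^ 3)) :
    |(d : ℝ) * L * finrank k
        ((MvPolynomial (Fin 3) k ⧸ Ideal.span {F}) ⧸ powerIdeal (varF F) fun r => L * ν r)
      - (L : ℝ) ^ 3 * (((m : ℝ) ^ 2 + (m' : ℝ) ^ 2 - ∑ r, ((d * ν r : ℕ) : ℝ) ^ 2) / 2)|
      ≤ 3 * (C * (D + 1)) := by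
  have hL := H.L_pos
  have hcol : ∀ s, ∃ r, ν r * O r s = 0 := fun s => by
    obtain ⟨r, hr⟩ := H.col_zero s
    exact ⟨r, by rw [hr, mul_zero]⟩
  set N := (d * D + K) / L with hN
  have hDr : ∀ r, L * ν r ≤ D := fun r => le_trans (Nat.mul_le_mul_left L
    (Finset.single_le_sum (f := ν) (fun _ _ => Nat.zero_le _) (Finset.mem_univ r))) hD
  -- Lowering `D` by `L * ν r` lowers the bound in the target by exactly `d * ν r`: the floor causes
  -- no error.
  have hNr : ∀ r, (d * (D - L * ν r) + K) / L = N - d * ν r := fun r => by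
    rw [hN, ← Nat.sub_mul_div]
    congr 1
    rw [Nat.mul_sub]
    have h1 : d * (L * ν r) ≤ d * D := Nat.mul_le_mul_left d (hDr r)
    have h2 : L * (d * ν r) = d * (L * ν r) := by ring
    omega
  have hNsum : ∑ r, d * ν r ≤ N := by
    rw [hN, Nat.le_div_iff_mul_le hL, ← Finset.mul_sum]
    have h1 := Nat.mul_le_mul_left d hD
    have h2 : d * (∑ r, ν r) * L = d * (L * ∑ r, ν r) := by ring
    omega
  obtain ⟨A, A', hA⟩ := hm
  have hgap := hA.finrank_idealLE (linMon_coprime hcol) (linMon_ne_zero _) hNsum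
  -- `XX E` is the ambient space and `WW E` the image of the curve inside it. Both have dimension `d
  -- ^ 2 * L * E ^ 2 / 2` to leading order, which is why the codimension is linear.
  let XX : ℕ → Submodule k ((Fin 3 → Fin L) → MvPolynomial (Fin 2) k) := fun E =>
    Submodule.pi Set.univ fun _ => restrictTotalDegree (Fin 2) k ((d * E + K) / L)
  let WW : ℕ → Submodule k ((Fin 3 → Fin L) → MvPolynomial (Fin 2) k) := fun E =>
    (Submodule.pi Set.univ fun _ : ι => restrictTotalDegree (Fin 3) k E).map (cover k L O v)
  have hWX : ∀ E, WW E ≤ XX E := fun E => map_cover_le H.row_sum hK E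
  have hXXf : ∀ E, FiniteDimensional k (XX E) := fun E => by
    change FiniteDimensional k (Submodule.pi Set.univ _ : Submodule k _)
    infer_instance
  have hcardV : Fintype.card (Fin 3 → Fin L) = L ^ 3 := by simp
  have hXX : ∀ E, (finrank k (XX E) : ℝ)
      = (L : ℝ) ^ 3 * finrank k (restrictTotalDegree (Fin 2) k ((d * E + K) / L)) := fun E => by
    change (finrank k (Submodule.pi Set.univ _ : Submodule k _) : ℝ) = _
    rw [finrank_pi_univ, Finset.sum_const, Finset.card_univ, hcardV]
    push_cast [smul_eq_mul]
    rfl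
  have hWW : ∀ E, (finrank k (WW E) : ℝ)
      = d * L * finrank k ((restrictTotalDegree (Fin 3) k E).map (modF F)) := fun E => by
    change (finrank k (Submodule.map _ _ : Submodule k _) : ℝ) = _
    rw [finrank_map_cover H hv, hcard]
    push_cast
    rfl
  have hcod : ∀ E ≤ D, (finrank k (XX E) : ℝ) - finrank k (WW E) ≤ C * (D + 1) := by
    intro E hE
    have h1 := le_finrank_map_modF H.hom H.irr.ne_zero E
    have h2 : ((((d * E + K) / L : ℕ) : ℝ)) * L ≤ d * E + K := by
      exact_mod_cast Nat.div_mul_le_self _ _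
    rw [hXX, hWW, finrank_restrictTotalDegree_two]
    set n : ℝ := (((d * E + K) / L : ℕ) : ℝ)
    have hn : 0 ≤ n := by positivity
    have hL1 : (0 : ℝ) < L := by exact_mod_cast hL
    have hd : (0 : ℝ) ≤ d := by positivity
    have hK0 : (0 : ℝ) ≤ K := by positivity
    have hE0 : (0 : ℝ) ≤ E := by positivity
    have hED : (E : ℝ) ≤ D := by exact_mod_cast hE
    have h3 : ((L : ℝ) * (n + 1)) * (L * (n + 2)) ≤ (d * E + (K + 2 * L)) ^ 2 := by
      rw [sq]
      apply mul_le_mul <;> nlinarith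
    have h4 : (L : ℝ) ^ 3 * ((n + 1) * (n + 2) / 2) = L / 2 * (L * (n + 1) * (L * (n + 2))) := by
      ring
    have h5 : (L : ℝ) / 2 * (L * (n + 1) * (L * (n + 2))) ≤ L / 2 * (d * E + (K + 2 * L)) ^ 2 :=
      mul_le_mul_of_nonneg_left h3 (by positivity)
    have h6 : (d : ℝ) * L * (d * E ^ 2 / 2 - d ^ 2 * E)
        ≤ d * L * finrank k ((restrictTotalDegree (Fin 3) k E).map (modF F)) :=
      mul_le_mul_of_nonneg_left h1 (by positivity)
    have h7 : (C : ℝ) * (E + 1) ≤ C * (D + 1) := by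
      refine mul_le_mul_of_nonneg_left (by linarith) ?_
      rw [hC]
      positivity
    rw [h4]
    refine le_trans ?_ h7
    have h8 : (L : ℝ) / 2 * (d * E + (K + 2 * L)) ^ 2 - d * L * (d * E ^ 2 / 2 - d ^ 2 * E)
        = L * (d * (K + 2 * L) + d ^ 3) * E + L * (K + 2 * L) ^ 2 / 2 := by ring
    have h9 : C * (E + 1) = L * (d * (K + 2 * L) + d ^ 3) * E + L * (K + 2 * L) ^ 2 / 2
        + (L * (K + 2 * L) ^ 2 * E + L * (K + 2 * L) ^ 2 / 2
          + L * (d * (K + 2 * L) + d ^ 3)) := by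
      rw [hC]
      ring
    have h10 : (0 : ℝ) ≤ L * (K + 2 * L) ^ 2 * E + L * (K + 2 * L) ^ 2 / 2
          + L * (d * (K + 2 * L) + d ^ 3) := by positivity
    linarith
  let g : Fin 3 → (((Fin 3 → Fin L) → MvPolynomial (Fin 2) k) →ₗ[k]
      ((Fin 3 → Fin L) → MvPolynomial (Fin 2) k)) := fun r =>
    (LinearMap.mulLeft k (∏ s, lin0 k s ^ (ν r * O r s))).compLeft (Fin 3 → Fin L)
  have hx : finrank k (⨆ r, (XX (D - L * ν r)).map (g r) : Submodule k _)
      = L ^ 3 * finrank k (idealLE (linMon k fun r s => ν r * O r s) (fun r => d * ν r) N) := by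
    have h1 : (⨆ r, (XX (D - L * ν r)).map (g r)) = Submodule.pi Set.univ fun _ =>
        idealLE (linMon k fun r s => ν r * O r s) (fun r => d * ν r) N := by
      simp only [XX, g, hNr]
      rw [iSup_map_compLeft, ← idealLE_lin0]
      rfl
    rw [h1]
    have : FiniteDimensional k
        (idealLE (linMon k fun r s => ν r * O r s) (fun r => d * ν r) N) := by
      unfold idealLE
      infer_instance
    rw [finrank_pi_univ, Finset.sum_const, Finset.card_univ, hcardV, smul_eq_mul]
  have hw : finrank k (⨆ r, (WW (D - L * ν r)).map (g r) : Submodule k _)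
      = d * L * finrank k ((powersLE k (fun r => L * ν r) D).map (modF F)) := by
    have : FiniteDimensional k (powersLE k (fun r => L * ν r) D) := by
      unfold powersLE
      infer_instance
    rw [← hcard, ← finrank_map_cover H hv, map_powersLE_cover]
  have h1 := finrank_iSup_map_le_add (fun r => hWX (D - L * ν r)) g
  have : ∀ r, FiniteDimensional k ((XX (D - L * ν r)).map (g r)) := fun r => inferInstance
  have h2 : finrank k (⨆ r, (WW (D - L * ν r)).map (g r) : Submodule k _)
      ≤ finrank k (⨆ r, (XX (D - L * ν r)).map (g r) : Submodule k _) :=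
    Submodule.finrank_mono (iSup_mono fun r => Submodule.map_mono (hWX _))
  rw [hx, hw] at h1 h2
  have h3 := finrank_quotient_add H.hom (fun r => L * ν r) (D := D) (by rwa [← Finset.mul_sum])
  have h4 := hWW D
  have h5 : (finrank k (XX D) : ℝ) = (L : ℝ) ^ 3 * finrank k (restrictTotalDegree (Fin 2) k N) :=
    hXX D
  have h6 := hcod D le_rfl
  have h7 : finrank k (WW D) ≤ finrank k (XX D) := Submodule.finrank_mono (hWX D)
  have h8 := hcod (D - L * ν 0) (Nat.sub_le _ _)
  have h9 := hcod (D - L * ν 1) (Nat.sub_le _ _)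
  have h10 := hcod (D - L * ν 2) (Nat.sub_le _ _)
  simp only [Fin.sum_univ_three] at h1
  rw [← h3, Nat.cast_add, mul_add] at h4
  rw [← hgap, mul_sub, ← h5]
  have h1' : ((L ^ 3 * finrank k (idealLE (linMon k fun r s => ν r * O r s)
      (fun r => d * ν r) N) + (finrank k (WW (D - L * ν 0)) + finrank k (WW (D - L * ν 1))
        + finrank k (WW (D - L * ν 2))) : ℕ) : ℝ)
      ≤ ((d * L * finrank k ((powersLE k (fun r => L * ν r) D).map (modF F))
        + (finrank k (XX (D - L * ν 0)) + finrank k (XX (D - L * ν 1))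
        + finrank k (XX (D - L * ν 2))) : ℕ) : ℝ) := by exact_mod_cast h1
  have h2' : ((d * L * finrank k ((powersLE k (fun r => L * ν r) D).map (modF F)) : ℕ) : ℝ)
      ≤ ((L ^ 3 * finrank k (idealLE (linMon k fun r s => ν r * O r s)
      (fun r => d * ν r) N) : ℕ) : ℝ) := by exact_mod_cast h2
  have h7' : (finrank k (WW D) : ℝ) ≤ finrank k (XX D) := by exact_mod_cast h7
  push_cast at h1' h2'
  -- The difference is `dim WW D - dim XX D`, in `[-C (D + 1), 0]`, plus the difference of the
  -- dimensions of the two ideal parts, in `[0, 3 C (D + 1)]`: one codimension for each generator.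
  rw [abs_le]
  constructor <;> linarith

end

/-- Hilbert-Kunz functions of `F` along multiples of `L` are given, up to a linear error term, by
syzygy gaps of products of linear forms. -/
theorem IsCover.exists_abs_finrank_sub_le [IsAlgClosed k] (H : IsCover F d L O κ) :
    ∃ C : ℝ, 0 ≤ C ∧ ∀ (ν : Fin 3 → ℕ) (m m' : ℕ),
      HasSyzPair (linMon k fun r s => ν r * O r s) (fun r => d * ν r) m m' →
      |(d : ℝ) * L * finrank k
          ((MvPolynomial (Fin 3) k ⧸ Ideal.span {F}) ⧸ powerIdeal (varF F) fun r => L * ν r)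
        - (L : ℝ) ^ 3 / 4 * ((d : ℝ) ^ 2 * quadQ (fun r => (ν r : ℝ≥0))
          + ((m : ℝ) - m') ^ 2)| ≤ C * (∑ r, (ν r : ℝ) + 1) := by
  have : NeZero L := ⟨H.L_pos.ne'⟩
  have hdet : (O.map (Nat.cast : ℕ → ℤ)).det ≠ 0 := by
    rw [H.det_eq]
    exact mul_ne_zero (by exact_mod_cast H.d_pos.ne') (by exact_mod_cast H.L_pos.ne')
  have hcard := card_quotient_rowLattice hdet
  rw [H.det_eq, ← Nat.cast_mul, Int.natAbs_natCast] at hcard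
  have : Finite ((Fin 3 → ℤ) ⧸ rowLattice O) := Nat.finite_of_card_ne_zero
    (hcard ▸ mul_ne_zero H.d_pos.ne' H.L_pos.ne')
  have := Fintype.ofFinite ((Fin 3 → ℤ) ⧸ rowLattice O)
  rw [Nat.card_eq_fintype_card] at hcard
  -- One monomial per coset; the bound `K` on their degrees does not depend on `ν`, so neither does
  -- the final constant.
  choose v hv using exists_cls_eq hdet
  obtain ⟨K, hK⟩ : ∃ K, ∀ c, ∑ s, v c s ≤ K := ⟨∑ c, ∑ s, v c s, fun c =>
    Finset.single_le_sum (f := fun c => ∑ s, v c s) (fun _ _ => Nat.zero_le _) (Finset.mem_univ c)⟩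
  have hinj : Function.Injective fun c => cls O (expo (v c)) := by
    simp only [hv]
    exact fun _ _ h => h
  refine ⟨3 * (L * (d * (K + 2 * L) + (K + 2 * L) ^ 2 + d ^ 3) * L), by positivity,
    fun ν m m' hm => ?_⟩
  refine le_trans (le_of_eq ?_) ((abs_finrank_sub_le H hinj hcard hK hm le_rfl rfl).trans ?_)
  · congr 2
    -- The sum of the degrees is known, so `m ^ 2 + m' ^ 2` can be traded for `(m - m') ^ 2`, using
    -- `2 (m ^ 2 + m' ^ 2) = (m + m') ^ 2 + (m - m') ^ 2`.
    have h1 : (m : ℝ) + m' = ∑ r, (d : ℝ) * ν r := by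
      obtain ⟨A, A', hA⟩ := hm
      exact_mod_cast hA.add_eq
    have h2 : (m' : ℝ) = ∑ r, (d : ℝ) * ν r - m := by linarith
    rw [h2, quadQ]
    simp only [Fin.sum_univ_three]
    push_cast
    ring
  · have hL : (1 : ℝ) ≤ L := by exact_mod_cast H.L_pos
    have h0 : (0 : ℝ) ≤ L * (d * (K + 2 * L) + (K + 2 * L) ^ 2 + d ^ 3) := by positivity
    have h1 : ((L * ∑ r, ν r : ℕ) : ℝ) + 1 ≤ L * (∑ r, (ν r : ℝ) + 1) := by
      push_cast
      nlinarith
    have := mul_le_mul_of_nonneg_left h1 h0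
    linarith

end Cover

/-! ## Removal of common factors -/

section Reduce

open MvPolynomial

variable {k : Type*} [Field k]

theorem HasSyzPair.mul_lin_pow {η η' : Fin 3 → Fin 3 → ℕ} {m m' : ℕ}
    (H : HasSyzPair (linMon k η) (fun r => ∑ s, η r s) m m') (r s : Fin 3) (n : ℕ)
    (hη : ∀ i t, η' i t = η i t + if t = s ∧ i ≠ r then n else 0) :
    HasSyzPair (linMon k η') (fun r => ∑ s, η' r s) (m + n) (m' + n) := by
  have h := H.mul_off (g := lin k s ^ n) (by simpa using (lin_isHomogeneous (k := k) s).pow n) r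
  convert h using 1
  · funext i
    by_cases hi : i = r
    · subst hi
      rw [Function.update_self]
      exact Finset.prod_congr rfl fun t _ => by rw [hη, if_neg (by tauto), add_zero]
    · rw [Function.update_of_ne hi, linMon, linMon, ← Finset.mul_prod_erase _ _ (Finset.mem_univ s),
        ← Finset.mul_prod_erase Finset.univ (fun t => lin k t ^ η i t) (Finset.mem_univ s), hη,
        if_pos ⟨rfl, hi⟩, pow_add]
      rw [Finset.prod_congr rfl fun t ht => by
        rw [hη, if_neg (fun h => Finset.ne_of_mem_erase ht h.1), add_zero]]
      ring
  · funext i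
    simp only [hη, Finset.sum_add_distrib]
    by_cases hi : i = r
    · subst hi
      simp
    · simp [hi]

/-- If one form is constant, the gap depends only on the degrees of the other two, whatever their
factors. Otherwise the forms already are powers of the three lines. -/
theorem exists_hasSyzPair_abs_eq {η : Fin 3 → Fin 3 → ℕ}
    (h : (∃ r, ∀ s, η r s = 0) ∨ ∀ r s, r ≠ s → η r s = 0) :
    ∃ m m', HasSyzPair (linMon k η) (fun r => ∑ s, η r s) m m' ∧
      syzygyGap k (linePowers k fun r => ∑ s, η r s) = |(m : ℤ) - m'| := by
  rcases h with ⟨r, hr⟩ | h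
  · have h0 : ∑ s, η r s = 0 := Finset.sum_eq_zero fun s _ => hr s
    have h1 := hasSyzPair_of_eq_one (fun i => linMon_isHomogeneous (k := k) η i) r
      (Finset.prod_eq_one fun s _ => by rw [hr, pow_zero]) h0
    refine ⟨_, _, h1, HasSyzPair.syzygyGap_linePowers ?_⟩
    refine hasSyzPair_of_eq_one (fun i => ?_) r ?_ h0
    · rw [linePowers_apply]
      simpa using (lin_isHomogeneous (k := k) i).pow (∑ s, η i s)
    · rw [linePowers_apply, h0, pow_zero]
  · obtain ⟨m, m', H⟩ := exists_hasSyzPair_linePowers (k := k) fun r => ∑ s, η r s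
    refine ⟨m, m', ?_, H.syzygyGap_linePowers⟩
    have h1 : η = diagExp fun r => ∑ s, η r s := by
      funext r s
      rw [diagExp]
      split_ifs with hrs
      · subst hrs
        rw [Finset.sum_eq_single r (fun s _ hs => h r s hs.symm) (by simp)]
      · exact h r s hrs
    have h2 : linMon k η = linePowers k fun r => ∑ s, η r s := by
      rw [← linMon_diagExp, ← h1]
    rwa [h2]

/-- The polynomials with exponents `ν r * O r s` have, after removal of common factors, the syzygy
gap of powers of the three linear forms with exponents `g ν`. -/
def HasReduction (k : Type*) [Field k] (d : ℕ) (O : Matrix (Fin 3) (Fin 3) ℕ)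
    (g : (Fin 3 → ℝ≥0) → Fin 3 → ℝ≥0) : Prop :=
  ∀ ν : Fin 3 → ℕ, ∃ (m m' : ℕ) (u : Fin 3 → ℕ),
    HasSyzPair (linMon k fun r s => ν r * O r s) (fun r => d * ν r) m m' ∧
    syzygyGap k (linePowers k u) = |(m : ℤ) - m'| ∧
    g (fun r => (ν r : ℝ≥0)) = fun r => (u r : ℝ≥0)

/-- In column `s` the row `z s` is left alone and the other two rows share `n s` copies of `lin k
s`; removing these shifts both degrees of the pair by the same amount. -/
theorem hasReduction_of {d : ℕ} {O : Matrix (Fin 3) (Fin 3) ℕ}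
    {g : (Fin 3 → ℝ≥0) → Fin 3 → ℝ≥0} (hrow : ∀ r, ∑ s, O r s = d) (z : Fin 3 → Fin 3)
    (h : ∀ ν : Fin 3 → ℕ, ∃ (η : Fin 3 → Fin 3 → ℕ) (n : Fin 3 → ℕ),
      (∀ r s, ν r * O r s = η r s + if r ≠ z s then n s else 0) ∧
      ((∃ r, ∀ s, η r s = 0) ∨ ∀ r s, r ≠ s → η r s = 0) ∧
      g (fun r => (ν r : ℝ≥0)) = fun r => ((∑ s, η r s : ℕ) : ℝ≥0)) : HasReduction k d O g := by
  intro ν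
  obtain ⟨η, n, h1, h2, h3⟩ := h ν
  obtain ⟨m, m', H, hgap⟩ := exists_hasSyzPair_abs_eq (k := k) h2
  refine ⟨m + n 0 + n 1 + n 2, m' + n 0 + n 1 + n 2, _, ?_, ?_, h3⟩
  · have h4 := ((H.mul_lin_pow (z 0) 0 (n 0) fun i t => rfl).mul_lin_pow (z 1) 1 (n 1)
      fun i t => rfl).mul_lin_pow (η' := fun r s => ν r * O r s) (z 2) 2 (n 2) fun i t => by
        rw [h1]
        fin_cases t <;> simp
    convert h4 using 2 with r
    rw [← Finset.mul_sum, hrow, mul_comm]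
  · rw [hgap]
    congr 1
    push_cast
    ring

end Reduce

/-! ## Trinomials and monomial maps -/

section Tri

open MvPolynomial

variable {k : Type*} [Field k] {a b c : Fin 3 → ℕ}

theorem expo_injective : Function.Injective expo := Finsupp.equivFunOnFinite.symm.injective

theorem trinomial_eq (a b c : Fin 3 → ℕ) : trinomial k a b c
    = monomial (expo a) 1 + monomial (expo b) 1 + monomial (expo c) 1 := by
  rw [trinomial, monomial_expo, monomial_expo, monomial_expo]

theorem coeff_trinomial_fst (hab : a ≠ b) (hac : a ≠ c) :
    coeff (expo a) (trinomial k a b c) = 1 := by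
  classical
  rw [trinomial_eq, coeff_add, coeff_add, coeff_monomial, coeff_monomial, coeff_monomial,
    if_pos rfl, if_neg (fun h => hab (expo_injective h.symm)),
    if_neg (fun h => hac (expo_injective h.symm))]
  simp

theorem coeff_trinomial_snd (hab : a ≠ b) (hbc : b ≠ c) :
    coeff (expo b) (trinomial k a b c) = 1 := by
  have : trinomial k a b c = trinomial k b a c := by
    rw [trinomial, trinomial]
    ring
  rw [this, coeff_trinomial_fst hab.symm hbc]

theorem coeff_trinomial_thd (hac : a ≠ c) (hbc : b ≠ c) :
    coeff (expo c) (trinomial k a b c) = 1 := by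
  have : trinomial k a b c = trinomial k c a b := by
    rw [trinomial, trinomial]
    ring
  rw [this, coeff_trinomial_fst hac.symm hbc.symm]

theorem sum_eq_of_trinomial {d : ℕ} (hab : a ≠ b) (hac : a ≠ c) (hbc : b ≠ c)
    (hhom : (trinomial k a b c).IsHomogeneous d) :
    ∑ i, a i = d ∧ ∑ i, b i = d ∧ ∑ i, c i = d := by
  rw [isHomogeneous_iff_degree] at hhom
  have h : ∀ v : Fin 3 → ℕ, (expo v).degree = ∑ i, v i := fun v => by
    rw [Finsupp.degree_eq_sum]
    rfl
  refine ⟨?_, ?_, ?_⟩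
  · rw [← h]
    exact hhom _ (by rw [coeff_trinomial_fst hab hac]; exact one_ne_zero)
  · rw [← h]
    exact hhom _ (by rw [coeff_trinomial_snd hab hbc]; exact one_ne_zero)
  · rw [← h]
    exact hhom _ (by rw [coeff_trinomial_thd hac hbc]; exact one_ne_zero)

theorem trinomial_not_dvd_X (hab : a ≠ b) (hac : a ≠ c) (hbc : b ≠ c)
    (hirr : Irreducible (trinomial k a b c)) (r : Fin 3) : ¬ trinomial k a b c ∣ X r := by
  classical
  rintro ⟨g, hg⟩
  have hX : Irreducible (X r : MvPolynomial (Fin 3) k) := X_prime.irreducible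
  have hu : IsUnit g := (hX.isUnit_or_isUnit hg).resolve_left hirr.not_isUnit
  obtain ⟨u, hu', rfl⟩ := MvPolynomial.isUnit_iff_eq_C_of_isReduced.1 hu
  rw [mul_comm] at hg
  have h1 := congrArg (coeff (expo a)) hg
  have h2 := congrArg (coeff (expo b)) hg
  rw [coeff_C_mul, coeff_trinomial_fst hab hac, mul_one, coeff_X] at h1
  rw [coeff_C_mul, coeff_trinomial_snd hab hbc, mul_one, coeff_X] at h2
  split_ifs at h1 with h3
  · split_ifs at h2 with h4
    · exact hab (expo_injective (h3.symm.trans h4))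
    · exact hu'.ne_zero h2.symm
  · exact hu'.ne_zero h1.symm

theorem isCover_trinomial {d L : ℕ} {O : Matrix (Fin 3) (Fin 3) ℕ} {κ : Fin 3 → ℕ}
    (hab : a ≠ b) (hac : a ≠ c) (hbc : b ≠ c) (hirr : Irreducible (trinomial k a b c))
    (hhom : (trinomial k a b c).IsHomogeneous d) (hd : 0 < d) (hL : 0 < L)
    (ha : ∀ s, ∑ r, a r * O r s = κ s + if 0 = s then L else 0)
    (hb : ∀ s, ∑ r, b r * O r s = κ s + if 1 = s then L else 0)
    (hc : ∀ s, ∑ r, c r * O r s = κ s + if 2 = s then L else 0)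
    (hrow : ∀ r, ∑ s, O r s = d) (hdet : (O.map (Nat.cast : ℕ → ℤ)).det = d * L)
    (hcol : ∀ s, ∃ r, O r s = 0) : IsCover (trinomial k a b c) d L O κ := by
  have h : ∀ (v : Fin 3 → ℕ) (i : Fin 3),
      (∀ s, ∑ r, v r * O r s = κ s + if i = s then L else 0) →
      expMap O (expo v) = expo κ + Finsupp.single i L := fun v i hv => by
    classical
    ext s
    simp [expMap, hv, Finsupp.single_apply]
  have hcls : ∀ i, cls O (expo κ) + cls O (Finsupp.single i L) = 0 := fun i => by
    rw [← cls_add]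
    fin_cases i
    · exact (h a 0 ha) ▸ cls_expMap _
    · exact (h b 1 hb) ▸ cls_expMap _
    · exact (h c 2 hc) ▸ cls_expMap _
  refine ⟨hirr, hhom, trinomial_not_dvd_X hab hac hbc hirr, hd, hL, ?_, hrow, hdet,
    fun s t => add_left_cancel ((hcls s).trans (hcls t).symm), hcol⟩
  rw [trinomial_eq, map_add, map_add, monMap_monomial, monMap_monomial, monMap_monomial,
    h a 0 ha, h b 1 hb, h c 2 hc, ← monomial_expo, fermat, Fin.sum_univ_three]
  simp only [X_pow_eq_monomial, mul_add, monomial_mul, mul_one]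

end Tri

/-! ## The two normal forms -/

section Types

open MvPolynomial

theorem toNNReal_natCast_sub (m n : ℕ) : ((m : ℝ) - n).toNNReal = ((m - n : ℕ) : ℝ≥0) := by
  rcases le_total n m with h | h
  · rw [← Nat.cast_sub h, Real.toNNReal_natCast]
  · rw [Nat.sub_eq_zero_of_le h, Nat.cast_zero, Real.toNNReal_eq_zero, sub_nonpos]
    exact_mod_cast h

theorem toNNReal_neg_natCast_sub (m n : ℕ) : (-((m : ℝ) - n)).toNNReal = ((n - m : ℕ) : ℝ≥0) := by
  rw [neg_sub, toNNReal_natCast_sub]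

theorem lt_of_mul_lt_mul_of_le {x y b c : ℕ} (h : x * b < y * c) (hbc : c ≤ b) : x < y := by
  by_contra! h'
  exact absurd (Nat.mul_le_mul h' hbc) (not_le.2 h)

variable {d : ℕ} {a b c : Fin 3 → ℕ}

theorem lam_of_expDet_eq {E : ℕ} (hd : 0 < d) (h : expDet a b c = d * E) : lam d a b c = E := by
  rw [lam, h, Int.mul_ediv_cancel_left _ (by exact_mod_cast hd.ne'), Int.toNat_natCast]

variable (a b c) in
/-- The exponents of the monomial map for the first normal form. -/
def coverI : Matrix (Fin 3) (Fin 3) ℕ := !![b 1, 0, b 2; c 0, c 2, 0; 0, a 1, a 0]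

variable (d b c) in
/-- The exponents of the monomial map for the second normal form. -/
def coverII : Matrix (Fin 3) (Fin 3) ℕ :=
  !![d - c 1 - b 2, c 1, b 2; 0, d, 0; b 0, 0, d - b 0]

/-- Positivity holds because `a 0` exceeds `d / 2` and `c 0` does not. The last three equations are
the diagonal entries of the product of the exponent matrix, with rows `a`, `b`, `c`, and `coverI`.
-/
theorem exists_lam_typeI (hI : IsTypeI d a b c) (ha : ∑ i, a i = d) (hb : ∑ i, b i = d)
    (hc : ∑ i, c i = d) : ∃ L : ℕ, 0 < L ∧ expDet a b c = d * L ∧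
      L + b 1 * c 0 = a 0 * b 1 + a 1 * c 0 ∧ L + a 1 * c 2 = b 1 * c 2 + b 2 * a 1 ∧
      L + a 0 * b 2 = c 0 * b 2 + c 2 * a 0 := by
  obtain ⟨h1, h2, h3, h4, h5, h6⟩ := hI
  simp only [Fin.sum_univ_three, h2, h3, h5, add_zero, zero_add] at ha hb hc
  have hlt : b 1 * c 0 < a 0 * b 1 + a 1 * c 0 := by nlinarith
  refine ⟨a 0 * b 1 + a 1 * c 0 - b 1 * c 0, by omega, ?_, by omega, ?_, ?_⟩
  · rw [expDet, Matrix.det_fin_three]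
    simp only [Matrix.of_apply, Matrix.cons_val, h2, h3, h5]
    push_cast [Nat.cast_sub hlt.le]
    have ha' : (a 1 : ℤ) = d - a 0 := by rw [← ha]; push_cast; ring
    have hb' : (b 2 : ℤ) = d - b 1 := by rw [← hb]; push_cast; ring
    have hc' : (c 0 : ℤ) = d - c 2 := by rw [← hc]; push_cast; ring
    rw [ha', hb', hc']
    ring
  · zify [hlt.le]
    have ha' : (a 1 : ℤ) = d - a 0 := by rw [← ha]; push_cast; ring
    have hb' : (b 2 : ℤ) = d - b 1 := by rw [← hb]; push_cast; ring
    have hc' : (c 0 : ℤ) = d - c 2 := by rw [← hc]; push_cast; ring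
    rw [ha', hb', hc']
    ring
  · zify [hlt.le]
    have ha' : (a 1 : ℤ) = d - a 0 := by rw [← ha]; push_cast; ring
    have hb' : (b 2 : ℤ) = d - b 1 := by rw [← hb]; push_cast; ring
    have hc' : (c 0 : ℤ) = d - c 2 := by rw [← hc]; push_cast; ring
    rw [ha', hb', hc']
    ring

theorem exists_lam_typeII (hII : IsTypeII d a b c) (hb : ∑ i, b i = d)
    (hc : ∑ i, c i = d) : ∃ L : ℕ, 0 < L ∧ expDet a b c = d * L ∧ L + b 2 * c 1 = b 1 * c 2 := by
  obtain ⟨h1, h2, h3, h4, h5, h6⟩ := hII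
  simp only [Fin.sum_univ_three, h5, zero_add] at hb hc
  have hlt : b 2 * c 1 < b 1 * c 2 := by nlinarith
  refine ⟨b 1 * c 2 - b 2 * c 1, by omega, ?_, by omega⟩
  rw [expDet, Matrix.det_fin_three]
  simp only [Matrix.of_apply, Matrix.cons_val, h1, h2, h3, h5]
  push_cast [Nat.cast_sub hlt.le]
  ring

theorem pos_of_typeI (hI : IsTypeI d a b c) (ha : ∑ i, a i = d) : 0 < d := by
  have := hI.1
  rw [Fin.sum_univ_three] at ha
  omega

theorem pos_of_typeII (hII : IsTypeII d a b c) (hb : ∑ i, b i = d) : 0 < d := by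
  have := hII.2.2.2.1
  rw [Fin.sum_univ_three] at hb
  omega

variable {k : Type*} [Field k]

/-- Let `E` have rows `a`, `b`, `c`. Its row sums are `d`, so adding the same vector `κ` to each row
of the adjugate of `E` and dividing by `d` gives a matrix `O` such that `E * O` is `L` times the
identity plus `κ` in every row. The chosen `κ` makes `O` integral and non-negative with a zero in
each column. -/
theorem isCover_typeI (hI : IsTypeI d a b c) (hab : a ≠ b) (hac : a ≠ c) (hbc : b ≠ c)
    (hirr : Irreducible (trinomial k a b c)) (hhom : (trinomial k a b c).IsHomogeneous d) :
    IsCover (trinomial k a b c) d (lam d a b c) (coverI a b c)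
      ![b 1 * c 0, a 1 * c 2, a 0 * b 2] := by
  obtain ⟨ha, hb, hc⟩ := sum_eq_of_trinomial hab hac hbc hhom
  have hd := pos_of_typeI hI ha
  obtain ⟨L, hL, hdet, e0, e1, e2⟩ := exists_lam_typeI hI ha hb hc
  rw [lam_of_expDet_eq hd hdet]
  obtain ⟨h1, h2, h3, h4, h5, h6⟩ := hI
  rw [expDet, Matrix.det_fin_three] at hdet
  simp only [Fin.sum_univ_three, h2, h3, h5, add_zero, zero_add] at ha hb hc
  refine isCover_trinomial hab hac hbc hirr hhom hd hL ?_ ?_ ?_ ?_ ?_ ?_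
  · intro s
    fin_cases s <;> simp [Fin.sum_univ_three, coverI, h2]
    linarith
  · intro s
    fin_cases s <;> simp [Fin.sum_univ_three, coverI, h3] <;> linarith
  · intro s
    fin_cases s <;> simp [Fin.sum_univ_three, coverI, h5]
    all_goals linarith
  · intro r
    fin_cases r <;> simp [Fin.sum_univ_three, coverI] <;> omega
  · rw [← hdet, Matrix.det_fin_three]
    simp [coverI, h2, h3, h5]
    ring
  · intro s
    fin_cases s
    · exact ⟨2, by simp [coverI]⟩
    · exact ⟨0, by simp [coverI]⟩
    · exact ⟨1, by simp [coverI]⟩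

theorem isCover_typeII (hII : IsTypeII d a b c) (hab : a ≠ b) (hac : a ≠ c) (hbc : b ≠ c)
    (hirr : Irreducible (trinomial k a b c)) (hhom : (trinomial k a b c).IsHomogeneous d) :
    IsCover (trinomial k a b c) d (lam d a b c) (coverII d b c)
      ![b 0 * c 2, d * c 1, d * b 2] := by
  obtain ⟨-, hb, hc⟩ := sum_eq_of_trinomial hab hac hbc hhom
  have hd := pos_of_typeII hII hb
  obtain ⟨L, hL, hdet, e0⟩ := exists_lam_typeII hII hb hc
  rw [lam_of_expDet_eq hd hdet]
  obtain ⟨h1, h2, h3, h4, h5, h6⟩ := hII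
  simp only [Fin.sum_univ_three, h5, zero_add] at hb hc
  obtain ⟨x, hx⟩ : ∃ x, d = x + c 1 + b 2 := ⟨d - c 1 - b 2, by omega⟩
  have hx' : d - c 1 - b 2 = x := by omega
  have hy : d - b 0 = b 1 + b 2 := by omega
  have hc2 : c 2 = x + b 2 := by omega
  have hb1 : b 1 + b 0 = x + c 1 := by omega
  have e1 : d * x = b 0 * c 2 + L := by
    zify at hx e0 hb1 hc2 ⊢
    linear_combination (x : ℤ) * hx - e0 - c 2 * hb1 - (x + c 1) * hc2
  have e2 : b 0 * x + b 2 * b 0 = b 0 * c 2 := by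
    rw [hc2]
    ring
  have e3 : b 0 * c 1 + b 1 * d = d * c 1 + L := by
    zify at hb hc e0 ⊢
    linear_combination (c 1 : ℤ) * hb - b 1 * hc - e0
  have e4 : b 0 * b 2 + b 2 * (b 1 + b 2) = d * b 2 := by
    rw [← hb]
    ring
  have e5 : c 2 * (b 1 + b 2) = d * b 2 + L := by
    zify at hc e0 ⊢
    linear_combination (b 2 : ℤ) * hc - e0
  refine isCover_trinomial hab hac hbc hirr hhom hd hL ?_ ?_ ?_ ?_ ?_ ?_
  · intro s
    fin_cases s <;> simp [Fin.sum_univ_three, coverII, h1, h2, h3, hx']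
    exact e1
  · intro s
    fin_cases s <;> simp [Fin.sum_univ_three, coverII, hx', hy]
    exacts [e2, e3, e4]
  · intro s
    fin_cases s <;> simp [Fin.sum_univ_three, coverII, h5, hx', hy]
    exacts [mul_comm _ _, mul_comm _ _, e5]
  · intro r
    fin_cases r <;> simp [Fin.sum_univ_three, coverII] <;> omega
  · rw [Matrix.det_fin_three]
    simp [coverII, hx', hy]
    zify at *
    have : (L : ℤ) = b 1 * c 2 - b 2 * c 1 := by linarith
    rw [this, hc2]
    linear_combination (-(d : ℤ) * b 2) * hb1
  · intro s
    fin_cases s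
    · exact ⟨1, by simp [coverII]⟩
    · exact ⟨2, by simp [coverII]⟩
    · exact ⟨1, by simp [coverII]⟩

/-- Each column has two entries, and `α'`, `β'`, `γ'` are their differences. Removing the column
minima leaves positive and negative parts, whose row sums are `α`, `β`, `γ`. -/
theorem hasReduction_typeI (hI : IsTypeI d a b c) (ha : ∑ i, a i = d) (hb : ∑ i, b i = d)
    (hc : ∑ i, c i = d) : HasReduction k d (coverI a b c) (abgI d a b c) := by
  obtain ⟨h1, h2, h3, h4, h5, h6⟩ := hI
  simp only [Fin.sum_univ_three, h2, h3, h5, add_zero, zero_add] at ha hb hc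
  refine hasReduction_of (fun r => ?_) ![2, 0, 1] fun ν => ?_
  · fin_cases r <;> simp [Fin.sum_univ_three, coverI] <;> omega
  have hα : alpha' d b c (fun r => (ν r : ℝ≥0)) = ((ν 0 * b 1 : ℕ) : ℝ) - (ν 1 * c 0 : ℕ) := by
    simp only [alpha', h3, h5, ← hb]
    push_cast
    ring
  have hβ : beta' d a c (fun r => (ν r : ℝ≥0)) = ((ν 1 * c 2 : ℕ) : ℝ) - (ν 2 * a 1 : ℕ) := by
    simp only [beta', h2, h5, ← hc]
    push_cast
    ring
  have hγ : gamma' d a b (fun r => (ν r : ℝ≥0)) = ((ν 2 * a 0 : ℕ) : ℝ) - (ν 0 * b 2 : ℕ) := by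
    simp only [gamma', h2, h3, ← ha]
    push_cast
    ring
  -- A negative difference forces a strict inequality between two of the `ν r`, since dominant
  -- exponents exceed the others.
  have k0 : ν 0 * b 1 < ν 1 * c 0 → ν 0 < ν 1 := fun h => lt_of_mul_lt_mul_of_le h (by omega)
  have k1 : ν 1 * c 2 < ν 2 * a 1 → ν 1 < ν 2 := fun h => lt_of_mul_lt_mul_of_le h (by omega)
  have k2 : ν 2 * a 0 < ν 0 * b 2 → ν 2 < ν 0 := fun h => lt_of_mul_lt_mul_of_le h (by omega)
  have hg : abgI d a b c (fun r => (ν r : ℝ≥0)) = ![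
      ((ν 0 * b 1 - ν 1 * c 0 : ℕ) : ℝ≥0) + (ν 0 * b 2 - ν 2 * a 0 : ℕ),
      ((ν 1 * c 2 - ν 2 * a 1 : ℕ) : ℝ≥0) + (ν 1 * c 0 - ν 0 * b 1 : ℕ),
      ((ν 2 * a 0 - ν 0 * b 2 : ℕ) : ℝ≥0) + (ν 2 * a 1 - ν 1 * c 2 : ℕ)] := by
    rw [abgI, hα, hβ, hγ]
    simp only [toNNReal_natCast_sub, toNNReal_neg_natCast_sub]
  rw [hg]
  refine ⟨![![ν 0 * b 1 - ν 1 * c 0, 0, ν 0 * b 2 - ν 2 * a 0],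
    ![ν 1 * c 0 - ν 0 * b 1, ν 1 * c 2 - ν 2 * a 1, 0],
    ![0, ν 2 * a 1 - ν 1 * c 2, ν 2 * a 0 - ν 0 * b 2]],
    ![min (ν 0 * b 1) (ν 1 * c 0), min (ν 1 * c 2) (ν 2 * a 1), min (ν 2 * a 0) (ν 0 * b 2)],
    ?_, ?_, ?_⟩
  · intro r s
    fin_cases r <;> fin_cases s <;> simp [coverI] <;> omega
  · generalize ν 0 * b 1 = x0 at *
    generalize ν 1 * c 0 = y0 at *
    generalize ν 1 * c 2 = x1 at *
    generalize ν 2 * a 1 = y1 at *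
    generalize ν 2 * a 0 = x2 at *
    generalize ν 0 * b 2 = y2 at *
    -- Three negative differences would give `ν 0 < ν 1 < ν 2 < ν 0`. So if some difference is
    -- negative, one of them has a non-negative cyclic predecessor, and the corresponding row
    -- vanishes.
    have : (y0 ≤ x0 ∧ y1 ≤ x1 ∧ y2 ≤ x2) ∨ (x0 ≤ y0 ∧ y2 ≤ x2) ∨ (x1 ≤ y1 ∧ y0 ≤ x0) ∨
      (x2 ≤ y2 ∧ y1 ≤ x1) := by omega
    rcases this with h | h | h | h
    · right
      intro r s hrs
      fin_cases r <;> fin_cases s <;> simp at hrs ⊢ <;> omega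
    · refine Or.inl ⟨0, fun s => ?_⟩
      fin_cases s <;> simp <;> omega
    · refine Or.inl ⟨1, fun s => ?_⟩
      fin_cases s <;> simp <;> omega
    · refine Or.inl ⟨2, fun s => ?_⟩
      fin_cases s <;> simp <;> omega
  · funext r
    fin_cases r <;> simp [Fin.sum_univ_three, add_comm]

/-- Again the column minima are removed. A negative `β'` empties the middle row; `α'` and `γ'`
cannot both be negative, because that would give `ν 0 < ν 2 < ν 0`. -/
theorem hasReduction_typeII (hII : IsTypeII d a b c) (hb : ∑ i, b i = d)
    (hc : ∑ i, c i = d) : HasReduction k d (coverII d b c) (abgII d a b c) := by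
  obtain ⟨h1, h2, h3, h4, h5, h6⟩ := hII
  simp only [Fin.sum_univ_three, h5, zero_add] at hb hc
  obtain ⟨x, hx⟩ : ∃ x, d = x + c 1 + b 2 := ⟨d - c 1 - b 2, by omega⟩
  have hx' : d - c 1 - b 2 = x := by omega
  have hy : d - b 0 = b 1 + b 2 := by omega
  refine hasReduction_of (fun r => ?_) ![1, 2, 1] fun ν => ?_
  · fin_cases r <;> simp [Fin.sum_univ_three, coverII] <;> omega
  have hα : alpha' d b c (fun r => (ν r : ℝ≥0)) = ((ν 0 * x : ℕ) : ℝ) - (ν 2 * b 0 : ℕ) := by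
    simp only [alpha', h5, hx]
    push_cast
    ring
  have hβ : beta' d a c (fun r => (ν r : ℝ≥0)) = ((ν 1 * d : ℕ) : ℝ) - (ν 0 * c 1 : ℕ) := by
    simp only [beta', h2, h3, h5]
    push_cast
    ring
  have hγ : gamma' d a b (fun r => (ν r : ℝ≥0))
      = ((ν 2 * (b 1 + b 2) : ℕ) : ℝ) - (ν 0 * b 2 : ℕ) := by
    simp only [gamma', h2, h3, ← hb]
    push_cast
    ring
  have k2 : ν 2 * (b 1 + b 2) < ν 0 * b 2 → ν 2 < ν 0 :=
    fun h => lt_of_mul_lt_mul_of_le h (by omega)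
  have k0 : ν 0 * x < ν 2 * b 0 → ν 0 < ν 2 := fun h => lt_of_mul_lt_mul_of_le h (by omega)
  have hg : abgII d a b c (fun r => (ν r : ℝ≥0)) = ![
      ((ν 0 * x - ν 2 * b 0 : ℕ) : ℝ≥0) + (ν 0 * c 1 - ν 1 * d : ℕ)
        + (ν 0 * b 2 - ν 2 * (b 1 + b 2) : ℕ),
      ((ν 1 * d - ν 0 * c 1 : ℕ) : ℝ≥0),
      ((ν 2 * (b 1 + b 2) - ν 0 * b 2 : ℕ) : ℝ≥0) + (ν 2 * b 0 - ν 0 * x : ℕ)] := by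
    rw [abgII, hα, hβ, hγ]
    simp only [toNNReal_natCast_sub, toNNReal_neg_natCast_sub]
  rw [hg]
  refine ⟨![![ν 0 * x - ν 2 * b 0, ν 0 * c 1 - ν 1 * d, ν 0 * b 2 - ν 2 * (b 1 + b 2)],
    ![0, ν 1 * d - ν 0 * c 1, 0],
    ![ν 2 * b 0 - ν 0 * x, 0, ν 2 * (b 1 + b 2) - ν 0 * b 2]],
    ![min (ν 0 * x) (ν 2 * b 0), min (ν 1 * d) (ν 0 * c 1), min (ν 2 * (b 1 + b 2)) (ν 0 * b 2)],
    ?_, ?_, ?_⟩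
  · intro r s
    fin_cases r <;> fin_cases s <;> simp [coverII, hx', hy] <;> omega
  · generalize ν 0 * x = x0 at *
    generalize ν 2 * b 0 = y0 at *
    generalize ν 1 * d = x1 at *
    generalize ν 0 * c 1 = y1 at *
    generalize ν 2 * (b 1 + b 2) = x2 at *
    generalize ν 0 * b 2 = y2 at *
    have : (y0 ≤ x0 ∧ y1 ≤ x1 ∧ y2 ≤ x2) ∨ (x0 ≤ y0 ∧ y1 ≤ x1 ∧ y2 ≤ x2) ∨ x1 ≤ y1 ∨
      (x2 ≤ y2 ∧ y0 ≤ x0) := by omega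
    rcases this with h | h | h | h
    · right
      intro r s hrs
      fin_cases r <;> fin_cases s <;> simp at hrs ⊢ <;> omega
    · refine Or.inl ⟨0, fun s => ?_⟩
      fin_cases s <;> simp <;> omega
    · refine Or.inl ⟨1, fun s => ?_⟩
      fin_cases s <;> simp
      omega
    · refine Or.inl ⟨2, fun s => ?_⟩
      fin_cases s <;> simp <;> omega
  · funext r
    fin_cases r <;> simp [Fin.sum_univ_three, add_comm]

end Types

/-! ## Dimension of the coordinate ring -/

section KrullDim

open MvPolynomial

variable {k : Type*} [Field k]

variable (k) in
/-- Setting the first `j` variables to zero. -/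
def killVars (j : ℕ) : MvPolynomial (Fin 3) k →ₐ[k] MvPolynomial (Fin 3) k :=
  aeval fun i : Fin 3 => if (i : ℕ) < j then 0 else X i

theorem ker_killVars_lt {j : ℕ} (hj : j < 3) :
    RingHom.ker (killVars k j) < RingHom.ker (killVars k (j + 1)) := by
  have h1 : (killVars k (j + 1)).comp (killVars k j) = killVars k (j + 1) := by
    refine algHom_ext fun i => ?_
    simp only [killVars, AlgHom.comp_apply, aeval_X]
    split_ifs with h2 h3 h3
    · rw [map_zero]
    · omega
    · rw [aeval_X, if_pos h3]
    · rw [aeval_X, if_neg h3]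
  refine lt_of_le_of_ne (fun f hf => ?_) fun h => ?_
  · rw [RingHom.mem_ker] at hf ⊢
    rw [← h1, AlgHom.comp_apply, hf, map_zero]
  · have h2 : (X ⟨j, hj⟩ : MvPolynomial (Fin 3) k) ∈ RingHom.ker (killVars k (j + 1)) := by
      simp [RingHom.mem_ker, killVars]
    rw [← h, RingHom.mem_ker] at h2
    simp [killVars] at h2

/-- The kernels of `killVars` form a chain of primes showing that the irrelevant ideal has full
height; dividing by a non-zero form inside it lowers the dimension by one. -/
theorem ringKrullDim_quotient_form {F : MvPolynomial (Fin 3) k} {d : ℕ} (hF : F.IsHomogeneous d)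
    (hF0 : F ≠ 0) (hd : 0 < d) :
    ringKrullDim (MvPolynomial (Fin 3) k ⧸ Ideal.span {F}) = (2 : ℕ) := by
  have hdim : ringKrullDim (MvPolynomial (Fin 3) k) = 3 := by
    rw [MvPolynomial.ringKrullDim_of_isNoetherianRing, ringKrullDim_eq_zero_of_field]
    simp
  have hpr : ∀ j, (RingHom.ker (killVars k j)).IsPrime := fun j => RingHom.ker_isPrime _
  have h1 := fun {j : ℕ} (hj : j < 3) =>
    Ideal.height_add_one_le_of_lt_of_isPrime (ker_killVars_lt (k := k) hj)
  have h3 : 3 ≤ (RingHom.ker (killVars k 3)).height := by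
    refine le_trans ?_ (h1 (j := 2) (by norm_num))
    refine le_trans ?_ (add_le_add_left (h1 (j := 1) (by norm_num)) 1)
    refine le_trans ?_ (add_le_add_left (add_le_add_left (h1 (j := 0) (by norm_num)) 1) 1)
    rw [add_assoc, add_assoc]
    exact le_add_self
  have h4 : ((RingHom.ker (killVars k 3)).height : WithBot ℕ∞) = ringKrullDim
      (MvPolynomial (Fin 3) k) := by
    refine le_antisymm Ideal.height_le_ringKrullDim_of_isPrime ?_
    rw [hdim]
    exact WithBot.coe_le_coe.2 h3
  have h5 : F ∈ RingHom.ker (killVars k 3) := by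
    rw [RingHom.mem_ker, F.as_sum, map_sum]
    refine Finset.sum_eq_zero fun e he => ?_
    have h6 := isHomogeneous_iff_degree.1 hF e (mem_support_iff.1 he)
    obtain ⟨i, hi⟩ : ∃ i, e i ≠ 0 := by
      by_contra! h
      rw [Finsupp.degree_eq_sum, Finset.sum_eq_zero fun i _ => h i] at h6
      omega
    rw [killVars, aeval_monomial, Finsupp.prod_fintype _ _ (by simp),
      Finset.prod_eq_zero (Finset.mem_univ i), mul_zero]
    rw [if_pos i.2, zero_pow hi]
  have h6 := Module.ringKrullDim_quotient_add_one_of_mem_nonZeroDivisors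
    (mem_nonZeroDivisors_of_ne_zero hF0) h4 h5
  rw [hdim] at h6
  generalize ringKrullDim (MvPolynomial (Fin 3) k ⧸ Ideal.span {F}) = x at *
  induction x with
  | bot => simp at h6
  | coe x =>
    induction x with
    | top => exact absurd h6 (by decide)
    | coe n =>
      have h8 : (n : ℕ∞) + 1 = 3 := WithBot.coe_injective h6
      have : n + 1 = 3 := by exact_mod_cast h8
      have h7 : n = 2 := by omega
      rw [h7]
      rfl

end KrullDim

/-! ## Frobenius powers -/

section Frobenius

variable {R : Type*} [CommRing R]

theorem frobeniusPower_powerIdeal (p : ℕ) [Fact p.Prime] [CharP R p] {ι : Type*} (x : ι → R)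
    (l : ι → ℕ) (e : ℕ) :
    frobeniusPower (powerIdeal x l) (p ^ e) = powerIdeal x fun i => p ^ e * l i := by
  have : ExpChar R p := ExpChar.prime Fact.out
  have h : frobeniusPower (powerIdeal x l) (p ^ e)
      = (powerIdeal x l).map (iterateFrobenius R p e) := rfl
  rw [h, powerIdeal, Ideal.map_span, ← Set.range_comp, powerIdeal]
  congr 2
  funext i
  simp only [Function.comp_apply, iterateFrobenius_def]
  rw [← pow_mul, mul_comm]

theorem powerIdeal_anti {ι : Type*} (x : ι → R) {l l' : ι → ℕ} (h : l ≤ l') :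
    powerIdeal x l' ≤ powerIdeal x l := by
  rw [powerIdeal, Ideal.span_le]
  rintro _ ⟨i, rfl⟩
  exact Ideal.mem_of_dvd _ (pow_dvd_pow _ (h i)) (Ideal.subset_span ⟨i, rfl⟩)

theorem finrank_quotient_mono {k : Type*} [Field k] [Algebra k R] {I J : Ideal R} (h : I ≤ J)
    [FiniteDimensional k (R ⧸ I)] : Module.finrank k (R ⧸ J) ≤ Module.finrank k (R ⧸ I) :=
  LinearMap.finrank_le_finrank_of_surjective (f := (Ideal.Quotient.factorₐ k h).toLinearMap)
    (Ideal.Quotient.factor_surjective h)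

end Frobenius

/-! ## The limit -/

section Limit

open MvPolynomial Module

theorem tendsto_floor_mul_div {p : ℕ} (hp : 1 < p) (L l c : ℕ) :
    Tendsto (fun e => ((p ^ e * l / L + c : ℕ) : ℝ≥0) / (p : ℝ≥0) ^ e) atTop
      (𝓝 ((l : ℝ≥0) / L)) := by
  have h1 := tendsto_floor_div hp ((l : ℝ≥0) / L)
  have h2 : Tendsto (fun e : ℕ => (c : ℝ≥0) / (p : ℝ≥0) ^ e) atTop (𝓝 0) := by
    have hp1 : (1 : ℝ) < p := by exact_mod_cast hp
    rw [← NNReal.tendsto_coe]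
    push_cast
    exact (tendsto_pow_atTop_atTop_of_one_lt hp1).const_div_atTop _
  have h3 := h1.add h2
  rw [add_zero] at h3
  refine h3.congr fun e => ?_
  rw [← add_div, Nat.cast_add]
  congr 3
  rw [← Nat.floor_div_eq_div (K := ℝ)]
  congr 1
  push_cast
  rw [mul_comm, mul_div_assoc, mul_comm]

theorem IsHanDelta.map_pow_mul {k : Type*} [Field k] {p : ℕ} [Fact p.Prime] [CharP k p]
    {δ : (Fin 3 → ℝ≥0) → ℝ} (hδ : IsHanDelta k p δ) (e : ℕ) (t : Fin 3 → ℝ≥0) :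
    δ (fun r => (p : ℝ≥0) ^ e * t r) = (p : ℝ) ^ e * δ t := by
  induction e with
  | zero => simp
  | succ e ih =>
    have := hδ.map_mul fun r => (p : ℝ≥0) ^ e * t r
    rw [ih] at this
    simpa only [pow_succ', mul_assoc] using this

variable {k : Type*} [Field k] [IsAlgClosed k] {p : ℕ} [Fact p.Prime] [CharP k p]
  {F : MvPolynomial (Fin 3) k} {d L : ℕ} {O : Matrix (Fin 3) (Fin 3) ℕ} {κ : Fin 3 → ℕ}
  {g : (Fin 3 → ℝ≥0) → Fin 3 → ℝ≥0} {δ : (Fin 3 → ℝ≥0) → ℝ}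

variable (d L g δ) in
/-- The limit of `dim (R / (x_r ^ (L ν_r) : r)) / p ^ (2 e)` if `ν_r / p ^ e` tends to `t_r`. -/
def limitFn (t : Fin 3 → ℝ≥0) : ℝ :=
  (L : ℝ) ^ 2 / (4 * d) * ((d : ℝ) ^ 2 * quadQ t + δ (g t) ^ 2)

theorem continuous_quadQ : Continuous quadQ := by
  unfold quadQ
  fun_prop

theorem continuous_limitFn (hδ : Continuous δ) (hg : Continuous g) :
    Continuous (limitFn d L g δ) := by
  have := continuous_quadQ
  unfold limitFn
  fun_prop

/-- By homogeneity of `g` and `δ`, the main term divided by `p ^ (2 e)` is exactly `limitFn` at `ν /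
p ^ e`, while the linear error divided by `p ^ (2 e)` tends to zero. -/
theorem tendsto_finrank_div (H : IsCover F d L O κ) (hred : HasReduction k d O g)
    (hg : Continuous g) (hgm : ∀ (c : ℝ≥0) t, g (fun r => c * t r) = fun r => c * g t r)
    (hδ : IsHanDelta k p δ) {ν : ℕ → Fin 3 → ℕ} {τ : Fin 3 → ℝ≥0}
    (hν : ∀ r, Tendsto (fun e => (ν e r : ℝ≥0) / (p : ℝ≥0) ^ e) atTop (𝓝 (τ r))) :
    Tendsto (fun e => (finrank k ((MvPolynomial (Fin 3) k ⧸ Ideal.span {F}) ⧸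
      powerIdeal (varF F) fun r => L * ν e r) : ℝ) / ((p : ℝ) ^ e) ^ 2) atTop
      (𝓝 (limitFn d L g δ τ)) := by
  have hp0 : (0 : ℝ) < p := by exact_mod_cast (Fact.out : p.Prime).pos
  have hp1 : (1 : ℝ) < p := by exact_mod_cast (Fact.out : p.Prime).one_lt
  have hd : (0 : ℝ) < d := by exact_mod_cast H.d_pos
  have hL : (0 : ℝ) < L := by exact_mod_cast H.L_pos
  obtain ⟨C, hC, hbound⟩ := H.exists_abs_finrank_sub_le
  have hlim : Tendsto (fun e => limitFn d L g δ fun r => (ν e r : ℝ≥0) / (p : ℝ≥0) ^ e) atTop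
      (𝓝 (limitFn d L g δ τ)) :=
    ((continuous_limitFn hδ.1 hg).tendsto τ).comp (tendsto_pi_nhds.2 hν)
  have hν' : ∀ r, Tendsto (fun e => (ν e r : ℝ) / (p : ℝ) ^ e) atTop (𝓝 (τ r)) := fun r => by
    have := (NNReal.continuous_coe.tendsto (τ r)).comp (hν r)
    refine this.congr fun e => ?_
    simp
  have hinv : Tendsto (fun e : ℕ => ((p : ℝ) ^ e)⁻¹) atTop (𝓝 0) :=
    (tendsto_pow_atTop_atTop_of_one_lt hp1).inv_tendsto_atTop
  have herr : Tendsto (fun e => C / (d * L) * ((∑ r, (ν e r : ℝ) / (p : ℝ) ^ e + ((p : ℝ) ^ e)⁻¹)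
      * ((p : ℝ) ^ e)⁻¹)) atTop (𝓝 0) := by
    have := ((tendsto_finsetSum Finset.univ fun r _ => hν' r).add hinv).mul hinv
    simpa using this.const_mul (C / (d * L))
  refine (tendsto_iff_of_dist (squeeze_zero (fun _ => dist_nonneg) (fun e => ?_) herr)).2 hlim
  obtain ⟨m, m', u, hm, hgap, hu⟩ := hred (ν e)
  have hb := hbound (ν e) m m' hm
  have hq : (0 : ℝ) < (p : ℝ) ^ e := by positivity
  have hq' : (p : ℝ≥0) ^ e ≠ 0 := by
    have : (p : ℝ≥0) ≠ 0 := by exact_mod_cast (Fact.out : p.Prime).ne_zero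
    positivity
  have hδu : (p : ℝ) ^ e * δ (g fun r => (ν e r : ℝ≥0) / (p : ℝ≥0) ^ e) = |(m : ℝ) - m'| := by
    rw [← hδ.map_pow_mul, ← hgm]
    have h1 : (fun r => (p : ℝ≥0) ^ e * ((ν e r : ℝ≥0) / (p : ℝ≥0) ^ e))
        = fun r => (ν e r : ℝ≥0) := by
      funext r
      rw [mul_div_cancel₀ _ hq']
    rw [h1, hu]
    have h2 := hδ.2 0 u
    simp only [pow_zero, div_one] at h2
    rw [h2, hgap]
    push_cast
    rfl
  have hδ2 : (δ (g fun r => (ν e r : ℝ≥0) / (p : ℝ≥0) ^ e)) ^ 2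
      = ((m : ℝ) - m') ^ 2 / ((p : ℝ) ^ e) ^ 2 := by
    rw [← sq_abs ((m : ℝ) - m'), ← hδu]
    field_simp
  have hQ : quadQ (fun r => (ν e r : ℝ≥0) / (p : ℝ≥0) ^ e)
      = quadQ (fun r => (ν e r : ℝ≥0)) / ((p : ℝ) ^ e) ^ 2 := by
    simp only [quadQ]
    push_cast
    field_simp
  rw [Real.dist_eq, limitFn, hδ2, hQ]
  set x : ℝ := (finrank k ((MvPolynomial (Fin 3) k ⧸ Ideal.span {F}) ⧸
      powerIdeal (varF F) fun r => L * ν e r) : ℝ)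
  have h3 : x / ((p : ℝ) ^ e) ^ 2 - (L : ℝ) ^ 2 / (4 * d) * ((d : ℝ) ^ 2 *
      (quadQ (fun r => (ν e r : ℝ≥0)) / ((p : ℝ) ^ e) ^ 2) + ((m : ℝ) - m') ^ 2 / ((p : ℝ) ^ e) ^ 2)
      = ((d : ℝ) * L * x - (L : ℝ) ^ 3 / 4 * ((d : ℝ) ^ 2 * quadQ (fun r => (ν e r : ℝ≥0))
          + ((m : ℝ) - m') ^ 2)) / (d * L * ((p : ℝ) ^ e) ^ 2) := by
    field_simp
  have h4 : C / (d * L) * ((∑ r, (ν e r : ℝ) / (p : ℝ) ^ e + ((p : ℝ) ^ e)⁻¹) * ((p : ℝ) ^ e)⁻¹)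
      = C * (∑ r, (ν e r : ℝ) + 1) / (d * L * ((p : ℝ) ^ e) ^ 2) := by
    rw [← Finset.sum_div]
    field_simp
  have h5 : (0 : ℝ) < d * L * ((p : ℝ) ^ e) ^ 2 := by positivity
  rw [h3, h4, abs_div, abs_of_pos h5]
  exact div_le_div_of_nonneg_right hb h5.le

/-- The Hilbert-Kunz multiplicity of a curve covered by a Fermat curve. -/
theorem hasHKM_of_isCover (H : IsCover F d L O κ) (hred : HasReduction k d O g)
    (hg : Continuous g) (hgm : ∀ (c : ℝ≥0) t, g (fun r => c * t r) = fun r => c * g t r)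
    (hδ : IsHanDelta k p δ) (l : Fin 3 → ℕ) :
    HasHKM k p (powerIdeal (varF F) l)
      (hkValue δ d L (quadQ fun r => (l r : ℝ≥0)) (g fun r => (l r : ℝ≥0))) := by
  refine ⟨2, ringKrullDim_quotient_form H.hom H.irr.ne_zero H.d_pos, ?_⟩
  have hp : 1 < p := (Fact.out : p.Prime).one_lt
  have hL : (0 : ℝ) < L := by exact_mod_cast H.L_pos
  have hd : (0 : ℝ) < d := by exact_mod_cast H.d_pos
  have hval : hkValue δ d L (quadQ fun r => (l r : ℝ≥0)) (g fun r => (l r : ℝ≥0))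
      = limitFn d L g δ fun r => (l r : ℝ≥0) / L := by
    have h1 : g (fun r => (l r : ℝ≥0) / L) = fun r => g (fun r => (l r : ℝ≥0)) r / L := by
      have := hgm (L : ℝ≥0)⁻¹ fun r => (l r : ℝ≥0)
      simp only [div_eq_inv_mul]
      exact this
    have h2 : quadQ (fun r => (l r : ℝ≥0) / L) = quadQ (fun r => (l r : ℝ≥0)) / (L : ℝ) ^ 2 := by
      simp only [quadQ]
      push_cast
      field_simp
    rw [limitFn, h1, h2, hkValue]
    field_simp
  have hchar : CharP (MvPolynomial (Fin 3) k ⧸ Ideal.span {F}) p := by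
    have hne : Nontrivial (MvPolynomial (Fin 3) k ⧸ Ideal.span {F}) :=
      Ideal.Quotient.nontrivial_iff.2 fun h =>
        H.irr.not_isUnit (Ideal.span_singleton_eq_top.1 h)
    exact charP_of_injective_algebraMap (algebraMap k _).injective p
  rw [hval]
  -- The exponents `p ^ e * l r` lie between consecutive multiples of `L`, and both multiples,
  -- divided by `L * p ^ e`, tend to `l r / L`. Dimensions are monotone in the exponents.
  have h1 := tendsto_finrank_div H hred hg hgm hδ (ν := fun e r => p ^ e * l r / L + 0)
    fun r => tendsto_floor_mul_div hp L (l r) 0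
  have h2 := tendsto_finrank_div H hred hg hgm hδ (ν := fun e r => p ^ e * l r / L + 1)
    fun r => tendsto_floor_mul_div hp L (l r) 1
  refine tendsto_of_tendsto_of_tendsto_of_le_of_le h1 h2 (fun e => ?_) fun e => ?_
  · refine div_le_div_of_nonneg_right (Nat.cast_le.2 ?_) (by positivity)
    rw [hkf, frobeniusPower_powerIdeal p]
    have := finiteDimensional_quotient (F := F) fun r => p ^ e * l r
    exact finrank_quotient_mono (powerIdeal_anti _ fun r => Nat.mul_div_le _ _)
  · refine div_le_div_of_nonneg_right (Nat.cast_le.2 ?_) (by positivity)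
    rw [hkf, frobeniusPower_powerIdeal p]
    have := finiteDimensional_quotient (F := F) fun r => L * (p ^ e * l r / L + 1)
    exact finrank_quotient_mono (powerIdeal_anti _ fun r =>
      (Nat.lt_mul_div_succ _ H.L_pos).le)

end Limit

/-! ## Extensions of Hilbert-Kunz multiplicities -/

section Extension

variable {k : Type*} [Field k] {p : ℕ}

theorem HasHKM.unique {R : Type*} [CommRing R] [Algebra k R] {I : Ideal R} {m m' : ℝ}
    (h : HasHKM k p I m) (h' : HasHKM k p I m') : m = m' := by
  obtain ⟨n, hn, h⟩ := h
  obtain ⟨n', hn', h'⟩ := h'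
  have : n = n' := by
    rw [hn] at hn'
    exact_mod_cast hn'
  subst this
  exact tendsto_nhds_unique h h'

/-- The behaviour under multiplication by `p` propagates the values from integral points to all
points with coordinates in `ℕ[1/p]`, and these are dense. -/
theorem IsHKMExtension.eq {R : Type*} [CommRing R] [Algebra k R] (hp : 1 < p) {x : Fin 3 → R}
    {μ μ' : (Fin 3 → ℝ≥0) → ℝ} (h : IsHKMExtension k p x μ) (h' : IsHKMExtension k p x μ') :
    μ = μ' := by
  obtain ⟨hc, ⟨n, hn, hm⟩, hl⟩ := h
  obtain ⟨hc', ⟨n', hn', hm'⟩, hl'⟩ := h'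
  have hnn : n = n' := by
    rw [hn] at hn'
    exact_mod_cast hn'
  subst hnn
  have hp0 : (p : ℝ) ≠ 0 := by
    have : p ≠ 0 := by omega
    exact_mod_cast this
  have hp0' : (p : ℝ≥0) ≠ 0 := by exact_mod_cast hp0
  have key : ∀ (e : ℕ) (l : Fin 3 → ℕ), μ (fun i => (l i : ℝ≥0) / (p : ℝ≥0) ^ e)
      = μ' fun i => (l i : ℝ≥0) / (p : ℝ≥0) ^ e := by
    intro e l
    induction e with
    | zero => simpa using (hl l).unique (hl' l)
    | succ e ih =>
      have h1 : (fun i => (p : ℝ≥0) * ((l i : ℝ≥0) / (p : ℝ≥0) ^ (e + 1)))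
          = fun i => (l i : ℝ≥0) / (p : ℝ≥0) ^ e := by
        funext i
        rw [pow_succ]
        field_simp
      have h2 := hm fun i => (l i : ℝ≥0) / (p : ℝ≥0) ^ (e + 1)
      have h3 := hm' fun i => (l i : ℝ≥0) / (p : ℝ≥0) ^ (e + 1)
      rw [h1] at h2 h3
      exact mul_left_cancel₀ (pow_ne_zero n hp0) (h2.symm.trans (ih.trans h3))
  refine hc.ext_on (dense_padicPoints hp) hc' ?_
  rintro _ ⟨⟨e, l⟩, rfl⟩
  exact key e l

theorem map_frobeniusPower {R R' : Type*} [CommRing R] [CommRing R'] (e : R ≃+* R') (I : Ideal R)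
    (q : ℕ) : (frobeniusPower I q).map (e : R →+* R') = frobeniusPower (I.map (e : R →+* R')) q := by
  rw [frobeniusPower, frobeniusPower, Ideal.map_span]
  congr 1
  ext y
  constructor
  · rintro ⟨_, ⟨f, hf, rfl⟩, rfl⟩
    exact ⟨e f, Ideal.mem_map_of_mem (e : R →+* R') hf, (map_pow e f q).symm⟩
  · rintro ⟨f, hf, rfl⟩
    obtain ⟨g, hg, rfl⟩ := (Ideal.mem_map_iff_of_surjective (e : R →+* R') e.surjective).1 hf
    exact ⟨g ^ q, ⟨g, hg, rfl⟩, map_pow e g q⟩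

theorem HasHKM.of_algEquiv {R R' : Type*} [CommRing R] [Algebra k R] [CommRing R'] [Algebra k R']
    (e : R ≃ₐ[k] R') {I : Ideal R} {m : ℝ}
    (h : HasHKM k p (I.map ((e : R ≃+* R') : R →+* R')) m) : HasHKM k p I m := by
  obtain ⟨n, hn, h⟩ := h
  refine ⟨n, (ringKrullDim_eq_of_ringEquiv (e : R ≃+* R')).trans hn, h.congr fun i => ?_⟩
  have := (Ideal.quotientEquivAlg (R₁ := k) (frobeniusPower I (p ^ i)) _ e
    (map_frobeniusPower (e : R ≃+* R') I (p ^ i)).symm).toLinearEquiv.finrank_eq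
  rw [hkf, hkf, this]

theorem map_powerIdeal {R R' : Type*} [CommRing R] [CommRing R'] (e : R ≃+* R') {ι : Type*}
    {x : ι → R} {x' : ι → R'} (σ : Equiv.Perm ι) (hx : ∀ i, e (x (σ i)) = x' i) (l : ι → ℕ) :
    (powerIdeal x l).map (e : R →+* R') = powerIdeal x' (l ∘ σ) := by
  rw [powerIdeal, powerIdeal, Ideal.map_span, ← Set.range_comp, ← σ.surjective.range_comp]
  congr 2
  funext i
  simp [← hx]

/-- Transport of extensions along isomorphisms permuting the generators. -/
theorem IsHKMExtension.of_algEquiv {R R' : Type*} [CommRing R] [Algebra k R] [CommRing R']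
    [Algebra k R'] (e : R ≃ₐ[k] R') {ι : Type*} {x : ι → R} {x' : ι → R'} (σ : Equiv.Perm ι)
    (hx : ∀ i, e (x (σ i)) = x' i) {μ : (ι → ℝ≥0) → ℝ} (h : IsHKMExtension k p x' μ) :
    IsHKMExtension k p x fun t => μ (t ∘ σ) := by
  obtain ⟨hc, ⟨n, hn, hm⟩, hl⟩ := h
  refine ⟨hc.comp (by fun_prop), ⟨n, (ringKrullDim_eq_of_ringEquiv (e : R ≃+* R')).trans hn,
    fun t => hm (t ∘ σ)⟩, fun l => HasHKM.of_algEquiv e ?_⟩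
  rw [map_powerIdeal (e : R ≃+* R') σ hx]
  exact hl (l ∘ σ)

open MvPolynomial in
/-- The extension of the Hilbert-Kunz multiplicities of a curve covered by a Fermat curve. -/
theorem isHKMExtension_of_isCover [IsAlgClosed k] [Fact p.Prime] [CharP k p]
    {F : MvPolynomial (Fin 3) k} {d L : ℕ} {O : Matrix (Fin 3) (Fin 3) ℕ} {κ : Fin 3 → ℕ}
    {g : (Fin 3 → ℝ≥0) → Fin 3 → ℝ≥0} {δ : (Fin 3 → ℝ≥0) → ℝ} (H : IsCover F d L O κ)
    (hred : HasReduction k d O g) (hg : Continuous g)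
    (hgm : ∀ (c : ℝ≥0) t, g (fun r => c * t r) = fun r => c * g t r) (hδ : IsHanDelta k p δ) :
    IsHKMExtension k p (varF F) fun t => hkValue δ d L (quadQ t) (g t) := by
  refine ⟨?_, ⟨2, ringKrullDim_quotient_form H.hom H.irr.ne_zero H.d_pos, fun t => ?_⟩,
    fun l => hasHKM_of_isCover H hred hg hgm hδ l⟩
  · have h1 := continuous_quadQ
    have h2 := hδ.1
    have h3 : Continuous fun t => δ fun i => g t i / (L : ℝ≥0) :=
      h2.comp (continuous_pi fun i => by
        have : Continuous fun t => g t i := (continuous_apply i).comp hg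
        exact this.div_const _)
    unfold hkValue
    fun_prop
  · have h1 : δ (fun i => (p : ℝ≥0) * g t i / L) = p * δ fun i => g t i / L := by
      rw [← hδ.map_mul]
      simp only [mul_div_assoc]
    have h2 : quadQ (fun i => (p : ℝ≥0) * t i) = (p : ℝ) ^ 2 * quadQ t := by
      simp only [quadQ]
      push_cast
      ring
    beta_reduce
    rw [hgm, hkValue, h1, h2, hkValue]
    ring

end Extension

/-! ## The extension for the two normal forms -/

section TypeExtension

variable {d : ℕ} {a b c : Fin 3 → ℕ}

theorem toNNReal_coe_mul (x : ℝ≥0) (y : ℝ) : ((x : ℝ) * y).toNNReal = x * y.toNNReal := by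
  rw [Real.toNNReal_mul x.coe_nonneg, Real.toNNReal_coe]

theorem alpha'_mul (x : ℝ≥0) (t : Fin 3 → ℝ≥0) :
    alpha' d b c (fun r => x * t r) = x * alpha' d b c t := by
  simp only [alpha']
  push_cast
  ring

theorem beta'_mul (x : ℝ≥0) (t : Fin 3 → ℝ≥0) :
    beta' d a c (fun r => x * t r) = x * beta' d a c t := by
  simp only [beta']
  push_cast
  ring

theorem gamma'_mul (x : ℝ≥0) (t : Fin 3 → ℝ≥0) :
    gamma' d a b (fun r => x * t r) = x * gamma' d a b t := by
  simp only [gamma']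
  push_cast
  ring

theorem abgI_mul (x : ℝ≥0) (t : Fin 3 → ℝ≥0) :
    abgI d a b c (fun r => x * t r) = fun r => x * abgI d a b c t r := by
  funext r
  simp only [abgI, alpha'_mul, beta'_mul, gamma'_mul, ← mul_neg, toNNReal_coe_mul, ← mul_add]
  fin_cases r <;> rfl

theorem abgII_mul (x : ℝ≥0) (t : Fin 3 → ℝ≥0) :
    abgII d a b c (fun r => x * t r) = fun r => x * abgII d a b c t r := by
  funext r
  simp only [abgII, alpha'_mul, beta'_mul, gamma'_mul, ← mul_neg, toNNReal_coe_mul, ← mul_add]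
  fin_cases r <;> rfl

theorem continuous_alpha' : Continuous (alpha' d b c) := by
  unfold alpha'
  fun_prop

theorem continuous_beta' : Continuous (beta' d a c) := by
  unfold beta'
  fun_prop

theorem continuous_gamma' : Continuous (gamma' d a b) := by
  unfold gamma'
  fun_prop

theorem continuous_abgI : Continuous (abgI d a b c) := by
  have h1 := continuous_alpha' (d := d) (b := b) (c := c)
  have h2 := continuous_beta' (d := d) (a := a) (c := c)
  have h3 := continuous_gamma' (d := d) (a := a) (b := b)
  refine continuous_pi fun i => ?_
  fin_cases i
  · exact (continuous_real_toNNReal.comp h1).add (continuous_real_toNNReal.comp h3.neg)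
  · exact (continuous_real_toNNReal.comp h2).add (continuous_real_toNNReal.comp h1.neg)
  · exact (continuous_real_toNNReal.comp h3).add (continuous_real_toNNReal.comp h2.neg)

theorem continuous_abgII : Continuous (abgII d a b c) := by
  have h1 := continuous_alpha' (d := d) (b := b) (c := c)
  have h2 := continuous_beta' (d := d) (a := a) (c := c)
  have h3 := continuous_gamma' (d := d) (a := a) (b := b)
  refine continuous_pi fun i => ?_
  fin_cases i
  · exact ((continuous_real_toNNReal.comp h1).add (continuous_real_toNNReal.comp h2.neg)).add
      (continuous_real_toNNReal.comp h3.neg)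
  · exact continuous_real_toNNReal.comp h2
  · exact (continuous_real_toNNReal.comp h3).add (continuous_real_toNNReal.comp h1.neg)

variable {k : Type*} [Field k] [IsAlgClosed k] {p : ℕ} [Fact p.Prime] [CharP k p]
  {δ : (Fin 3 → ℝ≥0) → ℝ}

theorem isHKMExtension_typeI (hI : IsTypeI d a b c) (hab : a ≠ b) (hac : a ≠ c) (hbc : b ≠ c)
    (hirr : Irreducible (trinomial k a b c)) (hhom : (trinomial k a b c).IsHomogeneous d)
    (hδ : IsHanDelta k p δ) : IsHKMExtension k p (coords k a b c) fun t =>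
      hkValue δ d (lam d a b c) (quadQ t) (abgI d a b c t) := by
  obtain ⟨ha, hb, hc⟩ := sum_eq_of_trinomial hab hac hbc hhom
  exact isHKMExtension_of_isCover (isCover_typeI hI hab hac hbc hirr hhom)
    (hasReduction_typeI hI ha hb hc) continuous_abgI abgI_mul hδ

theorem isHKMExtension_typeII (hII : IsTypeII d a b c) (hab : a ≠ b) (hac : a ≠ c) (hbc : b ≠ c)
    (hirr : Irreducible (trinomial k a b c)) (hhom : (trinomial k a b c).IsHomogeneous d)
    (hδ : IsHanDelta k p δ) : IsHKMExtension k p (coords k a b c) fun t =>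
      hkValue δ d (lam d a b c) (quadQ t) (abgII d a b c t) := by
  obtain ⟨-, hb, hc⟩ := sum_eq_of_trinomial hab hac hbc hhom
  exact isHKMExtension_of_isCover (isCover_typeII hII hab hac hbc hirr hhom)
    (hasReduction_typeII hII hb hc) continuous_abgII abgII_mul hδ

theorem quadQ_const (s : ℝ≥0) : quadQ (fun _ => s) = 3 * (s : ℝ) ^ 2 := by
  simp only [quadQ]
  ring

theorem toNNReal_neg_coe (x : ℝ≥0) : (-(x : ℝ)).toNNReal = 0 :=
  Real.toNNReal_of_nonpos (neg_nonpos.2 x.coe_nonneg)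

/-- For equal exponents `α'`, `β'`, `γ'` are multiples of sums of two dominant exponents minus `d`;
these are non-negative, so no negative parts occur. -/
theorem abgI_const (hI : IsTypeI d a b c) (ha : ∑ i, a i = d) (hb : ∑ i, b i = d)
    (hc : ∑ i, c i = d) (s : ℝ≥0) : abgI d a b c (fun _ => s) =
      ![((b 1 + c 2 - d : ℕ) : ℝ≥0) * s, ((a 0 + c 2 - d : ℕ) : ℝ≥0) * s,
        ((a 0 + b 1 - d : ℕ) : ℝ≥0) * s] := by
  obtain ⟨h1, h2, h3, h4, h5, h6⟩ := hI
  simp only [Fin.sum_univ_three, h2, h3, h5, add_zero, zero_add] at ha hb hc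
  obtain ⟨x, hx⟩ := Nat.exists_eq_add_of_le (show d ≤ b 1 + c 2 by omega)
  obtain ⟨y, hy⟩ := Nat.exists_eq_add_of_le (show d ≤ a 0 + c 2 by omega)
  obtain ⟨z, hz⟩ := Nat.exists_eq_add_of_le (show d ≤ a 0 + b 1 by omega)
  simp only [hx, hy, hz, Nat.add_sub_cancel_left]
  have ha' : (a 0 : ℝ) + a 1 = d := by exact_mod_cast ha
  have hb' : (b 1 : ℝ) + b 2 = d := by exact_mod_cast hb
  have hc' : (c 0 : ℝ) + c 2 = d := by exact_mod_cast hc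
  have hx' : (b 1 : ℝ) + c 2 = d + x := by exact_mod_cast hx
  have hy' : (a 0 : ℝ) + c 2 = d + y := by exact_mod_cast hy
  have hz' : (a 0 : ℝ) + b 1 = d + z := by exact_mod_cast hz
  have e1 : alpha' d b c (fun _ => s) = (x * s : ℝ≥0) := by
    simp only [alpha', h3, h5]
    push_cast
    linear_combination (s : ℝ) * hx' - s * hb' - s * hc'
  have e2 : beta' d a c (fun _ => s) = (y * s : ℝ≥0) := by
    simp only [beta', h2, h5]
    push_cast
    linear_combination (s : ℝ) * hy' - s * ha' - s * hc'
  have e3 : gamma' d a b (fun _ => s) = (z * s : ℝ≥0) := by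
    simp only [gamma', h2, h3]
    push_cast
    linear_combination (s : ℝ) * hz' - s * ha' - s * hb'
  rw [abgI, e1, e2, e3]
  simp only [Real.toNNReal_coe, toNNReal_neg_coe, add_zero]

theorem abgII_const (hII : IsTypeII d a b c) (hb : ∑ i, b i = d) (hc : ∑ i, c i = d) (s : ℝ≥0) :
    abgII d a b c (fun _ => s) =
      ![((b 1 + c 2 - d : ℕ) : ℝ≥0) * s, ((a 0 + c 2 - d : ℕ) : ℝ≥0) * s,
        ((a 0 + b 1 - d : ℕ) : ℝ≥0) * s] := by
  obtain ⟨h1, h2, h3, h4, h5, h6⟩ := hII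
  simp only [Fin.sum_univ_three, h5, zero_add] at hb hc
  obtain ⟨x, hx⟩ := Nat.exists_eq_add_of_le (show d ≤ b 1 + c 2 by omega)
  simp only [hx, h1, Nat.add_sub_cancel_left]
  have hb' : (b 0 : ℝ) + b 1 + b 2 = d := by exact_mod_cast hb
  have hc' : (c 1 : ℝ) + c 2 = d := by exact_mod_cast hc
  have hx' : (b 1 : ℝ) + c 2 = d + x := by exact_mod_cast hx
  have e1 : alpha' d b c (fun _ => s) = (x * s : ℝ≥0) := by
    simp only [alpha', h5]
    push_cast
    linear_combination (s : ℝ) * hx' - s * hb' - s * hc'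
  have e2 : beta' d a c (fun _ => s) = (c 2 * s : ℝ≥0) := by
    simp only [beta', h2, h3, h5]
    push_cast
    linear_combination (-(s : ℝ)) * hc'
  have e3 : gamma' d a b (fun _ => s) = (b 1 * s : ℝ≥0) := by
    simp only [gamma', h2, h3]
    push_cast
    linear_combination (-(s : ℝ)) * hb'
  rw [abgII, e1, e2, e3]
  simp only [Real.toNNReal_coe, toNNReal_neg_coe, add_zero]

end TypeExtension

/-! ## Classification of regular irreducible trinomials -/

section Classification

open MvPolynomial

variable {k : Type*} [Field k] {a b c : Fin 3 → ℕ} {d : ℕ}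

theorem aeval_monomial_expo_vertex (i : Fin 3) (v : Fin 3 → ℕ) :
    aeval (fun j => if j = i then 1 else X j : Fin 3 → MvPolynomial (Fin 3) k)
      (monomial (expo v) (1 : k)) = monomial (expo (Function.update v i 0)) 1 := by
  rw [monomial_expo, monomial_expo, map_prod]
  refine Finset.prod_congr rfl fun j _ => ?_
  rw [map_pow, aeval_X]
  by_cases h : j = i
  · subst h
    simp
  · rw [if_neg h, Function.update_of_ne h]

theorem degree_expo_update (i : Fin 3) (v : Fin 3 → ℕ) :
    (expo (Function.update v i 0)).degree + v i = ∑ j, v j := by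
  rw [Finsupp.degree_eq_sum]
  simp only [expo_apply]
  rw [← Finset.add_sum_erase _ _ (Finset.mem_univ i),
    ← Finset.add_sum_erase Finset.univ v (Finset.mem_univ i), Function.update_self, zero_add,
    add_comm]
  congr 1
  exact Finset.sum_congr rfl fun j hj => Function.update_of_ne (Finset.ne_of_mem_erase hj) _ _

/-- Setting `X i = 1` in a monomial of degree `d` leaves degree `d` minus its exponent at `i`. If no
exponent at `i` exceeds `d / 2`, nothing of degree below `d / 2` remains. -/
theorem exists_lt_of_multAtVertex_lt (ha : ∑ j, a j = d) (hb : ∑ j, b j = d) (hc : ∑ j, c j = d)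
    {i : Fin 3} (h : 2 * multAtVertex (trinomial k a b c) i < (d : ℕ∞)) :
    ∃ s, d < 2 * (![a, b, c] : Fin 3 → Fin 3 → ℕ) s i := by
  classical
  by_contra! h'
  refine absurd h (not_lt.2 ?_)
  -- With floor division, `d - d / 2` is half of `d` rounded up.
  have h1 : ((d - d / 2 : ℕ) : ℕ∞) ≤ multAtVertex (trinomial k a b c) i := by
    refine MvPowerSeries.nat_le_order fun m hm => ?_
    rw [MvPolynomial.coeff_coe, trinomial_eq, map_add, map_add, aeval_monomial_expo_vertex,
      aeval_monomial_expo_vertex, aeval_monomial_expo_vertex, coeff_add, coeff_add,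
      coeff_monomial, coeff_monomial, coeff_monomial]
    have h2 : ∀ v : Fin 3 → ℕ, ∑ j, v j = d → 2 * v i ≤ d →
        expo (Function.update v i 0) ≠ m := by
      rintro v hv hvi rfl
      have := degree_expo_update i v
      omega
    have h3 := h' 0
    have h4 := h' 1
    have h5 := h' 2
    rw [if_neg (h2 a ha h3), if_neg (h2 b hb h4), if_neg (h2 c hc h5)]
    simp
  calc (d : ℕ∞) ≤ 2 * ((d - d / 2 : ℕ) : ℕ∞) := by
        have : d ≤ 2 * (d - d / 2) := by omega
        exact_mod_cast this
    _ ≤ _ := by gcongr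

/-- Otherwise `X i` divides the trinomial, which by irreducibility would be a scalar multiple of `X
i`; it has too many terms for that. -/
theorem exists_eq_zero_of_irreducible (hab : a ≠ b) (hac : a ≠ c) (hbc : b ≠ c)
    (hirr : Irreducible (trinomial k a b c)) (i : Fin 3) :
    ∃ s, (![a, b, c] : Fin 3 → Fin 3 → ℕ) s i = 0 := by
  by_contra! h
  have h1 : ∀ v : Fin 3 → ℕ, v i ≠ 0 → (X i : MvPolynomial (Fin 3) k) ∣ ∏ j, X j ^ v j :=
    fun v hv => (dvd_pow_self _ hv).trans (Finset.dvd_prod_of_mem _ (Finset.mem_univ i))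
  have h2 : (X i : MvPolynomial (Fin 3) k) ∣ trinomial k a b c :=
    dvd_add (dvd_add (h1 a (h 0)) (h1 b (h 1))) (h1 c (h 2))
  obtain ⟨g, hg⟩ := h2
  have h3 : IsUnit g :=
    (hirr.isUnit_or_isUnit hg).resolve_left (X_prime (R := k)).irreducible.not_isUnit
  refine trinomial_not_dvd_X hab hac hbc hirr i ?_
  rw [hg]
  exact h3.mul_right_dvd.2 dvd_rfl

/-- Three exponent vectors with dominant diagonal and a zero in each coordinate are of one of the
two types, up to a permutation. -/
theorem exists_perm_isType {w : Fin 3 → Fin 3 → ℕ} (hsum : ∀ s, ∑ i, w s i = d)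
    (hdiag : ∀ i, d < 2 * w i i) (hzero : ∀ i, ∃ s, w s i = 0) : ∃ σ : Equiv.Perm (Fin 3),
      IsTypeI d (w (σ 0) ∘ σ) (w (σ 1) ∘ σ) (w (σ 2) ∘ σ) ∨
      IsTypeII d (w (σ 0) ∘ σ) (w (σ 1) ∘ σ) (w (σ 2) ∘ σ) := by
  have h0 : w 1 0 = 0 ∨ w 2 0 = 0 := by
    obtain ⟨s, hs⟩ := hzero 0
    have := hdiag 0
    fin_cases s <;> simp at hs <;> omega
  have h1 : w 0 1 = 0 ∨ w 2 1 = 0 := by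
    obtain ⟨s, hs⟩ := hzero 1
    have := hdiag 1
    fin_cases s <;> simp at hs <;> omega
  have h2 : w 0 2 = 0 ∨ w 1 2 = 0 := by
    obtain ⟨s, hs⟩ := hzero 2
    have := hdiag 2
    fin_cases s <;> simp at hs <;> omega
  have d0 := hdiag 0
  have d1 := hdiag 1
  have d2 := hdiag 2
  have s0 := hsum 0
  have s1 := hsum 1
  have s2 := hsum 2
  rw [Fin.sum_univ_three] at s0 s1 s2
  have r0 : finRotate 3 0 = 1 := by decide
  have r1 : finRotate 3 1 = 2 := by decide
  have r2 : finRotate 3 2 = 0 := by decide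
  have q0 : (finRotate 3).symm 0 = 2 := by decide
  have q1 : (finRotate 3).symm 1 = 0 := by decide
  have q2 : (finRotate 3).symm 2 = 1 := by decide
  have t0 : Equiv.swap (1 : Fin 3) 2 0 = 0 := by decide
  have t1 : Equiv.swap (0 : Fin 3) 1 2 = 2 := by decide
  have t2 : Equiv.swap (0 : Fin 3) 2 1 = 1 := by decide
  -- Eight placements of the zeros: the two cyclic ones give type I; in the other six some monomial
  -- has two zeros, hence is a pure power, and the type is II.
  rcases h0 with h0 | h0 <;> rcases h1 with h1 | h1 <;> rcases h2 with h2 | h2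
  · exact ⟨Equiv.swap 1 2, Or.inr (by simp [IsTypeII, t0]; omega)⟩
  · exact ⟨finRotate 3, Or.inr (by simp only [IsTypeII, Function.comp_apply, r0, r1, r2]; omega)⟩
  · exact ⟨1, Or.inl (by simp [IsTypeI]; omega)⟩
  · exact ⟨Equiv.swap 0 1, Or.inr (by simp [IsTypeII, t1]; omega)⟩
  · exact ⟨1, Or.inr (by simp [IsTypeII]; omega)⟩
  · exact ⟨Equiv.swap 1 2, Or.inl (by simp [IsTypeI, t0]; omega)⟩
  · exact ⟨Equiv.swap 0 2, Or.inr (by simp [IsTypeII, t2]; omega)⟩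
  · exact ⟨(finRotate 3).symm,
      Or.inr (by simp only [IsTypeII, Function.comp_apply, q0, q1, q2]; omega)⟩

theorem exists_perm_isType_trinomial (hab : a ≠ b) (hac : a ≠ c) (hbc : b ≠ c)
    (hirr : Irreducible (trinomial k a b c)) (hhom : (trinomial k a b c).IsHomogeneous d)
    (hreg : IsRegularForm d (trinomial k a b c)) : ∃ σ τ : Equiv.Perm (Fin 3),
      IsTypeI d (![a, b, c] (τ 0) ∘ σ) (![a, b, c] (τ 1) ∘ σ) (![a, b, c] (τ 2) ∘ σ) ∨
      IsTypeII d (![a, b, c] (τ 0) ∘ σ) (![a, b, c] (τ 1) ∘ σ) (![a, b, c] (τ 2) ∘ σ) := by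
  obtain ⟨ha, hb, hc⟩ := sum_eq_of_trinomial hab hac hbc hhom
  have hsum : ∀ s, ∑ i, (![a, b, c] : Fin 3 → Fin 3 → ℕ) s i = d := fun s => by
    fin_cases s
    exacts [ha, hb, hc]
  choose f hf using fun i => exists_lt_of_multAtVertex_lt ha hb hc (hreg i)
  -- A monomial of degree `d` cannot have two exponents above `d / 2`, so different variables
  -- dominate in different monomials.
  have hinj : Function.Injective f := fun i j hij => by
    by_contra hne
    have h1 := hf i
    have h2 := hf j
    rw [← hij] at h2
    have h3 := Finset.add_le_sum (f := (![a, b, c] : Fin 3 → Fin 3 → ℕ) (f i))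
      (fun _ _ => Nat.zero_le _) (Finset.mem_univ i) (Finset.mem_univ j) hne
    rw [hsum] at h3
    omega
  let φ : Equiv.Perm (Fin 3) := Equiv.ofBijective f (Finite.injective_iff_bijective.1 hinj)
  obtain ⟨σ, hσ⟩ := exists_perm_isType (w := fun i => (![a, b, c] : Fin 3 → Fin 3 → ℕ) (φ i))
    (fun i => hsum _) hf fun i => by
      obtain ⟨s, hs⟩ := exists_eq_zero_of_irreducible hab hac hbc hirr i
      exact ⟨φ.symm s, by simpa using hs⟩
  exact ⟨σ, σ.trans φ, hσ⟩

end Classification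

/-! ## Permutations of variables and monomials -/

section Permutation

open MvPolynomial

variable {k : Type*} [Field k] {a b c : Fin 3 → ℕ}

theorem trinomial_eq_sum (w : Fin 3 → Fin 3 → ℕ) :
    trinomial k (w 0) (w 1) (w 2) = ∑ s, ∏ i, X i ^ w s i := by
  rw [Fin.sum_univ_three, trinomial]

theorem trinomial_perm (σ τ : Equiv.Perm (Fin 3)) :
    renameEquiv k σ.symm (trinomial k a b c)
      = trinomial k (![a, b, c] (τ 0) ∘ σ) (![a, b, c] (τ 1) ∘ σ) (![a, b, c] (τ 2) ∘ σ) := by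
  rw [trinomial_eq_sum fun s => ![a, b, c] (τ s) ∘ σ,
    Equiv.sum_comp τ fun s => ∏ i, (X i : MvPolynomial (Fin 3) k) ^ (![a, b, c] s ∘ σ) i,
    show trinomial k a b c = ∑ s, ∏ i, X i ^ ![a, b, c] s i from trinomial_eq_sum ![a, b, c],
    map_sum]
  refine Finset.sum_congr rfl fun s _ => ?_
  rw [map_prod, ← Equiv.prod_comp σ]
  refine Finset.prod_congr rfl fun i _ => ?_
  rw [map_pow, renameEquiv_apply, rename_X, Equiv.symm_apply_apply, Function.comp_apply]

theorem IsHanDelta.hkValue_swap {p : ℕ} [Fact p.Prime] [CharP k p] {δ : (Fin 3 → ℝ≥0) → ℝ}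
    (hδ : IsHanDelta k p δ) (d l : ℕ) (q : ℝ) (u v w : ℝ≥0) :
    hkValue δ d l q ![u, v, w] = hkValue δ d l q ![w, v, u] := by
  have hdiv : ∀ u v w : ℝ≥0, (fun i => (![u, v, w] : Fin 3 → ℝ≥0) i / (l : ℝ≥0))
      = ![u / l, v / l, w / l] := by
    intro u v w
    funext i
    fin_cases i <;> rfl
  rw [hkValue, hkValue, hdiv, hdiv, ← hδ.swap]
  rfl

/-- A regular irreducible trinomial has an extension of its Hilbert-Kunz multiplicities. -/
theorem exists_isHKMExtension [IsAlgClosed k] {p : ℕ} [Fact p.Prime] [CharP k p] {d : ℕ}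
    (hab : a ≠ b) (hac : a ≠ c) (hbc : b ≠ c) (hirr : Irreducible (trinomial k a b c))
    (hhom : (trinomial k a b c).IsHomogeneous d) (hreg : IsRegularForm d (trinomial k a b c)) :
    ∃ μ, IsHKMExtension k p (coords k a b c) μ := by
  obtain ⟨δ, hδ⟩ := exists_isHanDelta k p
  obtain ⟨σ, τ, hστ⟩ := exists_perm_isType_trinomial hab hac hbc hirr hhom hreg
  have hF := trinomial_perm (k := k) (a := a) (b := b) (c := c) σ τ
  have hinj : Function.Injective fun s => (![a, b, c] : Fin 3 → Fin 3 → ℕ) (τ s) ∘ σ := by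
    intro s t hst
    have h1 := σ.surjective.injective_comp_right hst
    have h2 : Function.Injective (![a, b, c] : Fin 3 → Fin 3 → ℕ) := by
      intro i j hij
      fin_cases i <;> fin_cases j <;> simp_all
    exact τ.injective (h2 h1)
  set a' := (![a, b, c] : Fin 3 → Fin 3 → ℕ) (τ 0) ∘ σ
  set b' := (![a, b, c] : Fin 3 → Fin 3 → ℕ) (τ 1) ∘ σ
  set c' := (![a, b, c] : Fin 3 → Fin 3 → ℕ) (τ 2) ∘ σ
  have hab' : a' ≠ b' := fun h => absurd (hinj (a₁ := 0) (a₂ := 1) h) (by decide)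
  have hac' : a' ≠ c' := fun h => absurd (hinj (a₁ := 0) (a₂ := 2) h) (by decide)
  have hbc' : b' ≠ c' := fun h => absurd (hinj (a₁ := 1) (a₂ := 2) h) (by decide)
  have hirr' : Irreducible (trinomial k a' b' c') := by
    rw [← hF]
    exact (MulEquiv.irreducible_iff (renameEquiv k σ.symm)).2 hirr
  have hhom' : (trinomial k a' b' c').IsHomogeneous d := by
    rw [← hF]
    exact hhom.rename_isHomogeneous
  have hμ : ∃ μ, IsHKMExtension k p (coords k a' b' c') μ := by
    rcases hστ with h | h
    · exact ⟨_, isHKMExtension_typeI h hab' hac' hbc' hirr' hhom' hδ⟩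
    · exact ⟨_, isHKMExtension_typeII h hab' hac' hbc' hirr' hhom' hδ⟩
  obtain ⟨μ, hμ⟩ := hμ
  have hspan : Ideal.span {trinomial k a' b' c'} = (Ideal.span {trinomial k a b c}).map
      ((renameEquiv k σ.symm : MvPolynomial (Fin 3) k ≃+* MvPolynomial (Fin 3) k) :
        MvPolynomial (Fin 3) k →+* MvPolynomial (Fin 3) k) := by
    rw [Ideal.map_span, Set.image_singleton, ← hF]
    rfl
  refine ⟨_, IsHKMExtension.of_algEquiv (Ideal.quotientEquivAlg _ _ (renameEquiv k σ.symm) hspan) σ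
    (fun i => ?_) hμ⟩
  change Ideal.Quotient.mk _ (renameEquiv k σ.symm (X (σ i))) = Ideal.Quotient.mk _ (X i)
  rw [renameEquiv_apply, rename_X, Equiv.symm_apply_apply]

end Permutation

end HanMonsky

end

/-! ### Assembly of the theorem from existence, uniqueness, classification and the two formulas. -/

theorem mainTheorem10 (k : Type*) [Field k] [IsAlgClosed k] (p : ℕ) [Fact p.Prime] [CharP k p]
    (d : ℕ) (a b c : Fin 3 → ℕ) (hab : a ≠ b) (hac : a ≠ c) (hbc : b ≠ c)
    (hirr : Irreducible (HanMonsky.trinomial k a b c))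
    (hhom : (HanMonsky.trinomial k a b c).IsHomogeneous d)
    (hreg : HanMonsky.IsRegularForm d (HanMonsky.trinomial k a b c)) :
    -- Han's function and the extension of the Hilbert-Kunz multiplicities are well defined
    (∃! δ : (Fin 3 → ℝ≥0) → ℝ, HanMonsky.IsHanDelta k p δ) ∧
    (∃! μ : (Fin 3 → ℝ≥0) → ℝ, HanMonsky.IsHKMExtension k p (HanMonsky.coords k a b c) μ) ∧
    -- up to the order of the variables and of the monomials, the exponents have type I or II
    (∃ σ τ : Equiv.Perm (Fin 3),
      HanMonsky.IsTypeI d (![a, b, c] (τ 0) ∘ σ) (![a, b, c] (τ 1) ∘ σ) (![a, b, c] (τ 2) ∘ σ) ∨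
      HanMonsky.IsTypeII d (![a, b, c] (τ 0) ∘ σ) (![a, b, c] (τ 1) ∘ σ)
        (![a, b, c] (τ 2) ∘ σ)) ∧
    -- the determinant of the exponents is `d λ` with a positive integer `λ`
    (HanMonsky.IsTypeI d a b c ∨ HanMonsky.IsTypeII d a b c →
      0 < HanMonsky.lam d a b c ∧
      HanMonsky.expDet a b c = (d : ℤ) * (HanMonsky.lam d a b c : ℤ)) ∧
    ∀ δ μ : (Fin 3 → ℝ≥0) → ℝ, HanMonsky.IsHanDelta k p δ →
      HanMonsky.IsHKMExtension k p (HanMonsky.coords k a b c) μ →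
      -- the formula for real exponents and, in particular, for natural numbers, type I
      (HanMonsky.IsTypeI d a b c →
        (∀ t : Fin 3 → ℝ≥0, μ t = HanMonsky.hkValue δ d (HanMonsky.lam d a b c)
          (HanMonsky.quadQ t) (HanMonsky.abgI d a b c t)) ∧
        ∀ l : Fin 3 → ℕ,
          HanMonsky.HasHKM k p (HanMonsky.powerIdeal (HanMonsky.coords k a b c) l)
            (HanMonsky.hkValue δ d (HanMonsky.lam d a b c)
              (HanMonsky.quadQ fun i => (l i : ℝ≥0))
              (HanMonsky.abgI d a b c fun i => (l i : ℝ≥0)))) ∧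
      -- the same for type II
      (HanMonsky.IsTypeII d a b c →
        (∀ t : Fin 3 → ℝ≥0, μ t = HanMonsky.hkValue δ d (HanMonsky.lam d a b c)
          (HanMonsky.quadQ t) (HanMonsky.abgII d a b c t)) ∧
        ∀ l : Fin 3 → ℕ,
          HanMonsky.HasHKM k p (HanMonsky.powerIdeal (HanMonsky.coords k a b c) l)
            (HanMonsky.hkValue δ d (HanMonsky.lam d a b c)
              (HanMonsky.quadQ fun i => (l i : ℝ≥0))
              (HanMonsky.abgII d a b c fun i => (l i : ℝ≥0)))) ∧
      -- the case of equal exponents; the differences below are positive in both types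
      (HanMonsky.IsTypeI d a b c ∨ HanMonsky.IsTypeII d a b c → ∀ s : ℝ≥0,
        μ (fun _ => s) = HanMonsky.hkValue δ d (HanMonsky.lam d a b c) (3 * (s : ℝ) ^ 2)
          ![((a 0 + b 1 - d : ℕ) : ℝ≥0) * s, ((a 0 + c 2 - d : ℕ) : ℝ≥0) * s,
            ((b 1 + c 2 - d : ℕ) : ℝ≥0) * s]) := by
  have hp : 1 < p := (Fact.out : p.Prime).one_lt
  obtain ⟨ha, hb, hc⟩ := HanMonsky.sum_eq_of_trinomial hab hac hbc hhom
  obtain ⟨δ₀, hδ₀⟩ := HanMonsky.exists_isHanDelta k p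
  obtain ⟨μ₀, hμ₀⟩ := HanMonsky.exists_isHKMExtension (p := p) hab hac hbc hirr hhom hreg
  refine ⟨⟨δ₀, hδ₀, fun δ hδ => hδ.eq hδ₀⟩, ⟨μ₀, hμ₀, fun μ hμ => hμ.eq hp hμ₀⟩,
    HanMonsky.exists_perm_isType_trinomial hab hac hbc hirr hhom hreg, ?_, ?_⟩
  · rintro (h | h)
    · have hd := HanMonsky.pos_of_typeI h ha
      obtain ⟨L, hL, hdet, -⟩ := HanMonsky.exists_lam_typeI h ha hb hc
      rw [HanMonsky.lam_of_expDet_eq hd hdet]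
      exact ⟨hL, hdet⟩
    · have hd := HanMonsky.pos_of_typeII h hb
      obtain ⟨L, hL, hdet, -⟩ := HanMonsky.exists_lam_typeII h hb hc
      rw [HanMonsky.lam_of_expDet_eq hd hdet]
      exact ⟨hL, hdet⟩
  · intro δ μ hδ hμ
    refine ⟨fun h => ?_, fun h => ?_, ?_⟩
    · have hE := HanMonsky.isHKMExtension_typeI h hab hac hbc hirr hhom hδ
      exact ⟨fun t => congrFun (hμ.eq hp hE) t, fun l => hE.2.2 l⟩
    · have hE := HanMonsky.isHKMExtension_typeII h hab hac hbc hirr hhom hδ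
      exact ⟨fun t => congrFun (hμ.eq hp hE) t, fun l => hE.2.2 l⟩
    · rintro (h | h) s
      · have hE := HanMonsky.isHKMExtension_typeI h hab hac hbc hirr hhom hδ
        rw [hμ.eq hp hE, hδ.hkValue_swap, ← HanMonsky.abgI_const h ha hb hc, ← HanMonsky.quadQ_const s]
      · have hE := HanMonsky.isHKMExtension_typeII h hab hac hbc hirr hhom hδ
        rw [hμ.eq hp hE, hδ.hkValue_swap, ← HanMonsky.abgII_const h hb hc, ← HanMonsky.quadQ_const s]
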